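/- **Setting.** Let $\mathcal S$ be a measurable space, $\mathcal A$ a finite nonempty action set, $d,H,K\ge 1$ integers and $T=KH$. A nonstationary episodic linear MDP with known measurable feature map $\phi:\mathcal S\times\mathcal A\to\mathbb R^d$ has, in episode $k\in[K]$ and at step $h\in[H]$, transition kernel $P_h^k(E\mid s,a)=\langle\phi(s,a),\mu_{h,k}(E)\rangle$ and deterministic reward $r_h^k(s,a)=\langle\phi(s,a),\theta_{h,k}\rangle\in[0,1]$, where $\theta_{h,k}\in\mathbb R^d$ and $\mu_{h,k}=(\mu^1_{h,k},\dots,\mu^d_{h,k})$ is a vector of finite (signed) measures, both unknown, with $\|\phi(s,a)\|_2\le1$, $\|\theta_{h,k}\|_2\le\sqrt d$ and $\|\mu_{h,k}(E)\|_2\le\sqrt d$ for all measurable $E\subseteq\mathcal S$. The variation budgets are $$B_\theta=\sum_{k=2}^{K}\sum_{h=1}^H\|\theta_{h,k}-\theta_{h,k-1}\|_2,\qquad B_\mu=\sum_{k=2}^{K}\sum_{h=1}^H\ \sup_{E}\|\mu_{h,k}(E)-\mu_{h,k-1}(E)\|_2,$$ the supremum being over the measurable $E\subseteq\mathcal S$.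 **Algorithm (Ada-LSVI-UCB-Restart)** with parameters $c>0$, $b\ge1$, $p\in(0,1)$. Put $M=\lceil b\sqrt{dHT}\rceil$, $N=\lceil T/(MH)\rceil$, $\Delta=\lfloor\log_2M\rfloor+1$. The episodes are divided into $N$ consecutive blocks of $M$ episodes (the last may be shorter). At the beginning of block $i$ a window size $W_i=2^{l}H$, $l\in\{0,\dots,\Delta-1\}$, is drawn by EXP3-P: $l=l_i$ is drawn with probability $$u_{l,i}=(1-\gamma)\frac{e^{\alpha q_{l,i}}}{\sum_{j}e^{\alpha q_{j,i}}}+\frac{\gamma}{\Delta},\qquad q_{l,1}=0,\qquad q_{l,i+1}=q_{l,i}+\frac{\mathbf 1\{l=l_i\}R_i/(MH)+\beta'}{u_{l,i}},$$ where $R_i$ is the total reward received in block $i$, $\alpha=0.95\sqrt{\ln\Delta/(N\Delta)}$, $\beta'=\sqrt{\ln\Delta/(N\Delta)}$ and $\gamma=\min\{1,\,1.05\sqrt{\Delta\ln\Delta/N}\}$. Within block $i$, LSVI-UCB-Restart is run with window $W_i$: epochs of $W_i/H$ episodes start at the beginning of the block (an epoch is cut off at the end of the block). In episode $k$ of an epoch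 whose first episode is $\tau$, for $h=H,\dots,1$, with $V_{H+1}^k=0$ and $\phi_h^l=\phi(s_h^l,a_h^l)$, $$\Lambda_h^k=I+\sum_{l=\tau}^{k-1}\phi_h^l(\phi_h^l)^\top,\qquad w_h^k=(\Lambda_h^k)^{-1}\sum_{l=\tau}^{k-1}\phi_h^l\big[r_h^l(s_h^l,a_h^l)+V_{h+1}^k(s_{h+1}^l)\big],$$ $$Q_h^k(s,a)=\min\Big\{\langle w_h^k,\phi(s,a)\rangle+\beta\sqrt{\phi(s,a)^\top(\Lambda_h^k)^{-1}\phi(s,a)},\ H\Big\},\qquad V_h^k(s)=\max_aQ_h^k(s,a),$$ with $\beta=c\,dH\sqrt{\log(2dT/p)}$, and the policy $\pi^k$ that is greedy with respect to $Q_h^k$ (ties broken by any fixed measurable rule) is executed. The algorithm does not use $B_\theta$ or $B_\mu$. The initial states $s_1^k$ are chosen by an adversary, who may use, for the episodes of a block, everything that happened before that block, but not what happens in the block (in particular, any fixed sequence of initial states is allowed). The dynamic regret is $$\text{Dyn-Reg}(T)=\sum_{k=1}^K\big[V^*_{1,k}(s_1^k)-V^{\pi^k}_{1,k}(s_1^k)\big],\qquad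 V^*_{1,k}=\sup_\pi V^\pi_{1,k}.$$ **Theorem.** There are absolute constants $m\in\mathbb N$ and $c_0>0$ such that for all $c\ge c_0$ and $b\ge1$ there is a constant $C>0$, depending only on $c$ and $b$, with the following property. For all $d,H,K\ge1$, all $p\in(0,1)$, every nonstationary linear MDP as above and every such adversary, with probability at least $1-p$, $$\text{Dyn-Reg}(T)\ \le\ C\,\big(\log(2dT/p)\big)^{m}\,(B_\theta+B_\mu+1)^{1/4}\,d^{5/4}H^{5/4}T^{3/4}.$$ -/

import Mathlib

open MeasureTheory ProbabilityTheory
open scoped RealInnerProductSpace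

universe u v w

noncomputable section

namespace NonstatRL

/-! ### Nonstationary episodic linear MDPs

Episodes are numbered `k = 0, …, K - 1`, the steps of an episode `h = 0, …, H - 1`; data with
an index outside these ranges is never used. -/

/-- The vector `(ν¹(E), …, νᵈ(E)) ∈ ℝᵈ`. -/
def massVec {S : Type u} [MeasurableSpace S] {d : ℕ}
    (ν : Fin d → SignedMeasure S) (E : Set S) : EuclideanSpace ℝ (Fin d) :=
  WithLp.toLp 2 (fun i => ν i E)

/-- The variation norm `sup_E ‖(ν¹(E), …, νᵈ(E))‖₂` of a vector of `d` finite signed measures,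
the supremum being over the measurable sets. (The set of these numbers is bounded, since a finite
signed measure is bounded. For nonnegative measures the norm is `‖ν(S)‖₂`.) -/
def variationNorm {S : Type u} [MeasurableSpace S] {d : ℕ}
    (ν : Fin d → SignedMeasure S) : ℝ :=
  ⨆ E : {E : Set S // MeasurableSet E}, ‖massVec ν E.1‖

/-- A nonstationary episodic linear MDP with `K` episodes of length `H` and a known feature map
`φ : S × A → ℝᵈ`:  `P_h^k(E | s, a) = ⟨φ(s,a), μ_{h,k}(E)⟩`, `r_h^k(s, a) = ⟨φ(s,a), θ_{h,k}⟩`. -/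
structure LinearMDP (S : Type u) (A : Type v) [MeasurableSpace S] [MeasurableSpace A]
    (d H K : ℕ) where
  /-- feature map -/
  φ : S → A → EuclideanSpace ℝ (Fin d)
  /-- reward parameters `θ k h` -/
  θ : ℕ → ℕ → EuclideanSpace ℝ (Fin d)
  /-- transition parameters `μ k h` -/
  μ : ℕ → ℕ → Fin d → SignedMeasure S
  /-- transition kernels `trans k h` -/
  trans : ℕ → ℕ → Kernel (S × A) S
  measurable_φ : ∀ a, Measurable (fun s => φ s a)
  trans_prob : ∀ k < K, ∀ h < H, ∀ s a, IsProbabilityMeasure (trans k h (s, a))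
  trans_linear : ∀ k < K, ∀ h < H, ∀ s a, ∀ E : Set S, MeasurableSet E →
    (trans k h (s, a)).real E = ⟪φ s a, massVec (μ k h) E⟫
  reward_nonneg : ∀ k < K, ∀ h < H, ∀ s a, 0 ≤ ⟪φ s a, θ k h⟫
  reward_le_one : ∀ k < K, ∀ h < H, ∀ s a, ⟪φ s a, θ k h⟫ ≤ 1
  norm_φ_le : ∀ s a, ‖φ s a‖ ≤ 1
  norm_θ_le : ∀ k < K, ∀ h < H, ‖θ k h‖ ≤ √(d : ℝ)
  norm_μ_le : ∀ k < K, ∀ h < H, ∀ E : Set S, MeasurableSet E → ‖massVec (μ k h) E‖ ≤ √(d : ℝ)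

namespace LinearMDP

variable {S : Type u} {A : Type v} [MeasurableSpace S] [MeasurableSpace A] {d H K : ℕ}

/-- The deterministic reward `r_h^k(s, a)`. -/
def reward (𝓜 : LinearMDP S A d H K) (k h : ℕ) (s : S) (a : A) : ℝ := ⟪𝓜.φ s a, 𝓜.θ k h⟫

/-- The variation budget `B_θ`. -/
def varθ (𝓜 : LinearMDP S A d H K) : ℝ :=
  ∑ k ∈ Finset.range (K - 1), ∑ h ∈ Finset.range H, ‖𝓜.θ (k + 1) h - 𝓜.θ k h‖

/-- The variation budget `B_μ`. -/
def varμ (𝓜 : LinearMDP S A d H K) : ℝ :=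
  ∑ k ∈ Finset.range (K - 1), ∑ h ∈ Finset.range H,
    variationNorm (fun i => 𝓜.μ (k + 1) h i - 𝓜.μ k h i)

/-- The value of the policy `π` (a decision rule `π h : S → A` for every step `h`) in episode `k`
with `n` steps to go, by the Bellman equation: the first of the `n` steps is step `H - n`. -/
def valueToGo (𝓜 : LinearMDP S A d H K) (k : ℕ) (π : ℕ → S → A) : ℕ → S → ℝ
  | 0 => fun _ => 0
  | n + 1 => fun s =>
      𝓜.reward k (H - (n + 1)) s (π (H - (n + 1)) s) +
        ∫ s', valueToGo 𝓜 k π n s' ∂(𝓜.trans k (H - (n + 1)) (s, π (H - (n + 1)) s))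

/-- `V^π_{1,k}(s)`: the value of `π` over the whole episode `k` started in `s`. -/
def value (𝓜 : LinearMDP S A d H K) (k : ℕ) (π : ℕ → S → A) (s : S) : ℝ :=
  𝓜.valueToGo k π H s

/-- `V^*_{1,k}(s)`: the supremum of `V^π_{1,k}(s)` over all (measurable) policies. -/
def optValue (𝓜 : LinearMDP S A d H K) (k : ℕ) (s : S) : ℝ :=
  ⨆ π : {π : ℕ → S → A // ∀ h, Measurable (π h)}, 𝓜.value k π.1 s

end LinearMDP

/-- A measurable rule that picks a maximizer of a function on the finite action set
(that is, an arbitrary measurable way of breaking ties). -/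
structure ArgmaxRule (A : Type v) [MeasurableSpace A] where
  pick : (A → ℝ) → A
  measurable_pick : Measurable pick
  le_pick : ∀ (q : A → ℝ) (a : A), q a ≤ q (pick q)

/-! ### Optimistic least-squares value iteration

The arguments `st l h`, `ac l h`, `rw l h` are the state, action and reward of step `h` of episode
`l`. In episode `k` only the episodes `τ ≤ l < k` are used, `τ` being the first episode of the
current epoch. -/

section LSVI

variable {S : Type u} {A : Type v} {d : ℕ}

/-- `Λ_h^k = I + ∑_{l=τ}^{k-1} φ_h^l (φ_h^l)ᵀ`. -/
def gram (φ : S → A → EuclideanSpace ℝ (Fin d)) (st : ℕ → ℕ → S) (ac : ℕ → ℕ → A)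
    (τ k h : ℕ) : Matrix (Fin d) (Fin d) ℝ :=
  1 + ∑ l ∈ Finset.Ico τ k, Matrix.vecMulVec (φ (st l h) (ac l h)) (φ (st l h) (ac l h))

/-- `w_h^k = (Λ_h^k)⁻¹ ∑_{l=τ}^{k-1} φ_h^l [r_h^l + V(s_{h+1}^l)]`, with `V` the value estimate of
step `h + 1`. -/
def weight (φ : S → A → EuclideanSpace ℝ (Fin d)) (st : ℕ → ℕ → S) (ac : ℕ → ℕ → A)
    (rw : ℕ → ℕ → ℝ) (τ k h : ℕ) (V : S → ℝ) : Fin d → ℝ :=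
  Matrix.mulVec (gram φ st ac τ k h)⁻¹
    (fun i => ∑ l ∈ Finset.Ico τ k, φ (st l h) (ac l h) i * (rw l h + V (st l (h + 1))))

/-- `min{⟨w_h^k, φ(s,a)⟩ + β ‖φ(s,a)‖_{(Λ_h^k)⁻¹}, H}`, with `V` the value estimate of step
`h + 1`. -/
def ucbQ (H : ℕ) (β : ℝ) (φ : S → A → EuclideanSpace ℝ (Fin d)) (st : ℕ → ℕ → S)
    (ac : ℕ → ℕ → A) (rw : ℕ → ℕ → ℝ) (τ k h : ℕ) (V : S → ℝ) (s : S) (a : A) : ℝ :=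
  min (weight φ st ac rw τ k h V ⬝ᵥ (φ s a).ofLp +
      β * √((φ s a).ofLp ⬝ᵥ Matrix.mulVec (gram φ st ac τ k h)⁻¹ (φ s a).ofLp)) (H : ℝ)

/-- The value estimate `V_{H-n}^k = max_a Q_{H-n}^k(·, a)`, that is, with `n` steps to go. -/
def lsviV (H : ℕ) (β : ℝ) (φ : S → A → EuclideanSpace ℝ (Fin d)) (st : ℕ → ℕ → S)
    (ac : ℕ → ℕ → A) (rw : ℕ → ℕ → ℝ) (τ k : ℕ) : ℕ → S → ℝ
  | 0 => fun _ => 0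
  | n + 1 => fun s =>
      ⨆ a, ucbQ H β φ st ac rw τ k (H - (n + 1)) (lsviV H β φ st ac rw τ k n) s a

/-- The action-value estimate `Q_h^k`. -/
def lsviQ (H : ℕ) (β : ℝ) (φ : S → A → EuclideanSpace ℝ (Fin d)) (st : ℕ → ℕ → S)
    (ac : ℕ → ℕ → A) (rw : ℕ → ℕ → ℝ) (τ k h : ℕ) (s : S) (a : A) : ℝ :=
  ucbQ H β φ st ac rw τ k h (lsviV H β φ st ac rw τ k (H - (h + 1))) s a

end LSVI

/-! ### EXP3-P -/

/-- Sampling probabilities of EXP3-P: exponential weights of the scores `q`, mixed with the uniform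
distribution. -/
def exp3pProb {n : ℕ} (α γ : ℝ) (q : Fin n → ℝ) (l : Fin n) : ℝ :=
  (1 - γ) * (Real.exp (α * q l) / ∑ j, Real.exp (α * q j)) + γ / n

/-- Cumulative biased importance-weighted gain estimates of EXP3-P before round `i`, if in round
`j` arm `arm j` was played and its gain `gain j ∈ [0, 1]` was observed. -/
def exp3pScore {n : ℕ} (α β γ : ℝ) (arm : ℕ → Fin n) (gain : ℕ → ℝ) : ℕ → Fin n → ℝ
  | 0 => fun _ => 0
  | i + 1 => fun l =>
      exp3pScore α β γ arm gain i l +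
        ((if arm i = l then gain i else 0) + β) /
          exp3pProb α γ (exp3pScore α β γ arm gain i) l

/-! ### Ada-LSVI-UCB-Restart -/

/-- Total number of time steps `T = K H`. -/
def totalSteps (H K : ℕ) : ℝ := (K : ℝ) * H

/-- Number `M = ⌈b √(d H T)⌉` of episodes of a block. -/
def blockLen (b : ℝ) (d H K : ℕ) : ℕ := ⌈b * √((d : ℝ) * H * totalSteps H K)⌉₊

/-- Number `⌈K / M⌉ = ⌈T / (M H)⌉` of blocks (the last one may be shorter). -/
def numBlocks (b : ℝ) (d H K : ℕ) : ℕ := ⌈(K : ℝ) / blockLen b d H K⌉₊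

/-- Number `⌊log₂ M⌋ + 1` of window sizes in the grid `{H, 2H, 4H, …, 2^⌊log₂ M⌋ H}`;
window `l` has `2 ^ l` episodes, that is `2 ^ l * H` steps. -/
def numArms (b : ℝ) (d H K : ℕ) : ℕ := Nat.log 2 (blockLen b d H K) + 1

/-- Learning rate of EXP3-P. -/
def metaα (b : ℝ) (d H K : ℕ) : ℝ :=
  0.95 * √(Real.log (numArms b d H K) / (numBlocks b d H K * numArms b d H K))

/-- Bias of the gain estimates of EXP3-P. -/
def metaβ (b : ℝ) (d H K : ℕ) : ℝ :=
  √(Real.log (numArms b d H K) / (numBlocks b d H K * numArms b d H K))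

/-- Exploration rate of EXP3-P, capped at `1`. -/
def metaγ (b : ℝ) (d H K : ℕ) : ℝ :=
  min 1 (1.05 * √(numArms b d H K * Real.log (numArms b d H K) / numBlocks b d H K))

/-- Confidence width `β = c d H √(log (2 d T / p))` of the base algorithm. -/
def confWidth (c p : ℝ) (d H K : ℕ) : ℝ :=
  c * d * H * √(Real.log (2 * d * totalSteps H K / p))

/-- First episode of the epoch of episode `k`, if blocks have `M` episodes and the base algorithm is
restarted at the beginning of each block and then every `W` episodes. -/
def epochStart (M W k : ℕ) : ℕ := k - (k % M) % W

section Run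

variable {S : Type u} {A : Type v} [MeasurableSpace S] [MeasurableSpace A] {d H K : ℕ} {Ω : Type w}

/-- The policy `π^k` of the algorithm in episode `k`: greedy with respect to `Q_h^k`, computed from
the data of the current epoch with the window size sampled for the current block. -/
def adaPolicy (𝓜 : LinearMDP S A d H K) (sel : ArgmaxRule A) (c b p : ℝ)
    (st : ℕ → ℕ → Ω → S) (ac : ℕ → ℕ → Ω → A) (arm : ℕ → Ω → Fin (numArms b d H K))
    (k : ℕ) (ω : Ω) (h : ℕ) (s : S) : A :=
  sel.pick (fun a => lsviQ H (confWidth c p d H K) 𝓜.φ (fun l j => st l j ω) (fun l j => ac l j ω)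
    (fun l j => 𝓜.reward l j (st l j ω) (ac l j ω))
    (epochStart (blockLen b d H K) (2 ^ (arm (k / blockLen b d H K) ω : ℕ)) k) k h s a)

/-- Total reward of block `i`, divided by `M H`. -/
def blockGain (𝓜 : LinearMDP S A d H K) (b : ℝ) (st : ℕ → ℕ → Ω → S) (ac : ℕ → ℕ → Ω → A)
    (i : ℕ) (ω : Ω) : ℝ :=
  (∑ k ∈ Finset.Ico (i * blockLen b d H K) (min ((i + 1) * blockLen b d H K) K),
    ∑ h ∈ Finset.range H, 𝓜.reward k h (st k h ω) (ac k h ω)) / (blockLen b d H K * H)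

/-- The probability `u_{i,l}` with which window `l` is sampled for block `i`. -/
def armProb (𝓜 : LinearMDP S A d H K) (b : ℝ) (st : ℕ → ℕ → Ω → S) (ac : ℕ → ℕ → Ω → A)
    (arm : ℕ → Ω → Fin (numArms b d H K)) (i : ℕ) (l : Fin (numArms b d H K)) (ω : Ω) : ℝ :=
  exp3pProb (metaα b d H K) (metaγ b d H K)
    (exp3pScore (metaα b d H K) (metaβ b d H K) (metaγ b d H K) (fun j => arm j ω)
      (fun j => blockGain 𝓜 b st ac j ω) i) l

/-- Position of a moment of the interaction in the filtration: `tick H k 0` is the moment just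
before episode `k` (and before a window size is drawn, if `k` starts a block), and
`tick H k (h + 1)` the moment when the state of step `h` of episode `k` has just been observed. -/
def tick (H k h : ℕ) : ℕ := k * (H + 1) + h

/-- The processes `st` (states), `ac` (actions) and `arm` (window indices of the blocks) on the
filtered probability space `(Ω, ℱ, P)` form a run of `Ada-LSVI-UCB-Restart` on the MDP `𝓜`. -/
structure IsAdaRun [MeasurableSpace Ω] (𝓜 : LinearMDP S A d H K) (sel : ArgmaxRule A) (c b p : ℝ)
    (P : Measure Ω) (ℱ : Filtration ℕ (inferInstance : MeasurableSpace Ω))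
    (st : ℕ → ℕ → Ω → S) (ac : ℕ → ℕ → Ω → A) (arm : ℕ → Ω → Fin (numArms b d H K)) : Prop where
  /-- An adversary fixes the initial states of the episodes of a block; the choice may
  depend on all that happened before the block, but not on what happens in the block. -/
  init_measurable : ∀ k < K,
    Measurable[ℱ (tick H (k / blockLen b d H K * blockLen b d H K) 0)] (st k 0)
  state_measurable : ∀ k < K, ∀ h < H, Measurable[ℱ (tick H k (h + 1))] (st k h)
  /-- Conditionally on the past, the next state has law `P_h^k(· | s_h^k, a_h^k)`. -/
  state_law : ∀ k < K, ∀ h, h + 1 < H → ∀ E : Set S, MeasurableSet E →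
    P[(st k (h + 1) ⁻¹' E).indicator (fun _ => (1 : ℝ)) | ℱ (tick H k (h + 1))]
      =ᵐ[P] fun ω => (𝓜.trans k h (st k h ω, ac k h ω)).real E
  /-- The executed policy in episode `k` is `π^k`. -/
  action_eq : ∀ k < K, ∀ h < H, ∀ ω, ac k h ω = adaPolicy 𝓜 sel c b p st ac arm k ω h (st k h ω)
  arm_measurable : ∀ i, i * blockLen b d H K < K →
    Measurable[ℱ (tick H (i * blockLen b d H K) 1)] (arm i)
  /-- Conditionally on the past, the window of block `i` is sampled from the EXP3-P distribution. -/
  arm_law : ∀ i, i * blockLen b d H K < K → ∀ l,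
    P[(arm i ⁻¹' {l}).indicator (fun _ => (1 : ℝ)) | ℱ (tick H (i * blockLen b d H K) 0)]
      =ᵐ[P] fun ω => armProb 𝓜 b st ac arm i l ω

/-- The dynamic regret `∑_k [V^*_{1,k}(s_1^k) - V^{π^k}_{1,k}(s_1^k)]` of the algorithm. -/
def dynRegret (𝓜 : LinearMDP S A d H K) (sel : ArgmaxRule A) (c b p : ℝ)
    (st : ℕ → ℕ → Ω → S) (ac : ℕ → ℕ → Ω → A) (arm : ℕ → Ω → Fin (numArms b d H K)) (ω : Ω) : ℝ :=
  ∑ k ∈ Finset.range K,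
    (𝓜.optValue k (st k 0 ω) - 𝓜.value k (adaPolicy 𝓜 sel c b p st ac arm k ω) (st k 0 ω))

end Run

end NonstatRL

end

/-!
The regret is compared with that of a fixed window of `W` episodes, and `W` is chosen at the very
end; the algorithm need not know it.

*One epoch.* Within an epoch the transition operators drift, but in every episode they are linear in
the features (`LinearMDP.exists_expect_eq_inner`), so the least-squares weight estimates a linear
function up to three errors, all measured in the norm of `Λ⁻¹`: the ridge penalty, the drift of the
data collected earlier in the epoch, and the noise of the observed next states
(`abs_weight_sub_le`). The noise is a self-normalized martingale sum, controlled by an exponential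
supermartingale (`measure_confRadius_lt_le`). Since the value estimate to which the regression is
applied depends on the same data, the bound is made uniform over a finite net of the parametric
class of value estimates (`exists_netFun`, `NetConcentrated`). The logarithm of the size of the net
is of order `d²`, so that a bonus of width `c d H √(log (2dT/p))` covers ridge penalty and noise if
`c` is large (`exists_confParams`). Hence the estimates are optimistic up to the drift (`optimism`),
and the elliptical potential bound (`sum_sqrt_invForm_le`) gives the regret of an epoch
(`epoch_regret_le`). The estimates are not clipped from below. They still stay above `-H` as long as
the accumulated bias of the epoch is at most `H`; if it is larger, the trivial bound `H` on the
regret of an episode is good enough.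

*One block.* Summing over the epochs of a block bounds the regret against the *realized rewards* of
every block in which the window `W` happens to be used (`block_regret_le`). The bound is pathwise,
on an event that does not refer to the sampled windows.

*All blocks.* EXP3-P competes with the score of every arm on every path (`exp3p_gain_ge`). The block
rewards are not gains of an oblivious adversary: the reward that a window would have earned in a
block where it was not used is not determined by the run. The comparison is therefore made with
`guaranteedGain`, the optimal value of the block minus the bound of `block_regret_le`. It is known
before the window is drawn, because the initial states of the block are, and it is at most the
observed gain whenever the window is used. So the score dominates the sum of the guaranteed gains up
to a deviation that is controlled by a second exponential supermartingale (`measure_bias_lt_le`).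
This gives, with high probability, a regret bound against any fixed window
(`IsAdaRun.measure_dynRegret_le`).

*Tuning.* With `B = B_θ + B_μ`, the window of about `√(d H K / (B + 1))` episodes, rounded down to a
power of two, gives the claimed order with the exponent `m = 2` of the logarithm (`exists_window`).
If that window is shorter than one episode, if there is only one window size, or if there are too
few blocks for EXP3-P, the trivial bound `K H` has the claimed order (`mul_le_of_few_blocks`).
-/

noncomputable section

namespace NonstatRL

/-! ### Regularized Gram matrices -/

/-- The regularized Gram matrix `I + ∑_{τ ≤ l < k} x_l x_lᵀ` of a sequence of vectors. -/
def gramSum {d : ℕ} (x : ℕ → Fin d → ℝ) (τ k : ℕ) : Matrix (Fin d) (Fin d) ℝ :=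
  1 + ∑ l ∈ Finset.Ico τ k, Matrix.vecMulVec (x l) (x l)

/-- The bilinear form `yᵀ Λ⁻¹ z` of the inverse of the Gram matrix `Λ = gramSum x τ k`. -/
def invForm {d : ℕ} (x : ℕ → Fin d → ℝ) (τ k : ℕ) (y z : Fin d → ℝ) : ℝ :=
  y ⬝ᵥ Matrix.mulVec (gramSum x τ k)⁻¹ z

section

variable {d : ℕ} (x : ℕ → Fin d → ℝ) (τ k : ℕ)

lemma gramSum_self : gramSum x τ τ = 1 := by simp [gramSum]

lemma gramSum_succ {τ k : ℕ} (h : τ ≤ k) :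
    gramSum x τ (k + 1) = gramSum x τ k + Matrix.vecMulVec (x k) (x k) := by
  rw [gramSum, gramSum, Finset.sum_Ico_succ_top h, add_assoc]

lemma gramSum_posDef : (gramSum x τ k).PosDef := by
  refine Matrix.PosDef.one.add_posSemidef ?_
  refine Matrix.posSemidef_sum _ fun l _ => ?_
  simpa using Matrix.posSemidef_vecMulVec_self_star (x l)

lemma gramSum_isUnit_det : IsUnit (gramSum x τ k).det :=
  (gramSum_posDef x τ k).det_pos.ne'.isUnit

lemma invForm_comm (y z : Fin d → ℝ) : invForm x τ k y z = invForm x τ k z y := by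
  have h : (gramSum x τ k)⁻¹.IsHermitian := (gramSum_posDef x τ k).inv.isHermitian
  have h' : (gramSum x τ k)⁻¹.transpose = (gramSum x τ k)⁻¹ := by
    simpa [Matrix.IsSymm] using h
  rw [invForm, invForm, Matrix.dotProduct_mulVec, ← Matrix.mulVec_transpose, h', dotProduct_comm]

lemma invForm_self_nonneg (y : Fin d → ℝ) : 0 ≤ invForm x τ k y y := by
  simpa [invForm] using (gramSum_posDef x τ k).inv.posSemidef.dotProduct_mulVec_nonneg y

lemma invForm_add_right (y z z' : Fin d → ℝ) :
    invForm x τ k y (z + z') = invForm x τ k y z + invForm x τ k y z' := by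
  simp [invForm, Matrix.mulVec_add]

lemma invForm_smul_right (c : ℝ) (y z : Fin d → ℝ) :
    invForm x τ k y (c • z) = c * invForm x τ k y z := by
  simp [invForm, Matrix.mulVec_smul]

lemma invForm_add_left (y y' z : Fin d → ℝ) :
    invForm x τ k (y + y') z = invForm x τ k y z + invForm x τ k y' z := by
  simp [invForm]

lemma invForm_smul_left (c : ℝ) (y z : Fin d → ℝ) :
    invForm x τ k (c • y) z = c * invForm x τ k y z := by
  simp [invForm]

lemma invForm_zero_right (y : Fin d → ℝ) : invForm x τ k y 0 = 0 := by simp [invForm]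

/-- Cauchy–Schwarz. -/
lemma abs_invForm_le (y z : Fin d → ℝ) :
    |invForm x τ k y z| ≤ √(invForm x τ k y y) * √(invForm x τ k z z) := by
  rw [← Real.sqrt_mul (invForm_self_nonneg x τ k y)]
  apply Real.abs_le_sqrt
  have h : ∀ t : ℝ, 0 ≤ invForm x τ k z z * (t * t) + 2 * invForm x τ k y z * t
      + invForm x τ k y y := by
    intro t
    have := invForm_self_nonneg x τ k (y + t • z)
    rw [invForm_add_right, invForm_add_left, invForm_add_left, invForm_smul_right,
      invForm_smul_left, invForm_smul_right, invForm_smul_left, invForm_comm x τ k z y] at this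
    linarith
  have := discrim_le_zero h
  rw [discrim] at this
  nlinarith

/-- Triangle inequality for the norm `√(yᵀ Λ⁻¹ y)`. -/
lemma sqrt_invForm_add_le (y z : Fin d → ℝ) :
    √(invForm x τ k (y + z) (y + z)) ≤ √(invForm x τ k y y) + √(invForm x τ k z z) := by
  apply Real.sqrt_le_iff.2 ⟨by positivity, ?_⟩
  rw [invForm_add_right, invForm_add_left, invForm_add_left, invForm_comm x τ k z y, add_sq,
    Real.sq_sqrt (invForm_self_nonneg ..), Real.sq_sqrt (invForm_self_nonneg ..)]
  have := (le_abs_self _).trans (abs_invForm_le x τ k y z)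
  linarith

/-- The inverse after a rank-one update (Sherman–Morrison). -/
lemma invForm_succ {τ k : ℕ} (h : τ ≤ k) (y z : Fin d → ℝ) :
    invForm x τ (k + 1) y z = invForm x τ k y z -
      invForm x τ k y (x k) * invForm x τ k (x k) z / (1 + invForm x τ k (x k) (x k)) := by
  set Λ := gramSum x τ k with hΛ
  set g := x k with hg
  have hu : IsUnit Λ.det := gramSum_isUnit_det x τ k
  have ha : 0 ≤ invForm x τ k g g := invForm_self_nonneg x τ k g
  have ha' : 1 + invForm x τ k g g ≠ 0 := by positivity
  -- solve `Λ' v = z` explicitly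
  set v : Fin d → ℝ := Matrix.mulVec Λ⁻¹ z -
    (invForm x τ k g z / (1 + invForm x τ k g g)) • Matrix.mulVec Λ⁻¹ g with hv
  have hsol : Matrix.mulVec (gramSum x τ (k + 1)) v = z := by
    rw [gramSum_succ x h, ← hΛ, ← hg, Matrix.add_mulVec, Matrix.vecMulVec_mulVec, hv,
      Matrix.mulVec_sub, Matrix.mulVec_smul, Matrix.mulVec_mulVec, Matrix.mulVec_mulVec,
      Matrix.mul_nonsing_inv _ hu, Matrix.one_mulVec, Matrix.one_mulVec, dotProduct_sub,
      dotProduct_smul]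
    change z - _ • g + MulOpposite.op (invForm x τ k g z - _ * invForm x τ k g g) • g = z
    ext i
    simp only [Pi.add_apply, Pi.sub_apply, Pi.smul_apply, smul_eq_mul, MulOpposite.smul_eq_mul_unop,
      MulOpposite.unop_op]
    field_simp
    ring
  have hinv : Matrix.mulVec (gramSum x τ (k + 1))⁻¹ z = v := by
    rw [← hsol, Matrix.mulVec_mulVec, Matrix.nonsing_inv_mul _ (gramSum_isUnit_det x τ (k + 1)),
      Matrix.one_mulVec]
  rw [invForm, hinv, hv, dotProduct_sub, dotProduct_smul]
  change invForm x τ k y z - _ * invForm x τ k y g = _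
  ring

lemma invForm_base (y z : Fin d → ℝ) : invForm x τ τ y z = y ⬝ᵥ z := by
  simp [invForm, gramSum_self]

lemma invForm_self_le {τ k : ℕ} (h : τ ≤ k) (y : Fin d → ℝ) : invForm x τ k y y ≤ y ⬝ᵥ y := by
  induction k, h using Nat.le_induction with
  | base => rw [invForm_base]
  | succ k h ih =>
    rw [invForm_succ x h, invForm_comm x τ k y (x k)]
    have h1 := invForm_self_nonneg x τ k (x k)
    have : 0 ≤ invForm x τ k (x k) y * invForm x τ k (x k) y / (1 + invForm x τ k (x k) (x k)) :=
      div_nonneg (mul_self_nonneg _) (by positivity)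
    linarith

/-- How the squared norm of a sum changes when a new observation `ε x_k` is added. -/
lemma invForm_succ_add {τ k : ℕ} (h : τ ≤ k) (s : Fin d → ℝ) (ε : ℝ) :
    invForm x τ (k + 1) (s + ε • x k) (s + ε • x k) = invForm x τ k s s +
      (2 * ε * invForm x τ k (x k) s + ε ^ 2 * invForm x τ k (x k) (x k)
        - invForm x τ k (x k) s ^ 2) / (1 + invForm x τ k (x k) (x k)) := by
  have h1 := invForm_self_nonneg x τ k (x k)
  have ha' : 1 + invForm x τ k (x k) (x k) ≠ 0 := by positivity
  rw [invForm_succ x h]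
  simp only [invForm_add_right, invForm_add_left, invForm_smul_left, invForm_smul_right,
    invForm_comm x τ k s (x k)]
  field_simp
  ring

/-- The projection bound: `Λ⁻¹` dominates the design. -/
lemma invForm_sum_le {τ k : ℕ} (h : τ ≤ k) (a : ℕ → ℝ) :
    invForm x τ k (∑ l ∈ Finset.Ico τ k, a l • x l) (∑ l ∈ Finset.Ico τ k, a l • x l) ≤
      ∑ l ∈ Finset.Ico τ k, a l ^ 2 := by
  induction k, h using Nat.le_induction with
  | base => simp [invForm_zero_right]
  | succ k h ih =>
    rw [Finset.sum_Ico_succ_top h, Finset.sum_Ico_succ_top h, invForm_succ_add x h]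
    refine add_le_add ih ?_
    have h1 := invForm_self_nonneg x τ k (x k)
    rw [div_le_iff₀ (by positivity)]
    nlinarith [sq_nonneg (a k - invForm x τ k (x k) (∑ l ∈ Finset.Ico τ k, a l • x l))]

/-- A sum of bounded multiples of the design vectors. -/
lemma sqrt_invForm_sum_le {τ k : ℕ} (h : τ ≤ k) (a : ℕ → ℝ) {B : ℝ} (hB : 0 ≤ B)
    (ha : ∀ l ∈ Finset.Ico τ k, |a l| ≤ B) :
    √(invForm x τ k (∑ l ∈ Finset.Ico τ k, a l • x l) (∑ l ∈ Finset.Ico τ k, a l • x l)) ≤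
      B * √((k - τ : ℕ) : ℝ) := by
  apply Real.sqrt_le_iff.2 ⟨by positivity, (invForm_sum_le x h a).trans ?_⟩
  rw [mul_pow, Real.sq_sqrt (by positivity)]
  calc ∑ l ∈ Finset.Ico τ k, a l ^ 2 ≤ ∑ l ∈ Finset.Ico τ k, B ^ 2 :=
        Finset.sum_le_sum fun l hl => sq_le_sq' (abs_le.1 (ha l hl)).1 (abs_le.1 (ha l hl)).2
    _ = B ^ 2 * ((k - τ : ℕ) : ℝ) := by simp [mul_comm]

lemma det_gramSum_succ {τ k : ℕ} (h : τ ≤ k) :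
    (gramSum x τ (k + 1)).det = (gramSum x τ k).det * (1 + invForm x τ k (x k) (x k)) := by
  rw [gramSum_succ x h, Matrix.vecMulVec_eq Unit,
    Matrix.det_add_replicateCol_mul_replicateRow (gramSum_isUnit_det x τ k)]
  congr 1
  rw [Matrix.det_unique, Matrix.add_apply, Matrix.one_apply_eq, Matrix.mul_assoc]
  congr 1

lemma log_det_gramSum {τ k : ℕ} (h : τ ≤ k) :
    Real.log (gramSum x τ k).det =
      ∑ l ∈ Finset.Ico τ k, Real.log (1 + invForm x τ l (x l) (x l)) := by
  induction k, h using Nat.le_induction with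
  | base => simp [gramSum_self]
  | succ k h ih =>
    have h1 := invForm_self_nonneg x τ k (x k)
    rw [Finset.sum_Ico_succ_top h, det_gramSum_succ x h,
      Real.log_mul (gramSum_posDef x τ k).det_pos.ne' (by positivity), ih]

lemma log_det_gramSum_le (hx : ∀ l ∈ Finset.Ico τ k, x l ⬝ᵥ x l ≤ 1) :
    Real.log (gramSum x τ k).det ≤ d * Real.log (d + (k - τ : ℕ)) := by
  have hP := gramSum_posDef x τ k
  have htr : (gramSum x τ k).trace ≤ d + (k - τ : ℕ) := by
    rw [gramSum, Matrix.trace_add, Matrix.trace_one, Matrix.trace_sum]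
    simp only [Matrix.trace_vecMulVec, Fintype.card_fin]
    refine add_le_add le_rfl ((Finset.sum_le_sum hx).trans ?_)
    simp
  have hsum := hP.isHermitian.trace_eq_sum_eigenvalues
  have hdet := hP.isHermitian.det_eq_prod_eigenvalues
  simp only [RCLike.ofReal_real_eq_id, id_eq] at hsum hdet
  have hle : (gramSum x τ k).det ≤ (d + (k - τ : ℕ) : ℝ) ^ d := by
    rw [hdet]
    calc ∏ i, hP.isHermitian.eigenvalues i ≤ ∏ _i : Fin d, ((d : ℝ) + (k - τ : ℕ)) := by
          refine Finset.prod_le_prod (fun i _ => (hP.eigenvalues_pos i).le) fun i _ => ?_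
          refine le_trans ?_ htr
          rw [hsum]
          exact Finset.single_le_sum (f := fun i => hP.isHermitian.eigenvalues i)
            (fun j _ => (hP.eigenvalues_pos j).le) (Finset.mem_univ i)
      _ = _ := by simp
  calc Real.log (gramSum x τ k).det ≤ Real.log ((d + (k - τ : ℕ) : ℝ) ^ d) :=
        Real.log_le_log hP.det_pos hle
    _ = _ := by rw [Real.log_pow]

lemma div_one_add_le_log {a : ℝ} (ha : 0 ≤ a) : a / (1 + a) ≤ Real.log (1 + a) := by
  have h := Real.log_le_sub_one_of_pos (x := (1 + a)⁻¹) (by positivity)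
  rw [Real.log_inv] at h
  have : a / (1 + a) = 1 - (1 + a)⁻¹ := by field_simp; ring
  linarith

/-- The elliptical potential bound, in the form needed for the supermartingale. -/
lemma sum_div_one_add_invForm_le {τ k : ℕ} (h : τ ≤ k)
    (hx : ∀ l ∈ Finset.Ico τ k, x l ⬝ᵥ x l ≤ 1) :
    ∑ l ∈ Finset.Ico τ k, invForm x τ l (x l) (x l) / (1 + invForm x τ l (x l) (x l)) ≤
      d * Real.log (d + (k - τ : ℕ)) := by
  refine le_trans ?_ (log_det_gramSum_le x τ k hx)
  rw [log_det_gramSum x h]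
  exact Finset.sum_le_sum fun l _ => div_one_add_le_log (invForm_self_nonneg ..)

/-- The elliptical potential bound. -/
lemma sum_sqrt_invForm_le {τ k : ℕ} (h : τ ≤ k)
    (hx : ∀ l ∈ Finset.Ico τ k, x l ⬝ᵥ x l ≤ 1) :
    ∑ l ∈ Finset.Ico τ k, √(invForm x τ l (x l) (x l)) ≤
      √((k - τ : ℕ) * (2 * (d * Real.log (d + (k - τ : ℕ))))) := by
  apply Real.le_sqrt_of_sq_le
  refine (sq_sum_le_card_mul_sum_sq).trans ?_
  rw [Nat.card_Ico]
  refine mul_le_mul_of_nonneg_left ?_ (by positivity)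
  refine le_trans ?_ (mul_le_mul_of_nonneg_left (sum_div_one_add_invForm_le x h hx) zero_le_two)
  rw [Finset.mul_sum]
  refine Finset.sum_le_sum fun l hl => ?_
  have h0 := invForm_self_nonneg x τ l (x l)
  have h1 : invForm x τ l (x l) (x l) ≤ 1 :=
    (invForm_self_le x (Finset.mem_Ico.1 hl).1 _).trans (hx l hl)
  rw [Real.sq_sqrt h0, ← mul_div_assoc, le_div_iff₀ (by positivity)]
  nlinarith

end

/-! ### Concentration of self-normalized sums -/

section

lemma measurable_matrix_det {Ω : Type*} {m : MeasurableSpace Ω} {d : ℕ}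
    {A : Ω → Matrix (Fin d) (Fin d) ℝ} (hA : ∀ i j, Measurable fun ω => A ω i j) :
    Measurable fun ω => (A ω).det := by
  simp only [Matrix.det_apply]
  refine Finset.measurable_sum _ fun σ _ => Measurable.const_smul ?_ _
  exact Finset.measurable_prod _ fun i _ => hA _ _

lemma measurable_matrix_inv {Ω : Type*} {m : MeasurableSpace Ω} {d : ℕ}
    {A : Ω → Matrix (Fin d) (Fin d) ℝ} (hA : ∀ i j, Measurable fun ω => A ω i j) (i j : Fin d) :
    Measurable fun ω => (A ω)⁻¹ i j := by
  simp only [Matrix.inv_def, Ring.inverse_eq_inv', Matrix.smul_apply, smul_eq_mul,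
    Matrix.adjugate_apply]
  refine (measurable_matrix_det hA).inv.mul (measurable_matrix_det fun i' j' => ?_)
  by_cases h : i' = j
  · subst h
    simp
  · simpa [Matrix.updateRow_ne h] using hA i' j'

lemma measurable_gramSum {Ω : Type*} {m : MeasurableSpace Ω} {d : ℕ} {x : ℕ → Ω → Fin d → ℝ}
    {τ k : ℕ} (hx : ∀ l ∈ Finset.Ico τ k, Measurable (x l)) (i j : Fin d) :
    Measurable fun ω => gramSum (fun l => x l ω) τ k i j := by
  simp only [gramSum, Matrix.add_apply, Matrix.sum_apply, Matrix.vecMulVec_apply]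
  refine measurable_const.add (Finset.measurable_sum _ fun l hl => ?_)
  exact ((measurable_pi_apply i).comp (hx l hl)).mul ((measurable_pi_apply j).comp (hx l hl))

lemma measurable_invForm {Ω : Type*} {m : MeasurableSpace Ω} {d : ℕ} {x : ℕ → Ω → Fin d → ℝ}
    {τ k : ℕ} (hx : ∀ l ∈ Finset.Ico τ k, Measurable (x l)) {y z : Ω → Fin d → ℝ}
    (hy : Measurable y) (hz : Measurable z) :
    Measurable fun ω => invForm (fun l => x l ω) τ k (y ω) (z ω) := by
  simp only [invForm, dotProduct, Matrix.mulVec]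
  refine Finset.measurable_sum _ fun i _ => ((measurable_pi_apply i).comp hy).mul ?_
  refine Finset.measurable_sum _ fun j _ => ?_
  exact (measurable_matrix_inv (measurable_gramSum hx) i j).mul ((measurable_pi_apply j).comp hz)

/-- The one-step estimate behind the supermartingale: a chord bound for the exponential turns the
increment into a term that is linear in the centred noise `ε`. -/
lemma exp_increment_le {R a e u : ℝ} (hR : 0 < R) (ha : 0 ≤ a) (he : |e| ≤ R) :
    Real.exp ((2 * e * u + e ^ 2 * a - u ^ 2) / (1 + a) / (2 * R ^ 2) - a / (1 + a) / 2) ≤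
      1 + e * (Real.sinh (u / (R * (1 + a))) * Real.exp (-(u / (R * (1 + a))) ^ 2 / 2) / R) := by
  set y := u / (R * (1 + a)) with hy
  have ha1 : 0 < 1 + a := by linarith
  have hu : u = y * (R * (1 + a)) := by rw [hy]; field_simp
  have h1 : (2 * e * u + e ^ 2 * a - u ^ 2) / (1 + a) / (2 * R ^ 2) - a / (1 + a) / 2 ≤
      e / R * y + -y ^ 2 / 2 := by
    have he2 : e ^ 2 ≤ R ^ 2 := sq_le_sq' (abs_le.1 he).1 (abs_le.1 he).2
    have : e / R * y + -y ^ 2 / 2 - ((2 * e * u + e ^ 2 * a - u ^ 2) / (1 + a) / (2 * R ^ 2)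
        - a / (1 + a) / 2) = (a * y ^ 2 * R ^ 2 * (1 + a) + a * (R ^ 2 - e ^ 2)) /
          (2 * R ^ 2 * (1 + a)) := by
      rw [hu]; field_simp; ring
    have h2 : 0 ≤ (a * y ^ 2 * R ^ 2 * (1 + a) + a * (R ^ 2 - e ^ 2)) / (2 * R ^ 2 * (1 + a)) := by
      have : 0 ≤ R ^ 2 - e ^ 2 := by linarith
      positivity
    linarith
  have het : |e / R| ≤ 1 := by rwa [abs_div, abs_of_pos hR, div_le_one hR]
  calc _ ≤ Real.exp (e / R * y + -y ^ 2 / 2) := Real.exp_le_exp.2 h1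
    _ = Real.exp (e / R * y) * Real.exp (-y ^ 2 / 2) := Real.exp_add _ _
    _ ≤ (Real.cosh y + e / R * Real.sinh y) * Real.exp (-y ^ 2 / 2) :=
        mul_le_mul_of_nonneg_right (Real.exp_mul_le_cosh_add_mul_sinh het y) (Real.exp_pos _).le
    _ = Real.cosh y * Real.exp (-y ^ 2 / 2) + e * (Real.sinh y * Real.exp (-y ^ 2 / 2) / R) := by
        ring
    _ ≤ Real.exp (y ^ 2 / 2) * Real.exp (-y ^ 2 / 2) +
          e * (Real.sinh y * Real.exp (-y ^ 2 / 2) / R) := by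
        gcongr
        exact Real.cosh_le_exp_half_sq y
    _ = _ := by rw [← Real.exp_add, neg_div, add_neg_cancel, Real.exp_zero]

lemma abs_sinh_mul_exp_le (y : ℝ) : |Real.sinh y * Real.exp (-y ^ 2 / 2)| ≤ 1 := by
  rw [abs_mul, abs_of_pos (Real.exp_pos _)]
  have h : |Real.sinh y| ≤ Real.cosh y := by
    rw [abs_le]
    constructor
    · have := Real.exp_pos y
      rw [← Real.cosh_add_sinh] at this
      linarith
    · exact (Real.sinh_lt_cosh y).le
  calc |Real.sinh y| * Real.exp (-y ^ 2 / 2) ≤ Real.exp (y ^ 2 / 2) * Real.exp (-y ^ 2 / 2) := by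
        gcongr
        exact h.trans (Real.cosh_le_exp_half_sq y)
    _ = 1 := by rw [← Real.exp_add, neg_div, add_neg_cancel, Real.exp_zero]

/-- `ε` has conditional mean zero given the σ-algebra `m`, in the form of orthogonality to the
bounded `m`-measurable functions. -/
def CondMeanZero {Ω : Type*} {mΩ : MeasurableSpace Ω} (P : Measure Ω) (m : MeasurableSpace Ω)
    (ε : Ω → ℝ) : Prop :=
  ∀ g : Ω → ℝ, Measurable[m] g → (∃ C, ∀ ω, |g ω| ≤ C) → ∫ ω, ε ω * g ω ∂P = 0

/-- The weighted noise `∑_{τ ≤ l < k} ε_l x_l`. -/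
def noiseSum {d : ℕ} (x : ℕ → Fin d → ℝ) (ε : ℕ → ℝ) (τ k : ℕ) : Fin d → ℝ :=
  ∑ l ∈ Finset.Ico τ k, ε l • x l

/-- The exponential supermartingale of a self-normalized sum: the sum of the `a / (1 + a)` in the
exponent, which the elliptical potential bounds, compensates the growth of the squared norm. -/
def selfNormExp {d : ℕ} (R : ℝ) (x : ℕ → Fin d → ℝ) (ε : ℕ → ℝ) (τ k : ℕ) : ℝ :=
  Real.exp (invForm x τ k (noiseSum x ε τ k) (noiseSum x ε τ k) / (2 * R ^ 2) -
    (∑ l ∈ Finset.Ico τ k, invForm x τ l (x l) (x l) / (1 + invForm x τ l (x l) (x l))) / 2)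

lemma selfNormExp_pos {d : ℕ} (R : ℝ) (x : ℕ → Fin d → ℝ) (ε : ℕ → ℝ) (τ k : ℕ) :
    0 < selfNormExp R x ε τ k := Real.exp_pos _

/-- One step of the supermartingale: the increment is at most `ε_k` times a bounded quantity that is
known before `ε_k` is observed. -/
lemma selfNormExp_succ_le {d : ℕ} {R : ℝ} (hR : 0 < R) (x : ℕ → Fin d → ℝ) (ε : ℕ → ℝ) {τ k : ℕ}
    (h : τ ≤ k) (hε : |ε k| ≤ R) :
    selfNormExp R x ε τ (k + 1) ≤ selfNormExp R x ε τ k + ε k * (selfNormExp R x ε τ k *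
      (Real.sinh (invForm x τ k (x k) (noiseSum x ε τ k) / (R * (1 + invForm x τ k (x k) (x k)))) *
      Real.exp (-(invForm x τ k (x k) (noiseSum x ε τ k) /
        (R * (1 + invForm x τ k (x k) (x k)))) ^ 2 / 2) / R)) := by
  have hs : noiseSum x ε τ (k + 1) = noiseSum x ε τ k + ε k • x k := by
    rw [noiseSum, Finset.sum_Ico_succ_top h, noiseSum]
  have := exp_increment_le (u := invForm x τ k (x k) (noiseSum x ε τ k)) hR
    (invForm_self_nonneg x τ k (x k)) hε
  have hfac : selfNormExp R x ε τ (k + 1) = selfNormExp R x ε τ k *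
      Real.exp ((2 * ε k * invForm x τ k (x k) (noiseSum x ε τ k) +
        ε k ^ 2 * invForm x τ k (x k) (x k) - invForm x τ k (x k) (noiseSum x ε τ k) ^ 2) /
        (1 + invForm x τ k (x k) (x k)) / (2 * R ^ 2) -
        invForm x τ k (x k) (x k) / (1 + invForm x τ k (x k) (x k)) / 2) := by
    rw [selfNormExp, selfNormExp, ← Real.exp_add, hs, invForm_succ_add x h,
      Finset.sum_Ico_succ_top h]
    congr 1
    ring
  rw [hfac]
  have hZ : 0 < selfNormExp R x ε τ k := Real.exp_pos _
  calc _ ≤ selfNormExp R x ε τ k * _ := mul_le_mul_of_nonneg_left this hZ.le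
    _ = _ := by ring

lemma selfNormExp_le {d : ℕ} {R : ℝ} (hR : 0 < R) (x : ℕ → Fin d → ℝ) (ε : ℕ → ℝ) {τ k : ℕ}
    (h : τ ≤ k) (hε : ∀ l ∈ Finset.Ico τ k, |ε l| ≤ R) :
    selfNormExp R x ε τ k ≤ Real.exp ((k - τ : ℕ) / 2) := by
  refine Real.exp_le_exp.2 ?_
  have h1 : 0 ≤ ∑ l ∈ Finset.Ico τ k,
      invForm x τ l (x l) (x l) / (1 + invForm x τ l (x l) (x l)) :=
    Finset.sum_nonneg fun l _ => by
      have := invForm_self_nonneg x τ l (x l)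
      positivity
  have h2 : invForm x τ k (noiseSum x ε τ k) (noiseSum x ε τ k) ≤ (k - τ : ℕ) * R ^ 2 := by
    refine (invForm_sum_le x h ε).trans ?_
    calc ∑ l ∈ Finset.Ico τ k, ε l ^ 2 ≤ ∑ l ∈ Finset.Ico τ k, R ^ 2 :=
          Finset.sum_le_sum fun l hl => sq_le_sq' (abs_le.1 (hε l hl)).1 (abs_le.1 (hε l hl)).2
      _ = _ := by simp
  have h3 : invForm x τ k (noiseSum x ε τ k) (noiseSum x ε τ k) / (2 * R ^ 2) ≤
      (k - τ : ℕ) / 2 := by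
    rw [div_le_div_iff₀ (by positivity) (by positivity)]
    nlinarith
  linarith

variable {Ω : Type w} {d : ℕ}

lemma measurable_noiseSum {m : MeasurableSpace Ω} {x : ℕ → Ω → Fin d → ℝ} {ε : ℕ → Ω → ℝ}
    {τ k : ℕ} (hx : ∀ l ∈ Finset.Ico τ k, Measurable (x l))
    (hε : ∀ l ∈ Finset.Ico τ k, Measurable (ε l)) :
    Measurable fun ω => noiseSum (fun l => x l ω) (fun l => ε l ω) τ k := by
  refine measurable_pi_iff.2 fun i => ?_
  simp only [noiseSum, Finset.sum_apply, Pi.smul_apply, smul_eq_mul]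
  exact Finset.measurable_sum _ fun l hl => (hε l hl).mul ((measurable_pi_apply i).comp (hx l hl))

lemma measurable_selfNormExp {m : MeasurableSpace Ω} {R : ℝ} {x : ℕ → Ω → Fin d → ℝ}
    {ε : ℕ → Ω → ℝ} {τ k : ℕ} (hx : ∀ l ∈ Finset.Ico τ k, Measurable (x l))
    (hε : ∀ l ∈ Finset.Ico τ k, Measurable (ε l)) :
    Measurable fun ω => selfNormExp R (fun l => x l ω) (fun l => ε l ω) τ k := by
  have hS := measurable_noiseSum hx hε
  refine Real.measurable_exp.comp (((measurable_invForm hx hS hS).div_const _).sub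
    (Measurable.div_const (Finset.measurable_sum _ fun l hl => ?_) _))
  have hx' : ∀ j ∈ Finset.Ico τ l, Measurable (x j) := fun j hj => hx j <| by
    simp only [Finset.mem_Ico] at hj hl ⊢
    omega
  exact (measurable_invForm hx' (hx l hl) (hx l hl)).div
    (measurable_const.add (measurable_invForm hx' (hx l hl) (hx l hl)))

variable [mΩ : MeasurableSpace Ω] {P : Measure Ω} [IsProbabilityMeasure P]

/-- The supermartingale has mean at most one. -/
lemma integral_selfNormExp_le {m : ℕ → MeasurableSpace Ω} (hm : ∀ l, m l ≤ mΩ) (hmono : Monotone m)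
    {R : ℝ} (hR : 0 < R) {x : ℕ → Ω → Fin d → ℝ} {ε : ℕ → Ω → ℝ} {τ n : ℕ} (hn : τ ≤ n)
    (hx : ∀ l ∈ Finset.Ico τ n, Measurable[m l] (x l))
    (hε : ∀ l ∈ Finset.Ico τ n, Measurable[m (l + 1)] (ε l))
    (hεR : ∀ l ∈ Finset.Ico τ n, ∀ ω, |ε l ω| ≤ R)
    (hε0 : ∀ l ∈ Finset.Ico τ n, CondMeanZero P (m l) (ε l)) :
    ∫ ω, selfNormExp R (fun l => x l ω) (fun l => ε l ω) τ n ∂P ≤ 1 := by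
  induction n, hn using Nat.le_induction with
  | base => simp [selfNormExp, noiseSum, invForm_zero_right]
  | succ k hk ih =>
    have hsub : ∀ l, l ∈ Finset.Ico τ k → l ∈ Finset.Ico τ (k + 1) := fun l hl => by
      simp only [Finset.mem_Ico] at hl ⊢
      omega
    have hkm : k ∈ Finset.Ico τ (k + 1) := by simp [hk]
    refine le_trans ?_ (ih (fun l hl => hx l (hsub l hl)) (fun l hl => hε l (hsub l hl))
      (fun l hl => hεR l (hsub l hl)) fun l hl => hε0 l (hsub l hl))
    have hxk : ∀ l ∈ Finset.Ico τ k, Measurable[m k] (x l) := fun l hl =>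
      (hx l (hsub l hl)).mono (hmono (Finset.mem_Ico.1 hl).2.le) le_rfl
    have hεk : ∀ l ∈ Finset.Ico τ k, Measurable[m k] (ε l) := fun l hl =>
      (hε l (hsub l hl)).mono (hmono (Finset.mem_Ico.1 hl).2) le_rfl
    have hZ : Measurable[m k] fun ω => selfNormExp R (fun l => x l ω) (fun l => ε l ω) τ k :=
      measurable_selfNormExp hxk hεk
    have hZ' : Measurable fun ω => selfNormExp R (fun l => x l ω) (fun l => ε l ω) τ (k + 1) :=
      measurable_selfNormExp (fun l hl => (hx l hl).mono (hm _) le_rfl)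
        (fun l hl => (hε l hl).mono (hm _) le_rfl)
    have hS := measurable_noiseSum hxk hεk
    set y : Ω → ℝ := fun ω => invForm (fun l => x l ω) τ k (x k ω)
      (noiseSum (fun l => x l ω) (fun l => ε l ω) τ k) /
        (R * (1 + invForm (fun l => x l ω) τ k (x k ω) (x k ω))) with hy
    have hym : Measurable[m k] y := (measurable_invForm hxk (hx k hkm) hS).div
      (measurable_const.mul (measurable_const.add
        (measurable_invForm hxk (hx k hkm) (hx k hkm))))
    set g : Ω → ℝ := fun ω => selfNormExp R (fun l => x l ω) (fun l => ε l ω) τ k *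
      (Real.sinh (y ω) * Real.exp (-(y ω) ^ 2 / 2) / R) with hg
    have hgm : Measurable[m k] g := hZ.mul (((Real.measurable_sinh.comp hym).mul
      (Real.measurable_exp.comp ((hym.pow_const 2).neg.div_const 2))).div_const R)
    have hZb : ∀ ω, |selfNormExp R (fun l => x l ω) (fun l => ε l ω) τ k| ≤
        Real.exp ((k - τ : ℕ) / 2) := fun ω => by
      rw [abs_of_pos (selfNormExp_pos ..)]
      exact selfNormExp_le hR _ _ hk fun l hl => hεR l (hsub l hl) ω
    have hZb' : ∀ ω, |selfNormExp R (fun l => x l ω) (fun l => ε l ω) τ (k + 1)| ≤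
        Real.exp ((k + 1 - τ : ℕ) / 2) := fun ω => by
      rw [abs_of_pos (selfNormExp_pos ..)]
      exact selfNormExp_le hR _ _ (by omega) fun l hl => hεR l hl ω
    have hgb : ∀ ω, |g ω| ≤ Real.exp ((k - τ : ℕ) / 2) * (1 / R) := fun ω => by
      rw [hg, abs_mul, abs_div, abs_of_pos hR]
      gcongr
      · exact hZb ω
      · exact abs_sinh_mul_exp_le _
    have hgε : Integrable (fun ω => ε k ω * g ω) P :=
      Integrable.of_bound (((hε k hkm).mono (hm _) le_rfl).mul
        (hgm.mono (hm _) le_rfl)).aestronglyMeasurable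
        (R * (Real.exp ((k - τ : ℕ) / 2) * (1 / R))) (Filter.Eventually.of_forall fun ω => by
          rw [Real.norm_eq_abs, abs_mul]
          exact mul_le_mul (hεR k hkm ω) (hgb ω) (abs_nonneg _) hR.le)
    have hZi : Integrable (fun ω => selfNormExp R (fun l => x l ω) (fun l => ε l ω) τ k) P :=
      Integrable.of_bound (hZ.mono (hm _) le_rfl).aestronglyMeasurable _
        (Filter.Eventually.of_forall hZb)
    have hZi' : Integrable (fun ω => selfNormExp R (fun l => x l ω) (fun l => ε l ω) τ (k + 1)) P :=
      Integrable.of_bound hZ'.aestronglyMeasurable _ (Filter.Eventually.of_forall hZb')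
    -- `g` is bounded and known at time `k`, so `ε_k` is orthogonal to it
    calc ∫ ω, selfNormExp R (fun l => x l ω) (fun l => ε l ω) τ (k + 1) ∂P
        ≤ ∫ ω, (selfNormExp R (fun l => x l ω) (fun l => ε l ω) τ k + ε k ω * g ω) ∂P :=
          integral_mono hZi' (hZi.add hgε) fun ω =>
            selfNormExp_succ_le hR (fun l => x l ω) (fun l => ε l ω) hk (hεR k hkm ω)
      _ = _ := by
          rw [integral_add hZi hgε, hε0 k hkm g hgm ⟨_, hgb⟩, add_zero]

/-- Squared confidence radius of a self-normalized sum of `n` terms bounded by `R`, at confidence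
level `1 - δ`. -/
def confRadius (d n : ℕ) (R δ : ℝ) : ℝ :=
  R ^ 2 * (d * Real.log (d + n) + 2 * Real.log (1 / δ))

/-- Concentration of a self-normalized sum of bounded vector-valued martingale increments. -/
theorem measure_confRadius_lt_le {m : ℕ → MeasurableSpace Ω} (hm : ∀ l, m l ≤ mΩ)
    (hmono : Monotone m) {R δ : ℝ} (hR : 0 < R) (hδ : 0 < δ) {x : ℕ → Ω → Fin d → ℝ}
    {ε : ℕ → Ω → ℝ} {τ n : ℕ} (hn : τ ≤ n)
    (hx : ∀ l ∈ Finset.Ico τ n, Measurable[m l] (x l))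
    (hx1 : ∀ l ∈ Finset.Ico τ n, ∀ ω, x l ω ⬝ᵥ x l ω ≤ 1)
    (hε : ∀ l ∈ Finset.Ico τ n, Measurable[m (l + 1)] (ε l))
    (hεR : ∀ l ∈ Finset.Ico τ n, ∀ ω, |ε l ω| ≤ R)
    (hε0 : ∀ l ∈ Finset.Ico τ n, CondMeanZero P (m l) (ε l)) :
    P {ω | confRadius d (n - τ) R δ < invForm (fun l => x l ω) τ n
      (noiseSum (fun l => x l ω) (fun l => ε l ω) τ n)
      (noiseSum (fun l => x l ω) (fun l => ε l ω) τ n)} ≤ ENNReal.ofReal δ := by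
  have hint := integral_selfNormExp_le (P := P) hm hmono hR hn hx hε hεR hε0
  have hZ : Measurable fun ω => selfNormExp R (fun l => x l ω) (fun l => ε l ω) τ n :=
    measurable_selfNormExp (fun l hl => (hx l hl).mono (hm _) le_rfl)
      (fun l hl => (hε l hl).mono (hm _) le_rfl)
  have hZi : Integrable (fun ω => selfNormExp R (fun l => x l ω) (fun l => ε l ω) τ n) P :=
    Integrable.of_bound hZ.aestronglyMeasurable (Real.exp ((n - τ : ℕ) / 2))
      (Filter.Eventually.of_forall fun ω => by
        rw [Real.norm_eq_abs, abs_of_pos (selfNormExp_pos ..)]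
        exact selfNormExp_le hR _ _ hn fun l hl => hεR l hl ω)
  -- Markov's inequality
  have hmarkov := mul_meas_ge_le_integral_of_nonneg (μ := P)
    (Filter.Eventually.of_forall fun ω => (selfNormExp_pos ..).le) hZi (1 / δ)
  have hreal : P.real {ω | 1 / δ ≤ selfNormExp R (fun l => x l ω) (fun l => ε l ω) τ n} ≤ δ := by
    have := hmarkov.trans hint
    rwa [one_div_mul_eq_div, div_le_one hδ] at this
  refine le_trans (measure_mono fun ω hω => ?_)
    ((ENNReal.le_ofReal_iff_toReal_le (measure_ne_top _ _) hδ.le).2 hreal)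
  simp only [Set.mem_ofPred_eq, confRadius] at hω ⊢
  have hpot := sum_div_one_add_invForm_le (fun l => x l ω) hn fun l hl => hx1 l hl ω
  rw [selfNormExp, ← Real.log_le_iff_le_exp (by positivity)]
  set q := invForm (fun l => x l ω) τ n (noiseSum (fun l => x l ω) (fun l => ε l ω) τ n)
      (noiseSum (fun l => x l ω) (fun l => ε l ω) τ n)
  have : (d * Real.log (d + (n - τ : ℕ)) + 2 * Real.log (1 / δ)) / 2 ≤ q / (2 * R ^ 2) := by
    rw [div_le_div_iff₀ (by positivity) (by positivity)]
    nlinarith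
  linarith

end

/-! ### Regret of EXP3-P -/

lemma exp_le_one_add_add_sq {x : ℝ} (hx : x ≤ 1) : Real.exp x ≤ 1 + x + x ^ 2 := by
  rcases le_or_gt (-1) x with h | h
  · have := (abs_le.1 (Real.abs_exp_sub_one_sub_id_le (abs_le.2 ⟨h, hx⟩))).2
    linarith
  · have : Real.exp x ≤ 1 := Real.exp_le_one_iff.2 (by linarith)
    nlinarith

section Pathwise

variable {n : ℕ} {α β γ : ℝ}

/-- The mixture with the uniform distribution keeps all probabilities at least `γ / n`. -/
lemma exp3pProb_pos (hn : 0 < n) (hγ : 0 < γ) (hγ1 : γ ≤ 1) (q : Fin n → ℝ) (l : Fin n) :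
    γ / n ≤ exp3pProb α γ q l ∧ 0 < exp3pProb α γ q l := by
  have h : 0 ≤ (1 - γ) * (Real.exp (α * q l) / ∑ j, Real.exp (α * q j)) :=
    mul_nonneg (by linarith) (div_nonneg (Real.exp_pos _).le
      (Finset.sum_nonneg fun _ _ => (Real.exp_pos _).le))
  have h' : 0 < γ / n := div_pos hγ (by exact_mod_cast hn)
  unfold exp3pProb
  constructor <;> linarith

lemma sum_exp_pos (hn : 0 < n) (q : Fin n → ℝ) : 0 < ∑ j, Real.exp (α * q j) :=
  Finset.sum_pos (fun _ _ => Real.exp_pos _) ⟨⟨0, hn⟩, Finset.mem_univ _⟩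

lemma sum_exp3pProb (hn : 0 < n) (q : Fin n → ℝ) : ∑ l, exp3pProb α γ q l = 1 := by
  have h := (sum_exp_pos (α := α) hn q).ne'
  have h' : (n : ℝ) ≠ 0 := by exact_mod_cast hn.ne'
  simp only [exp3pProb, Finset.sum_add_distrib, ← Finset.mul_sum, ← Finset.sum_div,
    Finset.sum_const, Finset.card_univ, Fintype.card_fin, nsmul_eq_mul]
  rw [div_self h]
  field_simp
  ring

lemma exp3pProb_le_one (hn : 0 < n) (hγ : 0 < γ) (hγ1 : γ ≤ 1) (q : Fin n → ℝ) (l : Fin n) :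
    exp3pProb α γ q l ≤ 1 := by
  rw [← sum_exp3pProb (α := α) (γ := γ) hn q]
  exact Finset.single_le_sum (f := exp3pProb α γ q)
    (fun j _ => (exp3pProb_pos hn hγ hγ1 q j).2.le) (Finset.mem_univ l)

lemma exp3pScore_nonneg (hn : 0 < n) (hβ : 0 ≤ β) (hγ : 0 < γ) (hγ1 : γ ≤ 1) (arm : ℕ → Fin n)
    (gain : ℕ → ℝ) (N : ℕ) (hg : ∀ i < N, 0 ≤ gain i) (l : Fin n) :
    0 ≤ exp3pScore α β γ arm gain N l := by
  induction N with
  | zero => simp [exp3pScore]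
  | succ N ih =>
    have h1 := ih fun i hi => hg i (by omega)
    have h2 := (exp3pProb_pos (α := α) hn hγ hγ1 (exp3pScore α β γ arm gain N) l).2
    have h3 := hg N (by omega)
    simp only [exp3pScore]
    refine add_nonneg h1 (div_nonneg (add_nonneg ?_ hβ) h2.le)
    split_ifs <;> simp [h3]

/-- Growth of the potential `log ∑_j exp (α q_j)` of exponential weights in one round. -/
lemma log_sum_exp_step (hn : 0 < n) (hα : 0 < α) (hβ : 0 ≤ β) (hγ : 0 < γ) (hγ1 : γ < 1)
    (hαγ : α * (1 + β) * n ≤ γ) (q : Fin n → ℝ) (a : Fin n) {g : ℝ} (hg0 : 0 ≤ g) (hg1 : g ≤ 1)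
    (e : Fin n → ℝ) (he : ∀ l, e l = ((if a = l then g else 0) + β) / exp3pProb α γ q l) :
    Real.log (∑ j, Real.exp (α * (q j + e j))) ≤ Real.log (∑ j, Real.exp (α * q j)) +
      (α / (1 - γ) * (g + n * β) + α ^ 2 * (1 + β) / (1 - γ) * ∑ j, e j) := by
  set W := ∑ j, Real.exp (α * q j) with hW
  have hWpos : 0 < W := sum_exp_pos hn q
  have hW' : 0 < ∑ j, Real.exp (α * (q j + e j)) := sum_exp_pos (α := α) hn fun j => q j + e j
  have h1γ : 0 < 1 - γ := by linarith
  have hn' : (0 : ℝ) < n := by exact_mod_cast hn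
  have hu : ∀ l, 0 < exp3pProb α γ q l := fun l => (exp3pProb_pos hn hγ hγ1.le q l).2
  have hnum0 : ∀ l, 0 ≤ (if a = l then g else 0) + β := fun l => by split_ifs <;> linarith
  have hnum1 : ∀ l, (if a = l then g else 0) + β ≤ 1 + β := fun l => by split_ifs <;> linarith
  have he0 : ∀ l, 0 ≤ e l := fun l => by
    rw [he]; exact div_nonneg (hnum0 l) (hu l).le
  have hue : ∀ l, exp3pProb α γ q l * e l = (if a = l then g else 0) + β := fun l => by
    rw [he]; field_simp [(hu l).ne']
  -- the estimates are small, since every arm has probability at least `γ / n`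
  have heα : ∀ l, α * e l ≤ 1 := fun l => by
    have h1 := (exp3pProb_pos (α := α) hn hγ hγ1.le q l).1
    rw [he, ← mul_div_assoc, div_le_one (hu l)]
    refine le_trans ?_ h1
    rw [le_div_iff₀ hn']
    calc α * ((if a = l then g else 0) + β) * n ≤ α * (1 + β) * n := by
          have := mul_le_mul_of_nonneg_left (hnum1 l) hα.le
          exact mul_le_mul_of_nonneg_right this hn'.le
      _ ≤ γ := hαγ
  -- the exponential weights are dominated by the sampling probabilities
  have hp : ∀ l, Real.exp (α * q l) / W ≤ exp3pProb α γ q l / (1 - γ) := fun l => by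
    rw [le_div_iff₀ h1γ, exp3pProb]
    have : 0 ≤ γ / n := by positivity
    nlinarith
  have hratio : (∑ j, Real.exp (α * (q j + e j))) / W ≤
      1 + (α / (1 - γ) * (g + n * β) + α ^ 2 * (1 + β) / (1 - γ) * ∑ j, e j) := by
    have hs : ∑ j, Real.exp (α * q j) / W = 1 := by
      rw [← Finset.sum_div, ← hW, div_self hWpos.ne']
    have hue_sum : ∑ l, exp3pProb α γ q l * e l = g + n * β := by
      simp [hue, Finset.sum_add_distrib]
    calc (∑ j, Real.exp (α * (q j + e j))) / W
        = ∑ j, Real.exp (α * q j) / W * Real.exp (α * e j) := by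
          rw [Finset.sum_div]
          refine Finset.sum_congr rfl fun j _ => ?_
          rw [mul_add, Real.exp_add]; ring
      _ ≤ ∑ j, (Real.exp (α * q j) / W + exp3pProb α γ q j / (1 - γ) *
            (α * e j + (α * e j) ^ 2)) := by
          refine Finset.sum_le_sum fun j _ => ?_
          have h1 := exp_le_one_add_add_sq (heα j)
          have h2 : 0 ≤ Real.exp (α * q j) / W := by positivity
          have h3 : 0 ≤ α * e j + (α * e j) ^ 2 := by
            have := mul_nonneg hα.le (he0 j)
            positivity
          calc _ ≤ Real.exp (α * q j) / W * (1 + (α * e j + (α * e j) ^ 2)) :=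
                mul_le_mul_of_nonneg_left (by linarith) h2
            _ = Real.exp (α * q j) / W + Real.exp (α * q j) / W * (α * e j + (α * e j) ^ 2) := by
                ring
            _ ≤ _ := by
                have := mul_le_mul_of_nonneg_right (hp j) h3
                linarith
      _ ≤ ∑ j, (Real.exp (α * q j) / W + (α / (1 - γ) * (exp3pProb α γ q j * e j) +
            α ^ 2 * (1 + β) / (1 - γ) * e j)) := by
          refine Finset.sum_le_sum fun j _ => add_le_add le_rfl ?_
          have h4 : exp3pProb α γ q j * e j ≤ 1 + β := (hue j).trans_le (hnum1 j)
          have : exp3pProb α γ q j / (1 - γ) * (α * e j + (α * e j) ^ 2) =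
              α / (1 - γ) * (exp3pProb α γ q j * e j) +
              α ^ 2 * (exp3pProb α γ q j * e j) / (1 - γ) * e j := by ring
          rw [this]
          gcongr
          exact he0 j
      _ = _ := by
          rw [Finset.sum_add_distrib, hs, Finset.sum_add_distrib, ← Finset.mul_sum,
            ← Finset.mul_sum, hue_sum]
  -- `log x ≤ x - 1`
  have hlog := Real.log_le_sub_one_of_pos (div_pos hW' hWpos)
  rw [Real.log_div hW'.ne' hWpos.ne'] at hlog
  linarith

/-- The total gain of EXP3-P competes with the score of every arm, on every path. -/
theorem exp3p_gain_ge (hn : 0 < n) (hα : 0 < α) (hβ : 0 ≤ β) (hγ : 0 < γ) (hγ1 : γ ≤ 1 / 2)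
    (hαγ : α * (1 + β) * n ≤ γ) (arm : ℕ → Fin n) (gain : ℕ → ℝ) (N : ℕ)
    (hg0 : ∀ i < N, 0 ≤ gain i) (hg1 : ∀ i < N, gain i ≤ 1) (l : Fin n) :
    (1 - 2 * γ) * exp3pScore α β γ arm gain N l - Real.log n / α - N * (n * β) ≤
      ∑ i ∈ Finset.range N, gain i := by
  have h1γ : 0 < 1 - γ := by linarith
  have hn' : (0 : ℝ) < n := by exact_mod_cast hn
  set q := exp3pScore α β γ arm gain with hq
  have hpot : ∀ k ≤ N, Real.log (∑ j, Real.exp (α * q k j)) ≤ Real.log n +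
      (α / (1 - γ) * (∑ i ∈ Finset.range k, gain i + k * (n * β)) +
        α ^ 2 * (1 + β) / (1 - γ) * ∑ j, q k j) := by
    intro k hk
    induction k with
    | zero => simp [hq, exp3pScore]
    | succ k ih =>
      have h := log_sum_exp_step hn hα hβ hγ (by linarith) hαγ (q k) (arm k) (hg0 k hk) (hg1 k hk)
        (fun j => ((if arm k = j then gain k else 0) + β) / exp3pProb α γ (q k) j) fun _ => rfl
      have hstep : ∀ j, q (k + 1) j = q k j +
          ((if arm k = j then gain k else 0) + β) / exp3pProb α γ (q k) j := fun j => rfl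
      simp only [← hstep] at h
      refine h.trans ((add_le_add_left (ih (by omega)) _).trans (le_of_eq ?_))
      have hs : ∑ j, q (k + 1) j = ∑ j, q k j +
          ∑ j, ((if arm k = j then gain k else 0) + β) / exp3pProb α γ (q k) j := by
        rw [← Finset.sum_add_distrib]
        exact Finset.sum_congr rfl fun j _ => hstep j
      rw [hs, Finset.sum_range_succ]
      push_cast
      ring
  have hN := hpot N le_rfl
  -- the sum of the scores in the second-order term is absorbed by the largest score
  obtain ⟨b, -, hb⟩ := Finset.exists_max_image (Finset.univ : Finset (Fin n)) (q N)
    ⟨⟨0, hn⟩, Finset.mem_univ _⟩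
  have hqb : 0 ≤ q N b := exp3pScore_nonneg hn hβ hγ (by linarith) arm gain N hg0 b
  have h1 : α * q N b ≤ Real.log (∑ j, Real.exp (α * q N j)) := by
    rw [Real.le_log_iff_exp_le (sum_exp_pos hn _)]
    exact Finset.single_le_sum (f := fun j => Real.exp (α * q N j))
      (fun _ _ => (Real.exp_pos _).le) (Finset.mem_univ b)
  have h2 : ∑ j, q N j ≤ n * q N b := by
    calc ∑ j, q N j ≤ ∑ _j : Fin n, q N b := Finset.sum_le_sum fun j hj => hb j hj
      _ = _ := by simp
  have h3 : α * q N b ≤ Real.log n + (α / (1 - γ) * (∑ i ∈ Finset.range N, gain i + N * (n * β)) +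
      α ^ 2 * (1 + β) / (1 - γ) * (n * q N b)) := by
    refine (h1.trans hN).trans ?_
    gcongr
  have hlogn : 0 ≤ Real.log n := Real.log_nonneg (by exact_mod_cast hn)
  have h4 : (1 - γ) * q N b ≤ (1 - γ) * (Real.log n / α) +
      (∑ i ∈ Finset.range N, gain i + N * (n * β)) + α * (1 + β) * n * q N b := by
    have := mul_le_mul_of_nonneg_left h3 (show 0 ≤ (1 - γ) / α by positivity)
    have e1 : (1 - γ) / α * (α * q N b) = (1 - γ) * q N b := by field_simp
    have e2 : (1 - γ) / α * (Real.log n + (α / (1 - γ) * (∑ i ∈ Finset.range N, gain i +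
        N * (n * β)) + α ^ 2 * (1 + β) / (1 - γ) * (n * q N b))) = (1 - γ) * (Real.log n / α) +
      (∑ i ∈ Finset.range N, gain i + N * (n * β)) + α * (1 + β) * n * q N b := by
      field_simp
      ring
    rwa [e1, e2] at this
  have h5 : (1 - γ) * (Real.log n / α) ≤ Real.log n / α := by
    have : 0 ≤ Real.log n / α := by positivity
    nlinarith
  have h6 : α * (1 + β) * n * q N b ≤ γ * q N b := mul_le_mul_of_nonneg_right hαγ hqb
  have h7 : (1 - 2 * γ) * q N l ≤ (1 - 2 * γ) * q N b :=
    mul_le_mul_of_nonneg_left (hb l (Finset.mem_univ l)) (by linarith)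
  linarith

end Pathwise

section Estimates

/-- A variable minus (a version of) its conditional expectation has conditional mean zero. -/
lemma condMeanZero_of_condExp {Ω : Type w} {m mΩ : MeasurableSpace Ω} {P : Measure Ω}
    [IsProbabilityMeasure P] (hm : m ≤ mΩ) {f h : Ω → ℝ}
    (hf : Integrable f P) (hh : Integrable h P) (hfh : P[f | m] =ᵐ[P] h) :
    CondMeanZero P m (fun ω => f ω - h ω) := by
  rintro g hg ⟨C, hC⟩
  have hgs : StronglyMeasurable[m] g := hg.stronglyMeasurable
  have hga : AEStronglyMeasurable g P := (hgs.mono hm).aestronglyMeasurable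
  have hfg : Integrable (fun ω => g ω * f ω) P :=
    hf.bdd_mul hga (Filter.Eventually.of_forall hC)
  have hhg : Integrable (fun ω => g ω * h ω) P :=
    hh.bdd_mul hga (Filter.Eventually.of_forall hC)
  have h1 : ∫ ω, g ω * f ω ∂P = ∫ ω, g ω * h ω ∂P := by
    rw [← integral_condExp hm (f := fun ω => g ω * f ω)]
    refine integral_congr_ae ?_
    filter_upwards [condExp_mul_of_stronglyMeasurable_left hgs hfg hf, hfh] with ω h2 h3
    rw [← h3]
    exact h2
  calc ∫ ω, (f ω - h ω) * g ω ∂P = ∫ ω, (g ω * f ω - g ω * h ω) ∂P := by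
        congr 1; ext ω; ring
    _ = 0 := by rw [integral_sub hfg hhg, h1, sub_self]

variable {Ω : Type w} [mΩ : MeasurableSpace Ω] {P : Measure Ω} [IsProbabilityMeasure P]

/-- One-step estimate for the biased importance-weighted estimates. Here `I ∈ {0, 1}` tells
whether the arm was played. -/
lemma exp_bias_le {β G u I : ℝ} (hβ : 0 ≤ β) (hβ1 : β ≤ 1) (hG0 : 0 ≤ G) (hG1 : G ≤ 1) (hu : 0 < u)
    (hu1 : u ≤ 1) (hI : I = 0 ∨ I = 1) :
    Real.exp (β * (G - (I * G + β) / u)) ≤ 1 + (I - u) *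
      (Real.exp (β * (G - (G + β) / u)) - Real.exp (β * (G - β / u))) := by
  have hx0 : β * G ≤ 1 := by nlinarith
  have hx1 : β * G * (1 - 1 / u) ≤ 1 := by
    have : 1 - 1 / u ≤ 0 := by
      rw [sub_nonpos, le_div_iff₀ hu]; linarith
    nlinarith [mul_nonneg hβ hG0]
  have e0 : Real.exp (β * (G - β / u)) = Real.exp (β * G) * Real.exp (-(β ^ 2 / u)) := by
    rw [← Real.exp_add]; congr 1; ring
  have e1 : Real.exp (β * (G - (G + β) / u)) =
      Real.exp (β * G * (1 - 1 / u)) * Real.exp (-(β ^ 2 / u)) := by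
    rw [← Real.exp_add]; congr 1; field_simp; ring
  -- the bias `β / u` compensates the second-order term of the exponential
  have hmean : (1 - u) * Real.exp (β * (G - β / u)) + u * Real.exp (β * (G - (G + β) / u)) ≤ 1 := by
    have h0 := exp_le_one_add_add_sq hx0
    have h1 := exp_le_one_add_add_sq hx1
    have h2 : (1 - u) * Real.exp (β * G) + u * Real.exp (β * G * (1 - 1 / u)) ≤
        Real.exp (β ^ 2 / u) := by
      calc _ ≤ (1 - u) * (1 + β * G + (β * G) ^ 2) +
            u * (1 + β * G * (1 - 1 / u) + (β * G * (1 - 1 / u)) ^ 2) :=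
            add_le_add (mul_le_mul_of_nonneg_left h0 (by linarith))
              (mul_le_mul_of_nonneg_left h1 hu.le)
        _ = β ^ 2 / u * (G ^ 2 * (1 - u)) + 1 := by field_simp; ring
        _ ≤ β ^ 2 / u * 1 + 1 := by
            have : G ^ 2 * (1 - u) ≤ 1 := by nlinarith
            gcongr
        _ ≤ _ := by
            rw [mul_one]
            exact Real.add_one_le_exp _
    rw [e0, e1]
    calc _ = ((1 - u) * Real.exp (β * G) + u * Real.exp (β * G * (1 - 1 / u))) *
          Real.exp (-(β ^ 2 / u)) := by ring
      _ ≤ Real.exp (β ^ 2 / u) * Real.exp (-(β ^ 2 / u)) := by gcongr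
      _ = 1 := by rw [← Real.exp_add, add_neg_cancel, Real.exp_zero]
  rcases hI with rfl | rfl
  · simp only [zero_mul, zero_add]
    nlinarith
  · simp only [one_mul]
    nlinarith

/-- With high probability the biased importance-weighted estimates overestimate the gains of a
fixed arm. `I i ω ∈ {0, 1}` tells whether the arm was played in round `i`, and `u i` is the
probability of playing it. The gains `G i` are known before the arm of round `i` is drawn. -/
theorem measure_bias_lt_le {m : ℕ → MeasurableSpace Ω} (hm : ∀ l, m l ≤ mΩ) (hmono : Monotone m)
    {β δ c : ℝ} (hβ : 0 < β) (hβ1 : β ≤ 1) (hδ : 0 < δ) (hc : 0 < c) {G u I : ℕ → Ω → ℝ} {N : ℕ}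
    (hG : ∀ i < N, Measurable[m i] (G i)) (hG0 : ∀ i < N, ∀ ω, 0 ≤ G i ω)
    (hG1 : ∀ i < N, ∀ ω, G i ω ≤ 1) (hu : ∀ i < N, Measurable[m i] (u i))
    (huc : ∀ i < N, ∀ ω, c ≤ u i ω) (hu1 : ∀ i < N, ∀ ω, u i ω ≤ 1)
    (hI : ∀ i < N, Measurable[m (i + 1)] (I i)) (hI01 : ∀ i < N, ∀ ω, I i ω = 0 ∨ I i ω = 1)
    (hIu : ∀ i < N, CondMeanZero P (m i) fun ω => I i ω - u i ω) :
    P {ω | Real.log (1 / δ) / β < ∑ i ∈ Finset.range N, (G i ω - (I i ω * G i ω + β) / u i ω)} ≤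
      ENNReal.ofReal δ := by
  set Z : ℕ → Ω → ℝ := fun k ω => Real.exp (β *
    ∑ i ∈ Finset.range k, (G i ω - (I i ω * G i ω + β) / u i ω)) with hZdef
  have hupos : ∀ i < N, ∀ ω, 0 < u i ω := fun i hi ω => hc.trans_le (huc i hi ω)
  have hZpos : ∀ k ω, 0 < Z k ω := fun k ω => Real.exp_pos _
  have hterm : ∀ i < N, ∀ ω, G i ω - (I i ω * G i ω + β) / u i ω ≤ 1 := fun i hi ω => by
    have h1 := hG0 i hi ω
    have h2 := hG1 i hi ω
    have h3 := hupos i hi ω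
    have h4 : 0 ≤ I i ω := by rcases hI01 i hi ω with h | h <;> simp [h]
    have : 0 ≤ (I i ω * G i ω + β) / u i ω := by positivity
    linarith
  have hZb : ∀ k ≤ N, ∀ ω, |Z k ω| ≤ Real.exp (β * k) := fun k hk ω => by
    rw [abs_of_pos (hZpos k ω)]
    refine Real.exp_le_exp.2 (mul_le_mul_of_nonneg_left ?_ hβ.le)
    calc _ ≤ ∑ i ∈ Finset.range k, (1 : ℝ) :=
          Finset.sum_le_sum fun i hi => hterm i ((Finset.mem_range.1 hi).trans_le hk) ω
      _ = k := by simp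
  have hZm : ∀ k ≤ N, Measurable[m k] (Z k) := fun k hk => by
    refine Real.measurable_exp.comp
      (Measurable.const_mul (Finset.measurable_sum _ fun i hi => ?_) _)
    have hik := Finset.mem_range.1 hi
    have hG' := (hG i (hik.trans_le hk)).mono (hmono hik.le) le_rfl
    have hu' := (hu i (hik.trans_le hk)).mono (hmono hik.le) le_rfl
    have hI' := (hI i (hik.trans_le hk)).mono (hmono hik) le_rfl
    exact hG'.sub (((hI'.mul hG').add_const β).div hu')
  have hZi : ∀ k ≤ N, Integrable (Z k) P := fun k hk =>
    Integrable.of_bound ((hZm k hk).mono (hm _) le_rfl).aestronglyMeasurable _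
      (Filter.Eventually.of_forall (hZb k hk))
  -- `Z` is a supermartingale
  have hint : ∀ k ≤ N, ∫ ω, Z k ω ∂P ≤ 1 := by
    intro k hk
    induction k with
    | zero => simp [hZdef]
    | succ k ih =>
      have hk' : k < N := hk
      refine le_trans ?_ (ih hk'.le)
      set g : Ω → ℝ := fun ω => Z k ω * (Real.exp (β * (G k ω - (G k ω + β) / u k ω)) -
        Real.exp (β * (G k ω - β / u k ω))) with hg
      have hgm : Measurable[m k] g :=
        (hZm k hk'.le).mul ((Real.measurable_exp.comp (((hG k hk').sub
          (((hG k hk').add_const β).div (hu k hk'))).const_mul β)).sub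
          (Real.measurable_exp.comp (((hG k hk').sub
            (measurable_const.div (hu k hk'))).const_mul β)))
      have hgb : ∀ ω, |g ω| ≤ Real.exp (β * k) * Real.exp β := fun ω => by
        have h3 := hupos k hk' ω
        have h0 := hG0 k hk' ω
        have h1 := hG1 k hk' ω
        rw [hg, abs_mul]
        refine mul_le_mul (hZb k hk'.le ω) ?_ (abs_nonneg _) (Real.exp_pos _).le
        have h5 : 0 < Real.exp (β * (G k ω - (G k ω + β) / u k ω)) := Real.exp_pos _
        have h6 : Real.exp (β * (G k ω - (G k ω + β) / u k ω)) ≤ Real.exp β := by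
          refine Real.exp_le_exp.2 ?_
          have : 0 ≤ (G k ω + β) / u k ω := by positivity
          nlinarith
        have h7 : 0 < Real.exp (β * (G k ω - β / u k ω)) := Real.exp_pos _
        have h8 : Real.exp (β * (G k ω - β / u k ω)) ≤ Real.exp β := by
          refine Real.exp_le_exp.2 ?_
          have : 0 ≤ β / u k ω := by positivity
          nlinarith
        rw [abs_le]
        constructor <;> linarith
      have hIb : ∀ ω, |I k ω - u k ω| ≤ 1 := fun ω => by
        have h1 := hu1 k hk' ω
        have h2 := hupos k hk' ω
        rcases hI01 k hk' ω with h | h <;> rw [h, abs_le] <;> constructor <;> linarith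
      have hgi : Integrable (fun ω => (I k ω - u k ω) * g ω) P :=
        Integrable.of_bound ((((hI k hk').mono (hm _) le_rfl).sub
          ((hu k hk').mono (hm _) le_rfl)).mul (hgm.mono (hm _) le_rfl)).aestronglyMeasurable
          (1 * (Real.exp (β * k) * Real.exp β)) (Filter.Eventually.of_forall fun ω => by
            rw [Real.norm_eq_abs, abs_mul]
            exact mul_le_mul (hIb ω) (hgb ω) (abs_nonneg _) zero_le_one)
      calc ∫ ω, Z (k + 1) ω ∂P ≤ ∫ ω, (Z k ω + (I k ω - u k ω) * g ω) ∂P := by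
            refine integral_mono (hZi _ hk) ((hZi _ hk'.le).add hgi) fun ω => ?_
            have h := exp_bias_le hβ.le hβ1 (hG0 k hk' ω) (hG1 k hk' ω) (hupos k hk' ω)
              (hu1 k hk' ω) (hI01 k hk' ω)
            have hfac : Z (k + 1) ω = Z k ω *
                Real.exp (β * (G k ω - (I k ω * G k ω + β) / u k ω)) := by
              simp only [hZdef]
              rw [← Real.exp_add, Finset.sum_range_succ, mul_add]
            simp only [hfac, hg]
            have := mul_le_mul_of_nonneg_left h (hZpos k ω).le
            linarith
        _ = ∫ ω, Z k ω ∂P := by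
            rw [integral_add (hZi _ hk'.le) hgi, hIu k hk' g hgm ⟨_, hgb⟩, add_zero]
  have hmarkov := mul_meas_ge_le_integral_of_nonneg (μ := P)
    (Filter.Eventually.of_forall fun ω => (hZpos N ω).le) (hZi N le_rfl) (1 / δ)
  have hreal : P.real {ω | 1 / δ ≤ Z N ω} ≤ δ := by
    have := hmarkov.trans (hint N le_rfl)
    rwa [one_div_mul_eq_div, div_le_one hδ] at this
  refine le_trans (measure_mono fun ω hω => ?_)
    ((ENNReal.le_ofReal_iff_toReal_le (measure_ne_top _ _) hδ.le).2 hreal)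
  simp only [Set.mem_ofPred_eq] at hω ⊢
  rw [hZdef, ← Real.log_le_iff_le_exp (by positivity)]
  rw [div_lt_iff₀ hβ] at hω
  linarith

end Estimates

/-! ### Conditional expectations through the transition kernels -/

section CondKernel

variable {Ω Γ S : Type*} [MeasurableSpace Ω] [MeasurableSpace Γ] [MeasurableSpace S]

/-- If the probabilities of rectangles are given by the kernel `κ`, the joint law of `X` and `s'` is
the composition product of the law of `X` with `κ`. -/
lemma integral_eq_integral_kernel {P : Measure Ω} [IsProbabilityMeasure P] {X : Ω → Γ}
    (hX : Measurable X) {s' : Ω → S} (hs' : Measurable s') (κ : Kernel Γ S) [IsMarkovKernel κ]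
    (hlaw : ∀ B E, MeasurableSet B → MeasurableSet E →
      P (X ⁻¹' B ∩ s' ⁻¹' E) = ∫⁻ ω in X ⁻¹' B, κ (X ω) E ∂P)
    {Ψ : Γ × S → ℝ} (hΨ : Measurable Ψ) {R : ℝ} (hR : ∀ p, |Ψ p| ≤ R) :
    ∫ ω, Ψ (X ω, s' ω) ∂P = ∫ ω, ∫ y, Ψ (X ω, y) ∂(κ (X ω)) ∂P := by
  have : IsProbabilityMeasure (P.map X) := Measure.isProbabilityMeasure_map hX.aemeasurable
  have hXs : Measurable fun ω => (X ω, s' ω) := hX.prodMk hs'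
  have : IsProbabilityMeasure (P.map fun ω => (X ω, s' ω)) :=
    Measure.isProbabilityMeasure_map hXs.aemeasurable
  have hmeas : P.map (fun ω => (X ω, s' ω)) = (P.map X) ⊗ₘ κ := by
    refine Measure.ext_prod fun {B E} hB hE => ?_
    rw [Measure.map_apply hXs (hB.prod hE), Measure.compProd_apply_prod hB hE,
      setLIntegral_map hB (κ.measurable_coe hE) hX, ← hlaw B E hB hE]
    rfl
  have hint : Integrable Ψ ((P.map X) ⊗ₘ κ) :=
    Integrable.of_bound hΨ.aestronglyMeasurable R (Filter.Eventually.of_forall hR)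
  calc ∫ ω, Ψ (X ω, s' ω) ∂P = ∫ p, Ψ p ∂(P.map fun ω => (X ω, s' ω)) :=
        (integral_map hXs.aemeasurable hΨ.aestronglyMeasurable).symm
    _ = ∫ x, ∫ y, Ψ (x, y) ∂(κ x) ∂(P.map X) := by rw [hmeas, Measure.integral_compProd hint]
    _ = _ := by
        refine integral_map hX.aemeasurable ?_
        exact (StronglyMeasurable.integral_kernel_prod_right'
          hΨ.stronglyMeasurable).aestronglyMeasurable

end CondKernel

/-- If the conditional law of `s'` is the kernel `κ`, a function of the past and of `s'` can be
centred by integrating it against `κ`. The joint law of the past and `s'` is determined by the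
conditional probabilities of single events, the past being the random variable `id` with values in
`(Ω, m)`. -/
lemma condMeanZero_kernel {Ω : Type w} {S : Type u} [MeasurableSpace S] {m mΩ : MeasurableSpace Ω}
    {P : Measure Ω} [IsProbabilityMeasure P] (hm : m ≤ mΩ) {s' : Ω → S} (hs' : Measurable s')
    (κ : Kernel[m] Ω S) [IsMarkovKernel κ]
    (hlaw : ∀ E, MeasurableSet E →
      P[(s' ⁻¹' E).indicator (fun _ => (1 : ℝ)) | m] =ᵐ[P] fun ω => (κ ω).real E)
    {Ψ : Ω → S → ℝ} (hΨ : Measurable[m.prod inferInstance] fun p : Ω × S => Ψ p.1 p.2) {R : ℝ}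
    (hR : ∀ ω s, |Ψ ω s| ≤ R) :
    CondMeanZero P m fun ω => Ψ ω (s' ω) - ∫ y, Ψ ω y ∂(κ ω) := by
  rintro g hg ⟨C, hC⟩
  have hid : Measurable[mΩ, m] (id : Ω → Ω) := measurable_id'' hm
  have hκreal : ∀ E, MeasurableSet E → Measurable[m] fun ω => (κ ω).real E := fun E hE =>
    (κ.measurable_coe hE).ennreal_toReal
  have hl : ∀ B E, MeasurableSet[m] B → MeasurableSet E →
      P (id ⁻¹' B ∩ s' ⁻¹' E) = ∫⁻ ω in id ⁻¹' B, κ (id ω) E ∂P := by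
    intro B E hB hE
    simp only [Set.preimage_id, id]
    have hsE : MeasurableSet (s' ⁻¹' E) := hs' hE
    have h1 : ∫ ω in B, (s' ⁻¹' E).indicator (fun _ => (1 : ℝ)) ω ∂P =
        ∫ ω in B, (κ ω).real E ∂P := by
      rw [← setIntegral_condExp hm ((integrable_const _).indicator hsE) hB]
      exact integral_congr_ae (ae_restrict_of_ae (hlaw E hE))
    have h2 : ∫ ω in B, (s' ⁻¹' E).indicator (fun _ => (1 : ℝ)) ω ∂P = P.real (B ∩ s' ⁻¹' E) := by
      rw [setIntegral_indicator hsE]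
      simp [Measure.real]
    have h3 : ∫⁻ ω in B, κ ω E ∂P = ENNReal.ofReal (∫ ω in B, (κ ω).real E ∂P) := by
      rw [ofReal_integral_eq_lintegral_ofReal]
      · refine lintegral_congr fun ω => ?_
        rw [ofReal_measureReal]
      · refine Integrable.of_bound ((hκreal E hE).mono hm le_rfl).aestronglyMeasurable 1
          (Filter.Eventually.of_forall fun ω => ?_)
        rw [Real.norm_eq_abs, abs_of_nonneg measureReal_nonneg]
        exact measureReal_le_one
      · exact Filter.Eventually.of_forall fun ω => measureReal_nonneg
    rw [h3, ← h1, h2, ofReal_measureReal]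
  have hΨg : Measurable[m.prod inferInstance] fun p : Ω × S => Ψ p.1 p.2 * g p.1 :=
    hΨ.mul (hg.comp (@measurable_fst Ω S m _))
  have h := @integral_eq_integral_kernel Ω Ω S mΩ m _ P _ id hid s' hs' κ _ hl
    (fun p => Ψ p.1 p.2 * g p.1) hΨg (R * C) fun p => by
      rw [abs_mul]
      exact mul_le_mul (hR _ _) (hC _) (abs_nonneg _) ((abs_nonneg _).trans (hR p.1 p.2))
  simp only [id] at h
  have hΨi : Measurable[m] fun ω => ∫ y, Ψ ω y ∂(κ ω) :=
    (@StronglyMeasurable.integral_kernel_prod_right' Ω S m _ κ ℝ _ _ _ _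
      hΨ.stronglyMeasurable).measurable
  have hΨs : Measurable fun ω => Ψ ω (s' ω) :=
    hΨ.comp (show Measurable[mΩ, m.prod inferInstance] fun ω => (id ω, s' ω) from hid.prodMk hs')
  have hgm : Measurable g := hg.mono hm le_rfl
  have hi1 : Integrable (fun ω => Ψ ω (s' ω) * g ω) P :=
    Integrable.of_bound (hΨs.mul hgm).aestronglyMeasurable (R * C)
      (Filter.Eventually.of_forall fun ω => by
        rw [Real.norm_eq_abs, abs_mul]
        exact mul_le_mul (hR _ _) (hC _) (abs_nonneg _) ((abs_nonneg _).trans (hR ω (s' ω))))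
  have hi2 : Integrable (fun ω => (∫ y, Ψ ω y ∂(κ ω)) * g ω) P :=
    Integrable.of_bound ((hΨi.mono hm le_rfl).mul hgm).aestronglyMeasurable (R * C)
      (Filter.Eventually.of_forall fun ω => by
        rw [Real.norm_eq_abs, abs_mul]
        refine mul_le_mul ?_ (hC _) (abs_nonneg _) ((abs_nonneg _).trans (hR ω (s' ω)))
        have := norm_integral_le_of_norm_le_const (μ := κ ω) (f := fun y => Ψ ω y)
          (Filter.Eventually.of_forall fun y => hR ω y)
        simpa using this)
  calc ∫ ω, (Ψ ω (s' ω) - ∫ y, Ψ ω y ∂(κ ω)) * g ω ∂P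
      = ∫ ω, (Ψ ω (s' ω) * g ω - (∫ y, Ψ ω y ∂(κ ω)) * g ω) ∂P := by
        congr 1; ext ω; ring
    _ = 0 := by
        rw [integral_sub hi1 hi2, h, sub_eq_zero]
        refine integral_congr_ae (Filter.Eventually.of_forall fun ω => ?_)
        simp only
        rw [integral_mul_const]

/-! ### Measurability of the estimates -/

section Measurability

variable {S : Type u} {A : Type v} [MeasurableSpace S] [MeasurableSpace A] {d H K : ℕ}

namespace LinearMDP

lemma isMarkovKernel_trans (𝓜 : LinearMDP S A d H K) {k h : ℕ} (hk : k < K) (hh : h < H) :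
    IsMarkovKernel (𝓜.trans k h) := ⟨fun p => 𝓜.trans_prob k hk h hh p.1 p.2⟩

lemma measurable_φ_comp [MeasurableSingletonClass A] [Finite A] (𝓜 : LinearMDP S A d H K)
    {Γ : Type*} {mΓ : MeasurableSpace Γ} {f : Γ → S} {g : Γ → A} (hf : Measurable f)
    (hg : Measurable g) : Measurable fun x => 𝓜.φ (f x) (g x) := by
  have h : Measurable fun p : S × A => 𝓜.φ p.1 p.2 :=
    measurable_from_prod_countable_left fun a => 𝓜.measurable_φ a
  exact h.comp (hf.prodMk hg)

lemma measurable_φ_coord [MeasurableSingletonClass A] [Finite A] (𝓜 : LinearMDP S A d H K)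
    {Γ : Type*} {mΓ : MeasurableSpace Γ} {f : Γ → S} {g : Γ → A} (hf : Measurable f)
    (hg : Measurable g) : Measurable fun x => (𝓜.φ (f x) (g x)).ofLp :=
  (PiLp.continuous_ofLp 2 _).measurable.comp (𝓜.measurable_φ_comp hf hg)

lemma measurable_reward [MeasurableSingletonClass A] [Finite A] (𝓜 : LinearMDP S A d H K)
    {Γ : Type*} {mΓ : MeasurableSpace Γ} {f : Γ → S} {g : Γ → A} (hf : Measurable f)
    (hg : Measurable g) (k h : ℕ) : Measurable fun x => 𝓜.reward k h (f x) (g x) :=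
  (𝓜.measurable_φ_comp hf hg).inner measurable_const

end LinearMDP

variable [MeasurableSingletonClass A] [Finite A] (𝓜 : LinearMDP S A d H K)
  {Γ : Type w} {mΓ : MeasurableSpace Γ}

/-- The data may depend on `x` through a measurable map `γ`, which allows the state and the action
to be separate arguments. -/
lemma measurable_ucbQ {H' : ℕ} {β : ℝ} {st : ℕ → ℕ → Γ → S} {ac : ℕ → ℕ → Γ → A}
    {rwd : ℕ → ℕ → Γ → ℝ} {τ k h : ℕ} (hst : ∀ l < k, Measurable (st l h))
    (hac : ∀ l < k, Measurable (ac l h)) (hrw : ∀ l < k, Measurable (rwd l h)) {V : Γ → S → ℝ}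
    (hV : ∀ l < k, Measurable fun x => V x (st l (h + 1) x)) {Γ' : Type*} {mΓ' : MeasurableSpace Γ'}
    {γ : Γ' → Γ} {f : Γ' → S} {g : Γ' → A} (hγ : Measurable γ) (hf : Measurable f)
    (hg : Measurable g) :
    Measurable fun x => ucbQ H' β 𝓜.φ (fun l j => st l j (γ x)) (fun l j => ac l j (γ x))
      (fun l j => rwd l j (γ x)) τ k h (V (γ x)) (f x) (g x) := by
  have hφ : ∀ l ∈ Finset.Ico τ k, Measurable fun x => (𝓜.φ (st l h x) (ac l h x)).ofLp :=
    fun l hl => 𝓜.measurable_φ_coord (hst l (Finset.mem_Ico.1 hl).2) (hac l (Finset.mem_Ico.1 hl).2)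
  have hG := measurable_matrix_inv (measurable_gramSum hφ)
  have hG' : ∀ i j, Measurable fun x => (gram 𝓜.φ (fun l j => st l j (γ x))
      (fun l j => ac l j (γ x)) τ k h)⁻¹ i j := fun i j => (hG i j).comp hγ
  have hfg := 𝓜.measurable_φ_coord hf hg
  have hfgi : ∀ i, Measurable fun x => (𝓜.φ (f x) (g x)).ofLp i := fun i =>
    (measurable_pi_apply i).comp hfg
  unfold ucbQ
  refine Measurable.min (Measurable.add ?_ (Measurable.const_mul (Measurable.sqrt ?_) _))
    measurable_const
  · simp only [dotProduct, weight, Matrix.mulVec]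
    refine Finset.measurable_sum _ fun i _ => Measurable.mul ?_ (hfgi i)
    refine Finset.measurable_sum _ fun j _ => (hG' i j).mul ?_
    refine Finset.measurable_sum _ fun l hl => ?_
    have hl' := (Finset.mem_Ico.1 hl).2
    exact (((measurable_pi_apply j).comp (hφ l hl)).comp hγ).mul
      (((hrw l hl').comp hγ).add ((hV l hl').comp hγ))
  · simp only [dotProduct, Matrix.mulVec]
    refine Finset.measurable_sum _ fun i _ => (hfgi i).mul ?_
    exact Finset.measurable_sum _ fun j _ => (hG' i j).mul (hfgi j)

/-- The value estimates of episode `k` are jointly measurable in the data of the earlier episodes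
and the state. -/
lemma measurable_lsviV {β : ℝ} {st : ℕ → ℕ → Γ → S} {ac : ℕ → ℕ → Γ → A}
    {rwd : ℕ → ℕ → Γ → ℝ} {τ k : ℕ} (hst : ∀ l < k, ∀ h < H, Measurable (st l h))
    (hac : ∀ l < k, ∀ h < H, Measurable (ac l h)) (hrw : ∀ l < k, ∀ h < H, Measurable (rwd l h))
    {n : ℕ} (hn : n ≤ H) :
    Measurable fun p : Γ × S => lsviV H β 𝓜.φ (fun l j => st l j p.1) (fun l j => ac l j p.1)
      (fun l j => rwd l j p.1) τ k n p.2 := by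
  induction n with
  | zero => exact measurable_const
  | succ n ih =>
    have ih := ih (by omega)
    simp only [lsviV]
    refine Measurable.iSup fun a => measurable_ucbQ (H' := H) 𝓜
      (V := fun x => lsviV H β 𝓜.φ (fun l j => st l j x) (fun l j => ac l j x)
        (fun l j => rwd l j x) τ k n) (fun l hl => hst l hl _ (by omega))
      (fun l hl => hac l hl _ (by omega)) (fun l hl => hrw l hl _ (by omega)) (fun l hl => ?_)
      measurable_fst measurable_snd measurable_const
    rcases Nat.eq_zero_or_pos n with rfl | hn0
    · exact measurable_const
    · exact ih.comp (measurable_id.prodMk (hst l hl _ (by omega)))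

lemma measurable_lsviQ {β : ℝ} {st : ℕ → ℕ → Γ → S} {ac : ℕ → ℕ → Γ → A}
    {rwd : ℕ → ℕ → Γ → ℝ} {τ k h : ℕ} (hst : ∀ l < k, ∀ h < H, Measurable (st l h))
    (hac : ∀ l < k, ∀ h < H, Measurable (ac l h)) (hrw : ∀ l < k, ∀ h < H, Measurable (rwd l h))
    (hh : h < H) (a : A) :
    Measurable fun p : Γ × S => lsviQ H β 𝓜.φ (fun l j => st l j p.1) (fun l j => ac l j p.1)
      (fun l j => rwd l j p.1) τ k h p.2 a := by
  unfold lsviQ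
  have hV := measurable_lsviV (β := β) (τ := τ) 𝓜 hst hac hrw (n := H - (h + 1)) (by omega)
  refine measurable_ucbQ (H' := H) 𝓜 (V := fun x => lsviV H β 𝓜.φ (fun l j => st l j x)
    (fun l j => ac l j x) (fun l j => rwd l j x) τ k (H - (h + 1))) (fun l hl => hst l hl _ hh)
    (fun l hl => hac l hl _ hh) (fun l hl => hrw l hl _ hh) (fun l hl => ?_)
    measurable_fst measurable_snd measurable_const
  rcases Nat.eq_zero_or_pos (H - (h + 1)) with h0 | h0
  · rw [h0]
    exact measurable_const
  · exact hV.comp (measurable_id.prodMk (hst l hl _ (by omega)))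

/-- The estimates remain measurable if the first episode of the epoch is random. -/
lemma measurable_lsviQ_random {β : ℝ} {st : ℕ → ℕ → Γ → S} {ac : ℕ → ℕ → Γ → A}
    {rwd : ℕ → ℕ → Γ → ℝ} {k h : ℕ} {τ : Γ → ℕ} (hτ : Measurable τ)
    (hst : ∀ l < k, ∀ h < H, Measurable (st l h)) (hac : ∀ l < k, ∀ h < H, Measurable (ac l h))
    (hrw : ∀ l < k, ∀ h < H, Measurable (rwd l h)) (hh : h < H) (a : A) :
    Measurable fun p : Γ × S => lsviQ H β 𝓜.φ (fun l j => st l j p.1) (fun l j => ac l j p.1)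
      (fun l j => rwd l j p.1) (τ p.1) k h p.2 a := by
  have h : Measurable fun q : ℕ × (Γ × S) => lsviQ H β 𝓜.φ (fun l j => st l j q.2.1)
      (fun l j => ac l j q.2.1) (fun l j => rwd l j q.2.1) q.1 k h q.2.2 a :=
    measurable_from_prod_countable_right fun t =>
      measurable_lsviQ (β := β) (τ := t) 𝓜 hst hac hrw hh a
  have hp : Measurable fun p : Γ × S => (τ p.1, p) :=
    (hτ.comp measurable_fst).prodMk measurable_id
  simpa only [Function.comp_def] using h.comp hp

end Measurability

/-! ### Linearity and variation of the transition operators -/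

section Discretization

variable {S : Type u} [MeasurableSpace S]

/-- A number in `[0, 1]` is approximated by the proportion of the grid `1 / m, …, m / m` below it.
-/
lemma abs_sum_step_sub_le {m : ℕ} (hm : 0 < m) {y : ℝ} (hy0 : 0 ≤ y) (hy1 : y ≤ 1) :
    |(∑ j ∈ Finset.range m, if ((j : ℝ) + 1) / m ≤ y then (1 : ℝ) else 0) / m - y| ≤ 1 / m := by
  have hm' : (0 : ℝ) < m := by exact_mod_cast hm
  have hfl : ⌊m * y⌋₊ ≤ m := by
    exact Nat.floor_le_of_le (by nlinarith)
  have hset : (Finset.range m).filter (fun j : ℕ => ((j : ℝ) + 1) / m ≤ y) =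
      Finset.range ⌊m * y⌋₊ := by
    ext j
    simp only [Finset.mem_filter, Finset.mem_range]
    rw [div_le_iff₀ hm', mul_comm y, ← Nat.succ_le_iff (m := j) (n := ⌊m * y⌋₊),
      Nat.le_floor_iff (by positivity)]
    push_cast
    constructor
    · exact fun h => h.2
    · intro h
      refine ⟨?_, h⟩
      have : (j : ℝ) + 1 ≤ m := by nlinarith
      exact_mod_cast this
  rw [← Finset.sum_filter, hset]
  simp only [Finset.sum_const, Finset.card_range, nsmul_eq_mul, mul_one]
  have h1 := Nat.floor_le (show 0 ≤ m * y by positivity)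
  have h2 := Nat.lt_floor_add_one (m * y)
  have : (⌊m * y⌋₊ : ℝ) / m - y = (⌊m * y⌋₊ - m * y) / m := by field_simp
  rw [this, abs_div, abs_of_pos hm']
  gcongr
  rw [abs_le]
  constructor <;> linarith

/-- A `[0, 1]`-valued function is integrated up to `1 / m` by summing the probabilities of `m`
superlevel sets. -/
lemma abs_integral_sub_sum_levelSets_le (P : Measure S) [IsProbabilityMeasure P] {U : S → ℝ}
    (hU : Measurable U) (hU0 : ∀ s, 0 ≤ U s) (hU1 : ∀ s, U s ≤ 1) {m : ℕ} (hm : 0 < m) :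
    |(∑ j ∈ Finset.range m, P.real {s | ((j : ℝ) + 1) / m ≤ U s}) / m - ∫ s, U s ∂P| ≤ 1 / m := by
  have hUi : Integrable U P := Integrable.of_bound hU.aestronglyMeasurable 1
    (Filter.Eventually.of_forall fun s => by
      rw [Real.norm_eq_abs, abs_of_nonneg (hU0 s)]; exact hU1 s)
  have hE : ∀ j : ℕ, MeasurableSet {s | ((j : ℝ) + 1) / m ≤ U s} := fun j =>
    measurableSet_le measurable_const hU
  have hstep : ∀ j ∈ Finset.range m,
      Integrable (fun s => if ((j : ℝ) + 1) / m ≤ U s then (1 : ℝ) else 0) P := fun j _ => by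
    have := (integrable_const (1 : ℝ)).indicator (μ := P) (hE j)
    exact this.congr (Filter.Eventually.of_forall fun s => by simp [Set.indicator_apply])
  have h1 : (∑ j ∈ Finset.range m, P.real {s | ((j : ℝ) + 1) / m ≤ U s}) / m =
      ∫ s, (∑ j ∈ Finset.range m, if ((j : ℝ) + 1) / m ≤ U s then (1 : ℝ) else 0) / m ∂P := by
    rw [integral_div, integral_finsetSum _ hstep]
    congr 1
    refine Finset.sum_congr rfl fun j _ => ?_
    rw [← integral_indicator_one (hE j)]
    exact integral_congr_ae (Filter.Eventually.of_forall fun s => by simp [Set.indicator_apply])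
  rw [h1, ← integral_sub ((integrable_finsetSum _ hstep).div_const _) hUi]
  refine (norm_integral_le_of_norm_le_const (C := 1 / m)
    (f := fun s => (∑ j ∈ Finset.range m, if ((j : ℝ) + 1) / m ≤ U s then (1 : ℝ) else 0) / m - U s)
    (Filter.Eventually.of_forall fun s => abs_sum_step_sub_le hm (hU0 s) (hU1 s))).trans ?_
  simp

/-- A bound for the probabilities of events extends to `[0, 1]`-valued functions, without loss. -/
lemma abs_integral_sub_integral_le (P Q : Measure S) [IsProbabilityMeasure P]
    [IsProbabilityMeasure Q] {U : S → ℝ} (hU : Measurable U) (hU0 : ∀ s, 0 ≤ U s)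
    (hU1 : ∀ s, U s ≤ 1) {D : ℝ} (hD : ∀ E, MeasurableSet E → |P.real E - Q.real E| ≤ D) :
    |∫ s, U s ∂P - ∫ s, U s ∂Q| ≤ D := by
  refine le_of_forall_pos_le_add fun ε hε => ?_
  obtain ⟨m, hm⟩ := exists_nat_gt (2 / ε)
  have hm0 : (0 : ℝ) < m := (by positivity : (0 : ℝ) < 2 / ε).trans hm
  have hmn : 0 < m := by exact_mod_cast hm0
  have h1 := abs_integral_sub_sum_levelSets_le P hU hU0 hU1 hmn
  have h2 := abs_integral_sub_sum_levelSets_le Q hU hU0 hU1 hmn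
  have h3 : |(∑ j ∈ Finset.range m, P.real {s | ((j : ℝ) + 1) / m ≤ U s}) / m -
      (∑ j ∈ Finset.range m, Q.real {s | ((j : ℝ) + 1) / m ≤ U s}) / m| ≤ D := by
    rw [← sub_div, ← Finset.sum_sub_distrib, abs_div, abs_of_pos hm0, div_le_iff₀ hm0]
    refine (Finset.abs_sum_le_sum_abs _ _).trans ?_
    refine (Finset.sum_le_sum fun j _ => hD _ (measurableSet_le measurable_const hU)).trans ?_
    simp [mul_comm]
  have h4 : 2 / (m : ℝ) ≤ ε := by
    rw [div_le_iff₀ hm0]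
    rw [div_lt_iff₀ hε] at hm
    linarith
  have h5 : 2 / (m : ℝ) = 1 / m + 1 / m := by ring
  rw [abs_le] at *
  constructor <;> linarith [h1.1, h1.2, h2.1, h2.2, h3.1, h3.2]

end Discretization

section MDP

variable {S : Type u} {A : Type v} [MeasurableSpace S] [MeasurableSpace A] {d H K : ℕ}
  (𝓜 : LinearMDP S A d H K)

namespace LinearMDP

/-- The expected next value `(P_h^k V)(s, a)`. -/
def expect (k h : ℕ) (V : S → ℝ) (s : S) (a : A) : ℝ := ∫ s', V s' ∂(𝓜.trans k h (s, a))

variable {𝓜}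

lemma integrable_trans {k h : ℕ} (hk : k < K) (hh : h < H) {V : S → ℝ} (hV : Measurable V) {B : ℝ}
    (hB : ∀ s, |V s| ≤ B) (s : S) (a : A) : Integrable V (𝓜.trans k h (s, a)) := by
  have := 𝓜.trans_prob k hk h hh s a
  exact Integrable.of_bound hV.aestronglyMeasurable B (Filter.Eventually.of_forall hB)

lemma expect_mono {k h : ℕ} (hk : k < K) (hh : h < H) {V V' : S → ℝ} (hV : Measurable V)
    (hV' : Measurable V') {B B' : ℝ} (hB : ∀ s, |V s| ≤ B) (hB' : ∀ s, |V' s| ≤ B') {C : ℝ}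
    (hVV' : ∀ s, V s ≤ V' s + C) (s : S) (a : A) :
    𝓜.expect k h V s a ≤ 𝓜.expect k h V' s a + C := by
  have := 𝓜.trans_prob k hk h hh s a
  have h1 := integrable_trans (𝓜 := 𝓜) hk hh hV hB s a
  have h2 := integrable_trans (𝓜 := 𝓜) hk hh hV' hB' s a
  calc 𝓜.expect k h V s a ≤ ∫ s', (V' s' + C) ∂(𝓜.trans k h (s, a)) :=
        integral_mono h1 (h2.add (integrable_const C)) hVV'
    _ = _ := by
        rw [integral_add h2 (integrable_const C)]
        simp [expect]

lemma abs_expect_le {k h : ℕ} (hk : k < K) (hh : h < H) {V : S → ℝ} {B : ℝ} (hB : ∀ s, |V s| ≤ B)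
    (s : S) (a : A) : |𝓜.expect k h V s a| ≤ B := by
  have := 𝓜.trans_prob k hk h hh s a
  have h := norm_integral_le_of_norm_le_const (μ := 𝓜.trans k h (s, a)) (f := V)
    (Filter.Eventually.of_forall hB)
  simpa [expect] using h

lemma expect_nonneg {k h : ℕ} {V : S → ℝ} (hV : ∀ s, 0 ≤ V s)
    (s : S) (a : A) : 0 ≤ 𝓜.expect k h V s a := integral_nonneg hV

/-- Reduction to `[0, 1]`-valued functions. -/
lemma expect_affine {k h : ℕ} (hk : k < K) (hh : h < H) {V : S → ℝ} (hV : Measurable V) {B : ℝ}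
    (hB0 : 0 < B) (hB : ∀ s, |V s| ≤ B) (s : S) (a : A) :
    𝓜.expect k h V s a = 2 * B * 𝓜.expect k h (fun s => (V s + B) / (2 * B)) s a - B := by
  have := 𝓜.trans_prob k hk h hh s a
  have h1 := integrable_trans (𝓜 := 𝓜) hk hh hV hB s a
  unfold expect
  rw [integral_div, integral_add h1 (integrable_const B)]
  simp only [integral_const, probReal_univ, smul_eq_mul, one_mul]
  field_simp
  ring

lemma massVec_trans_inner {k h : ℕ} (hk : k < K) (hh : h < H) (s : S) (a : A) :
    ⟪𝓜.φ s a, massVec (𝓜.μ k h) Set.univ⟫ = 1 := by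
  have := 𝓜.trans_prob k hk h hh s a
  rw [← 𝓜.trans_linear k hk h hh s a _ MeasurableSet.univ]
  exact probReal_univ

/-- For a `[0, 1]`-valued function the expected next value is linear in the features. -/
lemma exists_expect_eq_inner_unit {k h : ℕ} (hk : k < K) (hh : h < H) {U : S → ℝ}
    (hU : Measurable U) (hU0 : ∀ s, 0 ≤ U s) (hU1 : ∀ s, U s ≤ 1) :
    ∃ ν : EuclideanSpace ℝ (Fin d), ‖ν‖ ≤ √(d : ℝ) ∧
      ∀ s a, 𝓜.expect k h U s a = ⟪𝓜.φ s a, ν⟫ := by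
  -- the coefficient vectors of the discretized function, and a limit point of them
  set v : ℕ → EuclideanSpace ℝ (Fin d) := fun m => ((m + 1 : ℕ) : ℝ)⁻¹ •
    ∑ j ∈ Finset.range (m + 1), massVec (𝓜.μ k h) {s | ((j : ℝ) + 1) / (m + 1 : ℕ) ≤ U s} with hv
  have hE : ∀ (m j : ℕ), MeasurableSet {s | ((j : ℝ) + 1) / (m + 1 : ℕ) ≤ U s} := fun m j =>
    measurableSet_le measurable_const hU
  have hvn : ∀ m, v m ∈ Metric.closedBall (0 : EuclideanSpace ℝ (Fin d)) (√(d : ℝ)) := fun m => by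
    rw [mem_closedBall_zero_iff, hv, norm_smul, norm_inv, Real.norm_natCast,
      inv_mul_le_iff₀ (by positivity)]
    refine (norm_sum_le _ _).trans ((Finset.sum_le_sum fun j _ =>
      𝓜.norm_μ_le k hk h hh _ (hE m j)).trans ?_)
    simp
  obtain ⟨ν, hν, ψ, hψ, hlim⟩ := (isCompact_closedBall (0 : EuclideanSpace ℝ (Fin d))
    (√(d : ℝ))).tendsto_subseq hvn
  refine ⟨ν, by simpa using hν, fun s a => ?_⟩
  have := 𝓜.trans_prob k hk h hh s a
  have happrox : ∀ m, |⟪𝓜.φ s a, v m⟫ - 𝓜.expect k h U s a| ≤ 1 / ((m : ℝ) + 1) := fun m => by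
    have h1 := abs_integral_sub_sum_levelSets_le (𝓜.trans k h (s, a)) hU hU0 hU1 m.succ_pos
    have h2 : ⟪𝓜.φ s a, v m⟫ = (∑ j ∈ Finset.range (m + 1),
        (𝓜.trans k h (s, a)).real {s | ((j : ℝ) + 1) / (m + 1 : ℕ) ≤ U s}) / (m + 1 : ℕ) := by
      rw [hv, inner_smul_right, inner_sum, div_eq_inv_mul]
      congr 1
      exact Finset.sum_congr rfl fun j _ => (𝓜.trans_linear k hk h hh s a _ (hE m j)).symm
    rw [h2]
    simpa [expect] using h1
  have hl1 : Filter.Tendsto (fun m => ⟪𝓜.φ s a, v m⟫) Filter.atTop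
      (nhds (𝓜.expect k h U s a)) := by
    rw [tendsto_iff_dist_tendsto_zero]
    exact squeeze_zero (fun _ => dist_nonneg) happrox tendsto_one_div_add_atTop_nhds_zero_nat
  have hl2 : Filter.Tendsto (fun m => ⟪𝓜.φ s a, v (ψ m)⟫) Filter.atTop (nhds ⟪𝓜.φ s a, ν⟫) :=
    tendsto_const_nhds.inner hlim
  exact tendsto_nhds_unique (hl1.comp hψ.tendsto_atTop) hl2

/-- The expected next value of a bounded function is linear in the features. -/
lemma exists_expect_eq_inner {k h : ℕ} (hk : k < K) (hh : h < H) {V : S → ℝ}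
    (hV : Measurable V) {B : ℝ} (hB0 : 0 < B) (hB : ∀ s, |V s| ≤ B) :
    ∃ ν : EuclideanSpace ℝ (Fin d), ‖ν‖ ≤ 3 * B * √(d : ℝ) ∧
      ∀ s a, 𝓜.expect k h V s a = ⟪𝓜.φ s a, ν⟫ := by
  obtain ⟨ν, hν, hνe⟩ := exists_expect_eq_inner_unit (𝓜 := 𝓜) hk hh
    (U := fun s => (V s + B) / (2 * B)) ((hV.add_const B).div_const _)
    (fun s => div_nonneg (by linarith [(abs_le.1 (hB s)).1]) (by positivity))
    (fun s => (div_le_one (by positivity)).2 (by linarith [(abs_le.1 (hB s)).2]))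
  -- undo the rescaling; the constant function `1` has the coefficients `μ(S)`
  refine ⟨(2 * B) • ν - B • massVec (𝓜.μ k h) Set.univ, ?_, fun s a => ?_⟩
  · refine (norm_sub_le _ _).trans ?_
    rw [norm_smul, norm_smul, Real.norm_of_nonneg hB0.le, Real.norm_of_nonneg (by positivity)]
    have h1 := 𝓜.norm_μ_le k hk h hh _ MeasurableSet.univ
    nlinarith
  · rw [expect_affine (𝓜 := 𝓜) hk hh hV hB0 hB, hνe, inner_sub_right, inner_smul_right,
      inner_smul_right, massVec_trans_inner hk hh]
    ring

lemma norm_massVec_sub_le {k h : ℕ} (hk : k + 1 < K) (hh : h < H) {E : Set S}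
    (hE : MeasurableSet E) :
    ‖massVec (𝓜.μ (k + 1) h) E - massVec (𝓜.μ k h) E‖ ≤
      variationNorm (fun i => 𝓜.μ (k + 1) h i - 𝓜.μ k h i) := by
  have heq : ∀ F : Set S, massVec (fun i => 𝓜.μ (k + 1) h i - 𝓜.μ k h i) F =
      massVec (𝓜.μ (k + 1) h) F - massVec (𝓜.μ k h) F := fun F => by
    ext i
    simp [massVec]
  -- the supremum in the variation norm is a genuine one
  have hbdd : BddAbove (Set.range fun F : {F : Set S // MeasurableSet F} =>
      ‖massVec (fun i => 𝓜.μ (k + 1) h i - 𝓜.μ k h i) F.1‖) := by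
    refine ⟨√(d : ℝ) + √(d : ℝ), ?_⟩
    rintro _ ⟨F, rfl⟩
    simp only
    rw [heq]
    exact (norm_sub_le _ _).trans (add_le_add (𝓜.norm_μ_le _ hk h hh _ F.2)
      (𝓜.norm_μ_le _ (by omega) h hh _ F.2))
  rw [← heq]
  exact le_ciSup hbdd ⟨E, hE⟩

lemma variationNorm_nonneg {d : ℕ} (ν : Fin d → SignedMeasure S) : 0 ≤ variationNorm ν :=
  Real.iSup_nonneg fun _ => norm_nonneg _

lemma norm_massVec_sub_le_sum {l k h : ℕ} (hlk : l ≤ k) (hk : k < K) (hh : h < H) {E : Set S}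
    (hE : MeasurableSet E) :
    ‖massVec (𝓜.μ k h) E - massVec (𝓜.μ l h) E‖ ≤
      ∑ j ∈ Finset.Ico l k, variationNorm (fun i => 𝓜.μ (j + 1) h i - 𝓜.μ j h i) := by
  induction k, hlk using Nat.le_induction with
  | base => simp
  | succ k hlk ih =>
    rw [Finset.sum_Ico_succ_top hlk, ← sub_add_sub_cancel _ (massVec (𝓜.μ k h) E), add_comm]
    exact (norm_add_le _ _).trans (add_le_add (ih (by omega)) (norm_massVec_sub_le hk hh hE))

lemma norm_θ_sub_le_sum {l k h : ℕ} (hlk : l ≤ k) :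
    ‖𝓜.θ k h - 𝓜.θ l h‖ ≤ ∑ j ∈ Finset.Ico l k, ‖𝓜.θ (j + 1) h - 𝓜.θ j h‖ := by
  induction k, hlk using Nat.le_induction with
  | base => simp
  | succ k hlk ih =>
    rw [Finset.sum_Ico_succ_top hlk, ← sub_add_sub_cancel _ (𝓜.θ k h), add_comm]
    exact (norm_add_le _ _).trans (add_le_add ih le_rfl)

/-- The one-episode drift at step `h` between the episodes `j` and `j + 1`: variation of the rewards
plus variation of the expected next values of functions bounded by `H`. It is zero by convention
if `j` is the last episode, so that sums of drifts over episodes are bounded by the budgets. -/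
def drift (𝓜 : LinearMDP S A d H K) (j h : ℕ) : ℝ :=
  if j + 1 < K then ‖𝓜.θ (j + 1) h - 𝓜.θ j h‖ +
    2 * H * variationNorm (fun i => 𝓜.μ (j + 1) h i - 𝓜.μ j h i) else 0

lemma drift_nonneg (j h : ℕ) : 0 ≤ 𝓜.drift j h := by
  have := variationNorm_nonneg (fun i => 𝓜.μ (j + 1) h i - 𝓜.μ j h i)
  unfold drift
  split_ifs <;> positivity

/-- Rewards and expected next values change by at most the accumulated drift. -/
lemma abs_reward_add_expect_sub_le {l k h : ℕ} (hlk : l ≤ k) (hk : k < K) (hh : h < H) {V : S → ℝ}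
    (hV : Measurable V) (hB : ∀ s, |V s| ≤ H) (s : S) (a : A) :
    |𝓜.reward l h s a + 𝓜.expect l h V s a - (𝓜.reward k h s a + 𝓜.expect k h V s a)| ≤
      ∑ j ∈ Finset.Ico l k, 𝓜.drift j h := by
  have hH : (0 : ℝ) < H := by exact_mod_cast (Nat.zero_lt_of_lt hh)
  have := 𝓜.trans_prob k hk h hh s a
  have := 𝓜.trans_prob l (by omega) h hh s a
  have h1 : |𝓜.reward l h s a - 𝓜.reward k h s a| ≤
      ∑ j ∈ Finset.Ico l k, ‖𝓜.θ (j + 1) h - 𝓜.θ j h‖ := by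
    rw [reward, reward, ← inner_sub_right]
    refine (abs_real_inner_le_norm _ _).trans ?_
    rw [norm_sub_rev]
    calc _ ≤ 1 * ‖𝓜.θ k h - 𝓜.θ l h‖ := by gcongr; exact 𝓜.norm_φ_le s a
      _ ≤ _ := by rw [one_mul]; exact norm_θ_sub_le_sum hlk
  have h2 : |𝓜.expect l h V s a - 𝓜.expect k h V s a| ≤ 2 * H *
      ∑ j ∈ Finset.Ico l k, variationNorm (fun i => 𝓜.μ (j + 1) h i - 𝓜.μ j h i) := by
    rw [expect_affine (by omega) hh hV hH hB, expect_affine hk hh hV hH hB,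
      sub_sub_sub_cancel_right, ← mul_sub, abs_mul, abs_of_pos (by positivity : (0 : ℝ) < 2 * H)]
    refine mul_le_mul_of_nonneg_left ?_ (by positivity)
    refine abs_integral_sub_integral_le _ _ ((hV.add_const _).div_const _)
      (fun s => div_nonneg (by linarith [(abs_le.1 (hB s)).1]) (by positivity))
      (fun s => (div_le_one (by positivity)).2 (by linarith [(abs_le.1 (hB s)).2]))
      fun E hE => ?_
    rw [𝓜.trans_linear l (by omega) h hh s a E hE, 𝓜.trans_linear k hk h hh s a E hE,
      ← inner_sub_right]
    refine (abs_real_inner_le_norm _ _).trans ?_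
    rw [norm_sub_rev]
    calc _ ≤ 1 * ‖massVec (𝓜.μ k h) E - massVec (𝓜.μ l h) E‖ := by
          gcongr; exact 𝓜.norm_φ_le s a
      _ ≤ _ := by rw [one_mul]; exact norm_massVec_sub_le_sum hlk hk hh hE
  have h3 : ∑ j ∈ Finset.Ico l k, 𝓜.drift j h = ∑ j ∈ Finset.Ico l k, ‖𝓜.θ (j + 1) h - 𝓜.θ j h‖ +
      2 * H * ∑ j ∈ Finset.Ico l k, variationNorm (fun i => 𝓜.μ (j + 1) h i - 𝓜.μ j h i) := by
    rw [Finset.mul_sum, ← Finset.sum_add_distrib]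
    refine Finset.sum_congr rfl fun j hj => ?_
    have : j + 1 < K := by
      have := (Finset.mem_Ico.1 hj).2
      omega
    rw [drift, if_pos this]
  rw [h3, add_sub_add_comm]
  exact (abs_add_le _ _).trans (add_le_add h1 h2)

/-! ### Values and optimal values -/

/-- The optimal value with `n` steps to go, by the Bellman optimality equation. Only the inequality
`optValue ≤ optToGo` is needed. -/
def optToGo (𝓜 : LinearMDP S A d H K) (k : ℕ) : ℕ → S → ℝ
  | 0 => fun _ => 0
  | n + 1 => fun s => ⨆ a, (𝓜.reward k (H - (n + 1)) s a +
      𝓜.expect k (H - (n + 1)) (optToGo 𝓜 k n) s a)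

lemma measurable_expect {k h : ℕ} (hk : k < K) (hh : h < H) {Γ : Type*} {mΓ : MeasurableSpace Γ}
    {V : Γ → S → ℝ} (hV : Measurable fun p : Γ × S => V p.1 p.2) {f : Γ → S} {g : Γ → A}
    (hf : Measurable f) (hg : Measurable g) :
    Measurable fun x => 𝓜.expect k h (V x) (f x) (g x) := by
  have := 𝓜.isMarkovKernel_trans hk hh
  exact (StronglyMeasurable.integral_kernel_prod_right'
    (κ := (𝓜.trans k h).comap (fun x => (f x, g x)) (hf.prodMk hg))
    hV.stronglyMeasurable).measurable

lemma optToGo_mem [Nonempty A] {k n : ℕ} (hk : k < K) (hn : n ≤ H) (s : S) :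
    0 ≤ 𝓜.optToGo k n s ∧ 𝓜.optToGo k n s ≤ n := by
  induction n generalizing s with
  | zero => simp [optToGo]
  | succ n ih =>
    have ih := ih (by omega)
    have hh : H - (n + 1) < H := by omega
    constructor
    · refine Real.iSup_nonneg fun a => add_nonneg (𝓜.reward_nonneg k hk _ hh s a) ?_
      exact expect_nonneg (fun s => (ih s).1) s a
    · refine ciSup_le fun a => ?_
      have h1 := 𝓜.reward_le_one k hk _ hh s a
      have h2 := (abs_le.1 (abs_expect_le (𝓜 := 𝓜) hk hh (V := 𝓜.optToGo k n) (B := n)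
        (fun s => abs_le.2 ⟨by linarith [(ih s).1, n.cast_nonneg (α := ℝ)], (ih s).2⟩) s a)).2
      push_cast
      rw [reward]
      linarith

lemma valueToGo_mem {k n : ℕ} (hk : k < K) (hn : n ≤ H) (π : ℕ → S → A) (s : S) :
    0 ≤ 𝓜.valueToGo k π n s ∧ 𝓜.valueToGo k π n s ≤ n := by
  induction n generalizing s with
  | zero => simp [valueToGo]
  | succ n ih =>
    have ih := ih (by omega)
    have hh : H - (n + 1) < H := by omega
    have h1 := 𝓜.reward_le_one k hk _ hh s (π (H - (n + 1)) s)
    have h2 := (abs_le.1 (abs_expect_le (𝓜 := 𝓜) hk hh (V := 𝓜.valueToGo k π n) (B := n)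
      (fun s => abs_le.2 ⟨by linarith [(ih s).1, n.cast_nonneg (α := ℝ)], (ih s).2⟩) s
      (π (H - (n + 1)) s))).2
    constructor
    · refine add_nonneg (𝓜.reward_nonneg k hk _ hh s _) ?_
      exact expect_nonneg (fun s => (ih s).1) s _
    · rw [expect] at h2
      simp only [valueToGo, reward]
      push_cast
      linarith

section Finite

variable [MeasurableSingletonClass A] [Finite A]

lemma measurable_optToGo {k n : ℕ} (hk : k < K) (hn : n ≤ H) : Measurable (𝓜.optToGo k n) := by
  induction n with
  | zero => exact measurable_const
  | succ n ih =>
    refine Measurable.iSup fun a => (𝓜.measurable_reward measurable_id measurable_const _ _).add ?_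
    exact measurable_expect hk (by omega) (Γ := S) (V := fun _ => 𝓜.optToGo k n)
      ((ih (by omega)).comp measurable_snd) measurable_id measurable_const

lemma measurable_valueToGo {k n : ℕ} (hk : k < K) (hn : n ≤ H) {Γ : Type*} {mΓ : MeasurableSpace Γ}
    {π : Γ → ℕ → S → A} (hπ : ∀ h < H, Measurable fun p : Γ × S => π p.1 h p.2) :
    Measurable fun p : Γ × S => 𝓜.valueToGo k (π p.1) n p.2 := by
  induction n with
  | zero => exact measurable_const
  | succ n ih =>
    refine (𝓜.measurable_reward measurable_snd (hπ _ (by omega)) _ _).add ?_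
    have h1 : Measurable fun q : (Γ × S) × S => 𝓜.valueToGo k (π q.1.1) n q.2 :=
      (ih (by omega)).comp ((measurable_fst.comp measurable_fst).prodMk measurable_snd)
    exact measurable_expect hk (by omega) (V := fun p : Γ × S => 𝓜.valueToGo k (π p.1) n)
      h1 measurable_snd (hπ _ (by omega))

variable [Nonempty A]

lemma valueToGo_le_optToGo {k n : ℕ} (hk : k < K) (hn : n ≤ H) {π : ℕ → S → A}
    (hπ : ∀ h, Measurable (π h)) (s : S) : 𝓜.valueToGo k π n s ≤ 𝓜.optToGo k n s := by
  induction n generalizing s with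
  | zero => simp [optToGo, valueToGo]
  | succ n ih =>
    have ih := ih (by omega)
    have hh : H - (n + 1) < H := by omega
    have hm : Measurable (𝓜.valueToGo k π n) :=
      (measurable_valueToGo (𝓜 := 𝓜) hk (n := n) (by omega) (Γ := S) (π := fun _ => π)
        (fun h _ => (hπ h).comp measurable_snd)).comp (measurable_id.prodMk measurable_id)
    have hb : ∀ s, |𝓜.valueToGo k π n s| ≤ n := fun s => by
      have := valueToGo_mem (𝓜 := 𝓜) hk (by omega : n ≤ H) π s
      exact abs_le.2 ⟨by linarith [n.cast_nonneg (α := ℝ)], this.2⟩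
    have hb' : ∀ s, |𝓜.optToGo k n s| ≤ n := fun s => by
      have := optToGo_mem (𝓜 := 𝓜) hk (by omega : n ≤ H) s
      exact abs_le.2 ⟨by linarith [n.cast_nonneg (α := ℝ)], this.2⟩
    have h1 := expect_mono (𝓜 := 𝓜) hk hh hm (measurable_optToGo hk (by omega)) hb hb' (C := 0)
      (fun s => by simpa using ih s) s (π (H - (n + 1)) s)
    have h2 := le_ciSup (f := fun a => 𝓜.reward k (H - (n + 1)) s a +
      𝓜.expect k (H - (n + 1)) (𝓜.optToGo k n) s a) (Set.finite_range _).bddAbove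
      (π (H - (n + 1)) s)
    simp only [valueToGo, optToGo]
    simp only [expect] at h1 h2 ⊢
    linarith

lemma optValue_le {k : ℕ} (hk : k < K) (s : S) : 𝓜.optValue k s ≤ 𝓜.optToGo k H s := by
  have : Nonempty {π : ℕ → S → A // ∀ h, Measurable (π h)} :=
    ⟨⟨fun _ _ => Classical.arbitrary A, fun _ => measurable_const⟩⟩
  exact ciSup_le fun π => valueToGo_le_optToGo hk le_rfl π.2 s

end Finite

end LinearMDP

end MDP

/-! ### Adaptedness of a run -/

section RunFacts

variable {S : Type u} {A : Type v} [MeasurableSpace S] [MeasurableSpace A] {d H K : ℕ} {Ω : Type w}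

lemma tick_le_tick {H k h k' h' : ℕ} (hh : h ≤ H + 1) (hk : k < k') :
    tick H k h ≤ tick H k' h' := by
  unfold tick
  calc k * (H + 1) + h ≤ k * (H + 1) + (H + 1) := by omega
    _ = (k + 1) * (H + 1) := by ring
    _ ≤ k' * (H + 1) := Nat.mul_le_mul_right _ hk
    _ ≤ _ := by omega

lemma tick_mono {H k h k' h' : ℕ} (hk : k ≤ k') (hh : h ≤ h') : tick H k h ≤ tick H k' h' := by
  unfold tick
  exact Nat.add_le_add (Nat.mul_le_mul_right _ hk) hh

/-- The value estimate with `n` steps to go that a run computes in episode `k` from the data of the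
episodes from `τ` on. -/
def runV (𝓜 : LinearMDP S A d H K) (c p : ℝ) (st : ℕ → ℕ → Ω → S) (ac : ℕ → ℕ → Ω → A)
    (τ k n : ℕ) (ω : Ω) (s : S) : ℝ :=
  lsviV H (confWidth c p d H K) 𝓜.φ (fun l j => st l j ω) (fun l j => ac l j ω)
    (fun l j => 𝓜.reward l j (st l j ω) (ac l j ω)) τ k n s

/-- The centred next value `V_l(s_{h+1}^l) - (P_h^l V_l)(s_h^l, a_h^l)` observed in episode `l`. -/
def nextNoise (𝓜 : LinearMDP S A d H K) (st : ℕ → ℕ → Ω → S) (ac : ℕ → ℕ → Ω → A) (h : ℕ)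
    (V : ℕ → Ω → S → ℝ) (l : ℕ) (ω : Ω) : ℝ :=
  V l ω (st l (h + 1) ω) - 𝓜.expect l h (V l ω) (st l h ω) (ac l h ω)

lemma measurable_epochStart {m : MeasurableSpace Ω} {Δ : ℕ} {arm : Ω → Fin Δ}
    (harm : Measurable arm) (M k : ℕ) : Measurable fun ω => epochStart M (2 ^ (arm ω : ℕ)) k :=
  (measurable_of_finite fun a : Fin Δ => epochStart M (2 ^ (a : ℕ)) k).comp harm

lemma measurable_adaPolicy_of [MeasurableSingletonClass A] [Finite A] {m : MeasurableSpace Ω}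
    (𝓜 : LinearMDP S A d H K) (sel : ArgmaxRule A) (c b p : ℝ) {st : ℕ → ℕ → Ω → S}
    {ac : ℕ → ℕ → Ω → A} {arm : ℕ → Ω → Fin (numArms b d H K)} {k h : ℕ} (hh : h < H)
    (harm : Measurable (arm (k / blockLen b d H K)))
    (hst : ∀ l < k, ∀ h < H, Measurable (st l h)) (hac : ∀ l < k, ∀ h < H, Measurable (ac l h)) :
    Measurable fun q : Ω × S => adaPolicy 𝓜 sel c b p st ac arm k q.1 h q.2 := by
  unfold adaPolicy
  refine sel.measurable_pick.comp (measurable_pi_iff.2 fun a => ?_)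
  exact measurable_lsviQ_random (Γ := Ω) (rwd := fun l j ω => 𝓜.reward l j (st l j ω) (ac l j ω))
    𝓜 (measurable_epochStart harm _ _) hst hac
    (fun l hl j hj => 𝓜.measurable_reward (hst l hl j hj) (hac l hl j hj) _ _) hh a

variable [mΩ : MeasurableSpace Ω] {𝓜 : LinearMDP S A d H K} {sel : ArgmaxRule A} {c b p : ℝ}
  {P : Measure Ω} {ℱ : Filtration ℕ (inferInstance : MeasurableSpace Ω)}
  {st : ℕ → ℕ → Ω → S} {ac : ℕ → ℕ → Ω → A} {arm : ℕ → Ω → Fin (numArms b d H K)}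

namespace IsAdaRun

lemma measurable_st (hrun : IsAdaRun 𝓜 sel c b p P ℱ st ac arm) {k h t : ℕ} (hk : k < K)
    (hh : h < H) (ht : tick H k (h + 1) ≤ t) : Measurable[ℱ t] (st k h) :=
  (hrun.state_measurable k hk h hh).mono (ℱ.mono ht) le_rfl

lemma measurable_arm (hrun : IsAdaRun 𝓜 sel c b p P ℱ st ac arm) {k t : ℕ} (hk : k < K)
    (ht : tick H k 1 ≤ t) : Measurable[ℱ t] (arm (k / blockLen b d H K)) := by
  have hle : k / blockLen b d H K * blockLen b d H K ≤ k := Nat.div_mul_le_self _ _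
  exact (hrun.arm_measurable _ (hle.trans_lt hk)).mono
    (ℱ.mono ((tick_mono hle le_rfl).trans ht)) le_rfl

variable [MeasurableSingletonClass A] [Finite A]

/-- The actions are adapted. The action of episode `k` is a function of the state, of the window of
the block and of the data of the earlier episodes, hence strong induction on `k`. -/
lemma measurable_ac_tick (hrun : IsAdaRun 𝓜 sel c b p P ℱ st ac arm) {k : ℕ} (hk : k < K) :
    ∀ h < H, Measurable[ℱ (tick H k (h + 1))] (ac k h) := by
  induction k using Nat.strong_induction_on with
  | _ k ih =>
    intro h hh
    have hpol := @measurable_adaPolicy_of S A _ _ d H K Ω _ _ (ℱ (tick H k (h + 1))) 𝓜 sel c b p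
      st ac arm k h hh (hrun.measurable_arm hk (tick_mono le_rfl (by omega)))
      (fun l hl j hj => hrun.measurable_st (hl.trans hk) hj (tick_le_tick (by omega) hl))
      (fun l hl j hj => (ih l hl (hl.trans hk) j hj).mono
        (ℱ.mono (tick_le_tick (by omega) hl)) le_rfl)
    have hid : Measurable[ℱ (tick H k (h + 1)), (ℱ (tick H k (h + 1))).prod inferInstance]
        fun ω => (ω, st k h ω) :=
      Measurable.prodMk (m := ℱ (tick H k (h + 1))) measurable_id
        (hrun.measurable_st hk hh le_rfl)
    have heq : ac k h = fun ω => adaPolicy 𝓜 sel c b p st ac arm k ω h (st k h ω) :=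
      funext (hrun.action_eq k hk h hh)
    rw [heq]
    have hcomp := hpol.comp hid
    simpa only [Function.comp_def] using hcomp

lemma measurable_ac (hrun : IsAdaRun 𝓜 sel c b p P ℱ st ac arm) {k h t : ℕ} (hk : k < K)
    (hh : h < H) (ht : tick H k (h + 1) ≤ t) : Measurable[ℱ t] (ac k h) :=
  (hrun.measurable_ac_tick hk h hh).mono (ℱ.mono ht) le_rfl

lemma measurable_rw (hrun : IsAdaRun 𝓜 sel c b p P ℱ st ac arm) {k h t : ℕ} (hk : k < K)
    (hh : h < H) (ht : tick H k (h + 1) ≤ t) :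
    Measurable[ℱ t] fun ω => 𝓜.reward k h (st k h ω) (ac k h ω) :=
  𝓜.measurable_reward (mΓ := ℱ t) (hrun.measurable_st hk hh ht) (hrun.measurable_ac hk hh ht) k h

lemma measurable_policy (hrun : IsAdaRun 𝓜 sel c b p P ℱ st ac arm) {k h t : ℕ} (hk : k < K)
    (hh : h < H) (ht : tick H k 1 ≤ t) : Measurable[(ℱ t).prod inferInstance]
      fun q : Ω × S => adaPolicy 𝓜 sel c b p st ac arm k q.1 h q.2 :=
  measurable_adaPolicy_of (m := ℱ t) 𝓜 sel c b p hh (hrun.measurable_arm hk ht)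
    (fun _ hl _ hj => hrun.measurable_st (hl.trans hk) hj ((tick_le_tick (by omega) hl).trans ht))
    (fun _ hl _ hj => hrun.measurable_ac (hl.trans hk) hj ((tick_le_tick (by omega) hl).trans ht))

lemma measurable_runV (hrun : IsAdaRun 𝓜 sel c b p P ℱ st ac arm) {k n t : ℕ} (hk : k < K)
    (hn : n ≤ H) (ht : tick H k 0 ≤ t) (τ : ℕ) : Measurable[(ℱ t).prod inferInstance]
      fun q : Ω × S => runV 𝓜 c p st ac τ k n q.1 q.2 :=
  measurable_lsviV (Γ := Ω) (mΓ := ℱ t)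
    (rwd := fun l j ω => 𝓜.reward l j (st l j ω) (ac l j ω)) 𝓜
    (fun _ hl _ hj => hrun.measurable_st (hl.trans hk) hj ((tick_le_tick (by omega) hl).trans ht))
    (fun _ hl _ hj => hrun.measurable_ac (hl.trans hk) hj ((tick_le_tick (by omega) hl).trans ht))
    (fun _ hl _ hj => hrun.measurable_rw (hl.trans hk) hj ((tick_le_tick (by omega) hl).trans ht))
    hn

lemma measurable_feature (hrun : IsAdaRun 𝓜 sel c b p P ℱ st ac arm) {k h t : ℕ} (hk : k < K)
    (hh : h < H) (ht : tick H k (h + 1) ≤ t) :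
    Measurable[ℱ t] fun ω => (𝓜.φ (st k h ω) (ac k h ω)).ofLp :=
  𝓜.measurable_φ_coord (mΓ := ℱ t) (hrun.measurable_st hk hh ht) (hrun.measurable_ac hk hh ht)

variable [IsProbabilityMeasure P]

/-- Concentration of the next values of predictable functions, with predictable vector weights,
over a range of episodes. -/
theorem concentration (hrun : IsAdaRun 𝓜 sel c b p P ℱ st ac arm) {h : ℕ} (hh : h + 1 < H)
    {τ n : ℕ} (hτn : τ ≤ n) (hn : n ≤ K) {d' : ℕ} {x : ℕ → Ω → Fin d' → ℝ}
    (hx : ∀ l < K, Measurable[ℱ (tick H l (h + 1))] (x l))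
    (hx1 : ∀ l < K, ∀ ω, x l ω ⬝ᵥ x l ω ≤ 1) {V : ℕ → Ω → S → ℝ}
    (hV : ∀ l < K, Measurable[(ℱ (tick H l (h + 1))).prod inferInstance]
      fun q : Ω × S => V l q.1 q.2)
    {R : ℝ} (hR : 0 < R) (hVR : ∀ l < K, ∀ ω s, |V l ω s| ≤ R) {δ : ℝ} (hδ : 0 < δ) :
    P {ω | confRadius d' (n - τ) (2 * R) δ < invForm (fun l => x l ω) τ n
      (noiseSum (fun l => x l ω) (fun l => nextNoise 𝓜 st ac h V l ω) τ n)
      (noiseSum (fun l => x l ω) (fun l => nextNoise 𝓜 st ac h V l ω) τ n)} ≤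
        ENNReal.ofReal δ := by
  have hlt : ∀ l ∈ Finset.Ico τ n, l < K := fun l hl => (Finset.mem_Ico.1 hl).2.trans_le hn
  refine measure_confRadius_lt_le (P := P) (m := fun l => ℱ (tick H l (h + 1)))
    (ε := nextNoise 𝓜 st ac h V) (fun l => ℱ.le _) (fun l l' hl => ℱ.mono (tick_mono hl le_rfl))
    (by positivity) hδ hτn (fun l hl => hx l (hlt l hl)) (fun l hl => hx1 l (hlt l hl)) ?_ ?_ ?_
  · intro l hl
    have hlK := hlt l hl
    have ht : tick H l (h + 1 + 1) ≤ tick H (l + 1) (h + 1) :=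
      tick_le_tick (by omega) (Nat.lt_succ_self l)
    have ht' : tick H l (h + 1) ≤ tick H (l + 1) (h + 1) := tick_mono (Nat.le_succ l) le_rfl
    have hpair : Measurable[ℱ (tick H (l + 1) (h + 1)),
        (ℱ (tick H l (h + 1))).prod inferInstance] fun ω => (ω, st l (h + 1) ω) :=
      (measurable_id'' (ℱ.mono ht')).prodMk (hrun.measurable_st hlK hh ht)
    refine Measurable.sub ((hV l hlK).comp hpair) ?_
    exact (LinearMDP.measurable_expect (mΓ := ℱ (tick H l (h + 1))) hlK (by omega) (hV l hlK)
      (hrun.measurable_st hlK (by omega) le_rfl)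
      (hrun.measurable_ac hlK (by omega) le_rfl)).mono (ℱ.mono ht') le_rfl
  · intro l hl ω
    have hlK := hlt l hl
    have h1 := hVR l hlK ω (st l (h + 1) ω)
    have h2 := LinearMDP.abs_expect_le (𝓜 := 𝓜) hlK (by omega : h < H) (hVR l hlK ω)
      (st l h ω) (ac l h ω)
    calc _ ≤ |V l ω (st l (h + 1) ω)| + |𝓜.expect l h (V l ω) (st l h ω) (ac l h ω)| :=
          abs_sub _ _
      _ ≤ 2 * R := by linarith
  · intro l hl
    have hlK := hlt l hl
    have := 𝓜.isMarkovKernel_trans hlK (by omega : h < H)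
    have hsa : Measurable[ℱ (tick H l (h + 1))] fun ω => (st l h ω, ac l h ω) :=
      Measurable.prodMk (m := ℱ (tick H l (h + 1))) (hrun.measurable_st hlK (by omega) le_rfl)
        (hrun.measurable_ac hlK (by omega) le_rfl)
    exact condMeanZero_kernel (ℱ.le (tick H l (h + 1)))
      ((hrun.measurable_st hlK hh le_rfl).mono (ℱ.le _) le_rfl)
      (@Kernel.comap _ _ _ _ _ (ℱ (tick H l (h + 1))) (𝓜.trans l h)
        (fun ω => (st l h ω, ac l h ω)) hsa)
      (fun E hE => hrun.state_law l hlK h hh E hE) (hV l hlK) (hVR l hlK)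

end IsAdaRun

/-- With a single constant feature the Gram matrix counts the observations. -/
lemma invForm_one (τ k : ℕ) (y : Fin 1 → ℝ) :
    invForm (fun _ => (1 : Fin 1 → ℝ)) τ k y y = y 0 ^ 2 / (1 + (k - τ : ℕ)) := by
  have h : gramSum (fun _ => (1 : Fin 1 → ℝ)) τ k 0 0 = 1 + (k - τ : ℕ) := by
    rw [gramSum, Matrix.add_apply, Matrix.sum_apply]
    simp only [Matrix.vecMulVec_apply]
    simp
  simp [invForm, dotProduct, Matrix.mulVec, Matrix.inv_subsingleton, h]
  ring

/-- Radius of a confidence interval for a sum of `n` martingale increments bounded by `R`. -/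
def sumRadius (n : ℕ) (R δ : ℝ) : ℝ := √((1 + n) * confRadius 1 n R δ)

namespace IsAdaRun

variable [MeasurableSingletonClass A] [Finite A] [IsProbabilityMeasure P]

/-- Concentration of sums: the case of a single constant feature. -/
theorem concentration_sum (hrun : IsAdaRun 𝓜 sel c b p P ℱ st ac arm) {h : ℕ} (hh : h + 1 < H)
    {τ n : ℕ} (hτn : τ ≤ n) (hn : n ≤ K) {V : ℕ → Ω → S → ℝ}
    (hV : ∀ l < K, Measurable[(ℱ (tick H l (h + 1))).prod inferInstance]
      fun q : Ω × S => V l q.1 q.2)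
    {R : ℝ} (hR : 0 < R) (hVR : ∀ l < K, ∀ ω s, |V l ω s| ≤ R) {δ : ℝ} (hδ : 0 < δ) :
    P {ω | sumRadius (n - τ) (2 * R) δ < |∑ l ∈ Finset.Ico τ n, nextNoise 𝓜 st ac h V l ω|} ≤
      ENNReal.ofReal δ := by
  refine le_trans (measure_mono fun ω hω => ?_) (hrun.concentration (d' := 1)
    (x := fun _ _ => 1) hh hτn hn (fun _ _ => measurable_const) (fun _ _ _ => by simp) hV hR hVR hδ)
  simp only [Set.mem_ofPred_eq] at hω ⊢
  rw [invForm_one, lt_div_iff₀ (by positivity)]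
  have h1 := Real.lt_sq_of_sqrt_lt hω
  rw [sq_abs] at h1
  have h2 : noiseSum (fun _ => (1 : Fin 1 → ℝ)) (fun l => nextNoise 𝓜 st ac h V l ω) τ n 0 =
      ∑ l ∈ Finset.Ico τ n, nextNoise 𝓜 st ac h V l ω := by
    simp [noiseSum]
  rw [h2]
  linarith

end IsAdaRun

end RunFacts

/-! ### A finite net of value estimates -/

section Net

/-- The parametric class of value estimates clipped to `[-H, H]`, with weight `w` and with `G` in
the role of the inverse Gram matrix. -/
def estClass {S : Type u} {A : Type v} {d : ℕ} (H : ℕ) (β : ℝ)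
    (φ : S → A → EuclideanSpace ℝ (Fin d)) (w : Fin d → ℝ) (G : Matrix (Fin d) (Fin d) ℝ)
    (s : S) : ℝ :=
  max (-(H : ℝ)) (⨆ a, min (w ⬝ᵥ (φ s a).ofLp +
    β * √((φ s a).ofLp ⬝ᵥ Matrix.mulVec G (φ s a).ofLp)) (H : ℝ))

lemma sqrt_le_sqrt_add_sqrt {x y z : ℝ} (hz : 0 ≤ z) (h : x ≤ y + z) : √x ≤ √y + √z := by
  rcases le_or_gt 0 y with hy | hy
  · apply Real.sqrt_le_iff.2 ⟨by positivity, ?_⟩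
    rw [add_sq, Real.sq_sqrt hy, Real.sq_sqrt hz]
    have : 0 ≤ 2 * √y * √z := by positivity
    linarith
  · have : √x ≤ √z := Real.sqrt_le_sqrt (by linarith)
    have := Real.sqrt_nonneg y
    linarith

lemma abs_coord_le_one {d : ℕ} {x : Fin d → ℝ} (hx : x ⬝ᵥ x ≤ 1) (i : Fin d) : |x i| ≤ 1 := by
  rw [← sq_le_one_iff_abs_le_one]
  refine le_trans ?_ hx
  rw [sq]
  exact Finset.single_le_sum (f := fun i => x i * x i) (fun j _ => mul_self_nonneg _)
    (Finset.mem_univ i)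

/-- The value estimates depend continuously on their parameters, uniformly in the state. The root in
the bonus is responsible for the term with `√ε`. -/
lemma estClass_le_add {S : Type u} {A : Type v} [Finite A] [Nonempty A] {d : ℕ} {H : ℕ} {β ε : ℝ}
    (hβ : 0 ≤ β) (hε : 0 ≤ ε) {φ : S → A → EuclideanSpace ℝ (Fin d)}
    (hφ : ∀ s a, (φ s a).ofLp ⬝ᵥ (φ s a).ofLp ≤ 1) {w w' : Fin d → ℝ}
    {G G' : Matrix (Fin d) (Fin d) ℝ} (hw : ∀ i, |w i - w' i| ≤ ε)
    (hG : ∀ i j, |G i j - G' i j| ≤ ε) (s : S) :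
    estClass H β φ w G s ≤ estClass H β φ w' G' s + (d * ε + β * (d * √ε)) := by
  set C := d * ε + β * (d * √ε) with hC
  have hC0 : 0 ≤ C := by positivity
  have hlin : ∀ a, w ⬝ᵥ (φ s a).ofLp ≤ w' ⬝ᵥ (φ s a).ofLp + d * ε := fun a => by
    have h1 : (w - w') ⬝ᵥ (φ s a).ofLp ≤ d * ε := by
      calc (w - w') ⬝ᵥ (φ s a).ofLp ≤ ∑ _i : Fin d, ε := by
            refine Finset.sum_le_sum fun i _ => (le_abs_self _).trans ?_
            rw [abs_mul]
            have := mul_le_mul (hw i) (abs_coord_le_one (hφ s a) i) (abs_nonneg _) hε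
            simpa using this
        _ = _ := by simp
    rw [sub_dotProduct] at h1
    linarith
  have hquad : ∀ a, √((φ s a).ofLp ⬝ᵥ Matrix.mulVec G (φ s a).ofLp) ≤
      √((φ s a).ofLp ⬝ᵥ Matrix.mulVec G' (φ s a).ofLp) + d * √ε := fun a => by
    have h1 : (φ s a).ofLp ⬝ᵥ Matrix.mulVec (G - G') (φ s a).ofLp ≤ d ^ 2 * ε := by
      calc (φ s a).ofLp ⬝ᵥ Matrix.mulVec (G - G') (φ s a).ofLp
          ≤ ∑ _i : Fin d, ∑ _j : Fin d, ε := by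
            simp only [dotProduct, Matrix.mulVec, Finset.mul_sum]
            refine Finset.sum_le_sum fun i _ => Finset.sum_le_sum fun j _ =>
              (le_abs_self _).trans ?_
            rw [abs_mul, abs_mul]
            have h2 := mul_le_mul (hG i j) (abs_coord_le_one (hφ s a) j) (abs_nonneg _) hε
            have h3 := mul_le_mul (abs_coord_le_one (hφ s a) i) h2
              (mul_nonneg (abs_nonneg _) (abs_nonneg _)) zero_le_one
            simpa using h3
        _ = _ := by simp; ring
    rw [Matrix.sub_mulVec, dotProduct_sub] at h1
    have h2 := sqrt_le_sqrt_add_sqrt (z := (d : ℝ) ^ 2 * ε) (by positivity)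
      (show (φ s a).ofLp ⬝ᵥ Matrix.mulVec G (φ s a).ofLp ≤
        (φ s a).ofLp ⬝ᵥ Matrix.mulVec G' (φ s a).ofLp + d ^ 2 * ε by linarith)
    rwa [Real.sqrt_mul (by positivity), Real.sqrt_sq (by positivity)] at h2
  refine max_le ((le_max_left _ _).trans (le_add_of_nonneg_right hC0)) (ciSup_le fun a => ?_)
  have h3 := le_ciSup (f := fun a => min (w' ⬝ᵥ (φ s a).ofLp +
    β * √((φ s a).ofLp ⬝ᵥ Matrix.mulVec G' (φ s a).ofLp)) (H : ℝ)) (Set.finite_range _).bddAbove a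
  have h4 : min (w ⬝ᵥ (φ s a).ofLp +
      β * √((φ s a).ofLp ⬝ᵥ Matrix.mulVec G (φ s a).ofLp)) (H : ℝ) ≤ min (w' ⬝ᵥ (φ s a).ofLp +
      β * √((φ s a).ofLp ⬝ᵥ Matrix.mulVec G' (φ s a).ofLp)) (H : ℝ) + C := by
    rw [← min_add_add_right]
    refine min_le_min ?_ (le_add_of_nonneg_right hC0)
    have := mul_le_mul_of_nonneg_left (hquad a) hβ
    have := hlin a
    rw [hC]
    linarith
  calc _ ≤ _ := h4
    _ ≤ _ := add_le_add_left h3 C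
    _ ≤ _ := add_le_add_left (le_max_right _ _) C

lemma abs_estClass_le {S : Type u} {A : Type v} [Nonempty A] {d H : ℕ} {β : ℝ}
    {φ : S → A → EuclideanSpace ℝ (Fin d)} (w : Fin d → ℝ) (G : Matrix (Fin d) (Fin d) ℝ) (s : S) :
    |estClass H β φ w G s| ≤ H := by
  refine abs_le.2 ⟨le_max_left _ _, max_le ?_ (ciSup_le fun a => min_le_right _ _)⟩
  have : (0 : ℝ) ≤ H := H.cast_nonneg
  linarith

/-- Points of a one-dimensional grid of step `ε`, centred at the origin. -/
def gridPt (ε : ℝ) (N : ℕ) (j : Fin (2 * N + 1)) : ℝ := ε * ((j : ℝ) - N)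

lemma exists_gridPt {ε : ℝ} (hε : 0 < ε) {N : ℕ} {x : ℝ} (hx : |x| ≤ N * ε) :
    ∃ j, |x - gridPt ε N j| ≤ ε := by
  obtain ⟨h1, h2⟩ := abs_le.1 hx
  have hy0 : 0 ≤ x / ε + N := by
    rw [div_add' _ _ _ hε.ne']
    exact div_nonneg (by linarith) hε.le
  have hy1 : x / ε + N ≤ (2 * N : ℕ) := by
    have : x / ε ≤ N := (div_le_iff₀ hε).2 h2
    push_cast
    linarith
  refine ⟨⟨⌊x / ε + N⌋₊, Nat.lt_succ_of_le (Nat.floor_le_of_le hy1)⟩, ?_⟩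
  have h3 := Nat.floor_le hy0
  have h4 := Nat.lt_floor_add_one (x / ε + N)
  have h5 : x - gridPt ε N ⟨⌊x / ε + N⌋₊, Nat.lt_succ_of_le (Nat.floor_le_of_le hy1)⟩ =
      ε * ((x / ε + N) - ⌊x / ε + N⌋₊) := by
    rw [gridPt]
    field_simp
    ring
  rw [h5, abs_mul, abs_of_pos hε]
  have : |(x / ε + N) - ⌊x / ε + N⌋₊| ≤ 1 := abs_le.2 ⟨by linarith, by linarith⟩
  nlinarith

/-- Indices of the net: one grid point for every coordinate of the weight and every entry of the
inverse Gram matrix. -/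
abbrev NetIndex (d N : ℕ) : Type := (Fin d → Fin (2 * N + 1)) × (Fin d → Fin d → Fin (2 * N + 1))

/-- The element of the net with index `z`. -/
def netFun {S : Type u} {A : Type v} {d : ℕ} (H : ℕ) (β : ℝ)
    (φ : S → A → EuclideanSpace ℝ (Fin d)) (ε : ℝ) (N : ℕ) (z : NetIndex d N) (s : S) : ℝ :=
  estClass H β φ (fun i => gridPt ε N (z.1 i)) (fun i j => gridPt ε N (z.2 i j)) s

lemma card_netIndex (d N : ℕ) : Fintype.card (NetIndex d N) = (2 * N + 1) ^ (d + d * d) := by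
  simp [NetIndex, pow_add, pow_mul]

/-- If `N * ε` bounds the parameters, every value estimate is uniformly close to the net. -/
lemma exists_netFun {S : Type u} {A : Type v} [Finite A] [Nonempty A] {d : ℕ} {H : ℕ} {β ε : ℝ}
    (hβ : 0 ≤ β) (hε : 0 < ε) {N : ℕ} {φ : S → A → EuclideanSpace ℝ (Fin d)}
    (hφ : ∀ s a, (φ s a).ofLp ⬝ᵥ (φ s a).ofLp ≤ 1) {w : Fin d → ℝ}
    {G : Matrix (Fin d) (Fin d) ℝ} (hw : ∀ i, |w i| ≤ N * ε) (hG : ∀ i j, |G i j| ≤ N * ε) :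
    ∃ z : NetIndex d N, ∀ s, |estClass H β φ w G s - netFun H β φ ε N z s| ≤
      d * ε + β * (d * √ε) := by
  choose z1 hz1 using fun i => exists_gridPt hε (hw i)
  choose z2 hz2 using fun i j => exists_gridPt hε (hG i j)
  refine ⟨(z1, z2), fun s => ?_⟩
  have h1 := estClass_le_add (H := H) hβ hε.le hφ (w := w) (G := G)
    (w' := fun i => gridPt ε N (z1 i)) (G' := fun i j => gridPt ε N (z2 i j)) hz1 hz2 s
  have h2 := estClass_le_add (H := H) hβ hε.le hφ (w' := w) (G' := G)
    (w := fun i => gridPt ε N (z1 i)) (G := fun i j => gridPt ε N (z2 i j))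
    (fun i => by rw [abs_sub_comm]; exact hz1 i) (fun i j => by rw [abs_sub_comm]; exact hz2 i j) s
  rw [abs_le]
  constructor <;> simp only [netFun] <;> linarith

lemma measurable_estClass {S : Type u} {A : Type v} [MeasurableSpace S] [MeasurableSpace A]
    [MeasurableSingletonClass A] [Finite A] {d H K : ℕ} (𝓜 : LinearMDP S A d H K) (β : ℝ)
    (w : Fin d → ℝ) (G : Matrix (Fin d) (Fin d) ℝ) : Measurable (estClass H β 𝓜.φ w G) := by
  have hφ : ∀ (a : A) (i : Fin d), Measurable fun s => (𝓜.φ s a).ofLp i := fun a i =>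
    (measurable_pi_apply i).comp (𝓜.measurable_φ_coord measurable_id measurable_const)
  refine measurable_const.max (Measurable.iSup fun a => Measurable.min (Measurable.add ?_
    (Measurable.const_mul (Measurable.sqrt ?_) _)) measurable_const)
  · exact Finset.measurable_sum _ fun i _ => (hφ a i).const_mul _
  · simp only [dotProduct, Matrix.mulVec]
    exact Finset.measurable_sum _ fun i _ => (hφ a i).mul
      (Finset.measurable_sum _ fun j _ => (hφ a j).const_mul _)

end Net

/-! ### Estimation error, optimism and regret of an epoch -/

lemma inner_eq_dot {d : ℕ} (x y : EuclideanSpace ℝ (Fin d)) : ⟪x, y⟫ = x.ofLp ⬝ᵥ y.ofLp := by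
  rw [EuclideanSpace.inner_eq_star_dotProduct, dotProduct_comm]
  simp

lemma gramSum_mulVec {d : ℕ} (x : ℕ → Fin d → ℝ) (τ k : ℕ) (v : Fin d → ℝ) :
    Matrix.mulVec (gramSum x τ k) v = v + ∑ l ∈ Finset.Ico τ k, (x l ⬝ᵥ v) • x l := by
  rw [gramSum, Matrix.add_mulVec, Matrix.one_mulVec, Matrix.sum_mulVec]
  congr 1
  refine Finset.sum_congr rfl fun l _ => ?_
  rw [Matrix.vecMulVec_mulVec]
  ext i
  simp [mul_comm]

/-- Regression on exact linear data recovers the coefficients up to the ridge penalty. -/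
lemma invForm_sum_dot {d : ℕ} (x : ℕ → Fin d → ℝ) (τ k : ℕ) (y v : Fin d → ℝ) :
    invForm x τ k y (∑ l ∈ Finset.Ico τ k, (x l ⬝ᵥ v) • x l) = y ⬝ᵥ v - invForm x τ k y v := by
  have h : invForm x τ k y (Matrix.mulVec (gramSum x τ k) v) = y ⬝ᵥ v := by
    rw [invForm, Matrix.mulVec_mulVec, Matrix.nonsing_inv_mul _ (gramSum_isUnit_det x τ k),
      Matrix.one_mulVec]
  rw [gramSum_mulVec, invForm_add_right] at h
  linarith

lemma weight_dot {S : Type u} {A : Type v} {d : ℕ} (φ : S → A → EuclideanSpace ℝ (Fin d))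
    (st : ℕ → ℕ → S) (ac : ℕ → ℕ → A) (rwd : ℕ → ℕ → ℝ) (τ k h : ℕ) (V : S → ℝ) (y : Fin d → ℝ) :
    weight φ st ac rwd τ k h V ⬝ᵥ y = invForm (fun l => (φ (st l h) (ac l h)).ofLp) τ k y
      (∑ l ∈ Finset.Ico τ k, (rwd l h + V (st l (h + 1))) • (φ (st l h) (ac l h)).ofLp) := by
  rw [dotProduct_comm, weight, invForm]
  congr 2
  ext i
  simp [Finset.sum_apply, mul_comm]

section Pathwise

variable {S : Type u} {A : Type v} [MeasurableSpace S] [MeasurableSpace A] {d H K : ℕ} {Ω : Type w}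

lemma LinearMDP.φ_dot_self_le (𝓜 : LinearMDP S A d H K) (s : S) (a : A) :
    (𝓜.φ s a).ofLp ⬝ᵥ (𝓜.φ s a).ofLp ≤ 1 := by
  have h := 𝓜.norm_φ_le s a
  rw [EuclideanSpace.norm_eq, Real.sqrt_le_one] at h
  refine le_trans (le_of_eq ?_) h
  simp [dotProduct, sq]

/-- The features `φ(s_h^l, a_h^l)` along a run. -/
def runFeature (𝓜 : LinearMDP S A d H K) (st : ℕ → ℕ → Ω → S) (ac : ℕ → ℕ → Ω → A) (h : ℕ) (ω : Ω)
    (l : ℕ) : Fin d → ℝ := (𝓜.φ (st l h ω) (ac l h ω)).ofLp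

/-- The value estimates of a run, clipped from below at `-H`. Unlike the estimates themselves they
are bounded on the whole sample space, as the concentration inequalities require. -/
def clipV (𝓜 : LinearMDP S A d H K) (c p : ℝ) (st : ℕ → ℕ → Ω → S) (ac : ℕ → ℕ → Ω → A)
    (τ k n : ℕ) (ω : Ω) (s : S) : ℝ := max (-(H : ℝ)) (runV 𝓜 c p st ac τ k n ω s)

/-- Uniform concentration, at the sample point `ω`, of the next values of the functions in the net,
over all ranges `τ ≤ l < n` of episodes. The last step of an episode has no next value. -/
def NetConcentrated (𝓜 : LinearMDP S A d H K) (c p ε δ : ℝ) (N : ℕ) (st : ℕ → ℕ → Ω → S)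
    (ac : ℕ → ℕ → Ω → A) (ω : Ω) : Prop :=
  ∀ h, h + 1 < H → ∀ τ n, τ ≤ n → n ≤ K → ∀ z : NetIndex d N,
    invForm (runFeature 𝓜 st ac h ω) τ n
      (noiseSum (runFeature 𝓜 st ac h ω) (fun l => nextNoise 𝓜 st ac h
        (fun _ _ => netFun H (confWidth c p d H K) 𝓜.φ ε N z) l ω) τ n)
      (noiseSum (runFeature 𝓜 st ac h ω) (fun l => nextNoise 𝓜 st ac h
        (fun _ _ => netFun H (confWidth c p d H K) 𝓜.φ ε N z) l ω) τ n) ≤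
      confRadius d (n - τ) (2 * H) δ

variable {𝓜 : LinearMDP S A d H K} {c p : ℝ} {st : ℕ → ℕ → Ω → S} {ac : ℕ → ℕ → Ω → A} {ω : Ω}

lemma confRadius_mono {d n n' : ℕ} (hd : 1 ≤ d) (hn : n ≤ n') (R δ : ℝ) :
    confRadius d n R δ ≤ confRadius d n' R δ := by
  unfold confRadius
  have h1 : (1 : ℝ) ≤ d := by exact_mod_cast hd
  have h2 : (n : ℝ) ≤ n' := by exact_mod_cast hn
  have h3 : (0 : ℝ) ≤ n := n.cast_nonneg
  have : Real.log (d + n) ≤ Real.log (d + n') := Real.log_le_log (by positivity) (by linarith)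
  gcongr

lemma runFeature_dot_le (h l : ℕ) :
    runFeature 𝓜 st ac h ω l ⬝ᵥ runFeature 𝓜 st ac h ω l ≤ 1 := 𝓜.φ_dot_self_le _ _

lemma runV_le [Nonempty A] (τ k n : ℕ) (s : S) : runV 𝓜 c p st ac τ k n ω s ≤ H := by
  cases n with
  | zero => exact H.cast_nonneg
  | succ n => exact ciSup_le fun a => min_le_right _ _

lemma clipV_eq_estClass {τ k n : ℕ} : clipV 𝓜 c p st ac τ k (n + 1) ω =
    estClass H (confWidth c p d H K) 𝓜.φ
      (weight 𝓜.φ (fun l j => st l j ω) (fun l j => ac l j ω)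
        (fun l j => 𝓜.reward l j (st l j ω) (ac l j ω)) τ k (H - (n + 1))
        (runV 𝓜 c p st ac τ k n ω))
      (gramSum (runFeature 𝓜 st ac (H - (n + 1)) ω) τ k)⁻¹ := rfl

lemma abs_weight_le {τ k h : ℕ} (hτk : τ ≤ k) (hk : k < K) (hh : h < H) {V : S → ℝ}
    (hV : ∀ s, |V s| ≤ H) (i : Fin d) :
    |weight 𝓜.φ (fun l j => st l j ω) (fun l j => ac l j ω)
      (fun l j => 𝓜.reward l j (st l j ω) (ac l j ω)) τ k h V i| ≤ 2 * H * K := by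
  have hH : (1 : ℝ) ≤ H := by exact_mod_cast (Nat.one_le_of_lt hh)
  have hK : (1 : ℝ) ≤ K := by exact_mod_cast (Nat.one_le_of_lt hk)
  have h1 : ∀ w : Fin d → ℝ, w i = w ⬝ᵥ Pi.single i 1 := fun w => by simp
  rw [h1 (weight _ _ _ _ _ _ _ _), weight_dot]
  refine (abs_invForm_le _ _ _ _ _).trans ?_
  have h2 : √(invForm (runFeature 𝓜 st ac h ω) τ k (Pi.single i 1) (Pi.single i 1)) ≤ 1 :=
    Real.sqrt_le_one.2 ((invForm_self_le _ hτk _).trans (by simp))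
  have h3 := sqrt_invForm_sum_le (runFeature 𝓜 st ac h ω) hτk
    (fun l => 𝓜.reward l h (st l h ω) (ac l h ω) + V (st l (h + 1) ω)) (B := 2 * H)
    (by positivity) fun l hl => by
      have hl' : l < K := ((Finset.mem_Ico.1 hl).2.trans hk)
      have h4 := 𝓜.reward_nonneg l hl' h hh (st l h ω) (ac l h ω)
      have h5 := 𝓜.reward_le_one l hl' h hh (st l h ω) (ac l h ω)
      have h6 := abs_le.1 (hV (st l (h + 1) ω))
      rw [LinearMDP.reward]
      exact abs_le.2 ⟨by linarith, by linarith⟩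
  have h7 : √((k - τ : ℕ) : ℝ) ≤ K := by
    refine Real.sqrt_le_iff.2 ⟨by positivity, ?_⟩
    have : ((k - τ : ℕ) : ℝ) ≤ K := by exact_mod_cast (Nat.sub_le _ _).trans hk.le
    nlinarith
  calc _ ≤ 1 * (2 * H * √((k - τ : ℕ) : ℝ)) :=
        mul_le_mul h2 h3 (Real.sqrt_nonneg _) zero_le_one
    _ ≤ _ := by rw [one_mul]; gcongr

lemma abs_gramSum_inv_le {d : ℕ} (x : ℕ → Fin d → ℝ) {τ k : ℕ} (hτk : τ ≤ k) (i j : Fin d) :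
    |(gramSum x τ k)⁻¹ i j| ≤ 1 := by
  have h : (gramSum x τ k)⁻¹ i j = invForm x τ k (Pi.single i 1) (Pi.single j 1) := by
    simp [invForm]
  have h2 : ∀ i : Fin d, √(invForm x τ k (Pi.single i 1) (Pi.single i 1)) ≤ 1 := fun i =>
    Real.sqrt_le_one.2 ((invForm_self_le _ hτk _).trans (by simp))
  rw [h]
  refine (abs_invForm_le _ _ _ _ _).trans ?_
  have := mul_le_mul (h2 i) (h2 j) (Real.sqrt_nonneg _) zero_le_one
  simpa using this

/-- The regression noise of the value estimates is controlled through the net. The estimate with `n`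
steps to go is assumed to be bounded, which puts the weight of the next one into the range of the
net. -/
lemma sqrt_invForm_noise_le [MeasurableSingletonClass A] [Finite A] [Nonempty A] {ε δ : ℝ} {N : ℕ}
    (hd : 1 ≤ d) (hβ : 0 ≤ confWidth c p d H K) (hε : 0 < ε) (hNε : 2 * H * K ≤ N * ε)
    (hεK : d * ε + confWidth c p d H K * (d * √ε) ≤ 1 / K)
    (hnet : NetConcentrated 𝓜 c p ε δ N st ac ω) {τ k h n : ℕ} (hτk : τ ≤ k) (hk : k < K)
    (hh : h + 1 < H) (hn : n + 1 ≤ H) (hV : ∀ s, |runV 𝓜 c p st ac τ k n ω s| ≤ H) :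
    √(invForm (runFeature 𝓜 st ac h ω) τ k
      (noiseSum (runFeature 𝓜 st ac h ω) (fun l => nextNoise 𝓜 st ac h
        (fun _ => clipV 𝓜 c p st ac τ k (n + 1)) l ω) τ k)
      (noiseSum (runFeature 𝓜 st ac h ω) (fun l => nextNoise 𝓜 st ac h
        (fun _ => clipV 𝓜 c p st ac τ k (n + 1)) l ω) τ k)) ≤
      √(confRadius d K (2 * H) δ) + 2 := by
  have hH : (1 : ℝ) ≤ H := by exact_mod_cast (show 1 ≤ H by omega)
  have hK : (1 : ℝ) ≤ K := by exact_mod_cast (Nat.one_le_of_lt hk)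
  have hK0 : (0 : ℝ) < K := by linarith
  set x := runFeature 𝓜 st ac h ω with hx
  -- an element `F` of the net within `1 / K` of the estimate
  obtain ⟨z, hz⟩ := exists_netFun (H := H) hβ hε (N := N) (φ := 𝓜.φ) 𝓜.φ_dot_self_le
    (w := weight 𝓜.φ (fun l j => st l j ω) (fun l j => ac l j ω)
        (fun l j => 𝓜.reward l j (st l j ω) (ac l j ω)) τ k (H - (n + 1))
        (runV 𝓜 c p st ac τ k n ω))
    (G := (gramSum (runFeature 𝓜 st ac (H - (n + 1)) ω) τ k)⁻¹)
    (fun i => (abs_weight_le hτk hk (by omega) hV i).trans hNε)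
    (fun i j => (abs_gramSum_inv_le _ hτk i j).trans (by nlinarith))
  rw [← clipV_eq_estClass] at hz
  set F := netFun H (confWidth c p d H K) 𝓜.φ ε N z with hF
  set V := clipV 𝓜 c p st ac τ k (n + 1) ω with hVdef
  have hzK : ∀ s, |V s - F s| ≤ 1 / K := fun s => (hz s).trans hεK
  have hFm : Measurable F := measurable_estClass 𝓜 _ _ _
  have hVm : Measurable V := by
    rw [hVdef, clipV_eq_estClass]
    exact measurable_estClass 𝓜 _ _ _
  have hFb : ∀ s, |F s| ≤ H := fun s => abs_estClass_le _ _ s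
  have hVb : ∀ s, |V s| ≤ H := fun s => by
    rw [hVdef, clipV_eq_estClass]
    exact abs_estClass_le _ _ s
  have hsplit : noiseSum x (fun l => nextNoise 𝓜 st ac h (fun _ =>
      clipV 𝓜 c p st ac τ k (n + 1)) l ω) τ k =
      noiseSum x (fun l => nextNoise 𝓜 st ac h (fun _ _ => F) l ω) τ k +
      ∑ l ∈ Finset.Ico τ k, (nextNoise 𝓜 st ac h (fun _ => clipV 𝓜 c p st ac τ k (n + 1)) l ω -
        nextNoise 𝓜 st ac h (fun _ _ => F) l ω) • x l := by
    rw [noiseSum, noiseSum, ← Finset.sum_add_distrib]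
    refine Finset.sum_congr rfl fun l _ => ?_
    rw [← add_smul]
    congr 1
    ring
  rw [hsplit]
  refine (sqrt_invForm_add_le _ _ _ _ _).trans (add_le_add ?_ ?_)
  · refine Real.sqrt_le_sqrt ((hnet h hh τ k hτk hk.le z).trans ?_)
    exact confRadius_mono hd ((Nat.sub_le _ _).trans hk.le) _ _
  · refine (sqrt_invForm_sum_le x hτk _ (B := 2 / K) (by positivity) fun l hl => ?_).trans ?_
    · have hl' : l < K := ((Finset.mem_Ico.1 hl).2.trans hk)
      have h1 := LinearMDP.expect_mono (𝓜 := 𝓜) hl' (by omega : h < H) hVm hFm hVb hFb (C := 1 / K)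
        (fun s => by linarith [(abs_le.1 (hzK s)).2]) (st l h ω) (ac l h ω)
      have h2 := LinearMDP.expect_mono (𝓜 := 𝓜) hl' (by omega : h < H) hFm hVm hFb hVb (C := 1 / K)
        (fun s => by linarith [(abs_le.1 (hzK s)).1]) (st l h ω) (ac l h ω)
      have h3 := abs_le.1 (hzK (st l (h + 1) ω))
      have h4 : (2 : ℝ) / K = 1 / K + 1 / K := by ring
      simp only [nextNoise]
      rw [← hVdef]
      exact abs_le.2 ⟨by linarith [h3.1], by linarith [h3.2]⟩
    -- at most `K` terms, each within `2 / K`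
    · have h7 : √((k - τ : ℕ) : ℝ) ≤ K := by
        refine Real.sqrt_le_iff.2 ⟨by positivity, ?_⟩
        have : ((k - τ : ℕ) : ℝ) ≤ K := by exact_mod_cast (Nat.sub_le _ _).trans hk.le
        nlinarith
      calc 2 / (K : ℝ) * √((k - τ : ℕ) : ℝ) ≤ 2 / K * K := by gcongr
        _ = 2 := by field_simp

end Pathwise

section Epoch

variable {S : Type u} {A : Type v} [MeasurableSpace S] [MeasurableSpace A] {d H K : ℕ} {Ω : Type w}

/-- The requirements on the step `ε` and the half-width `N` of the net, on the confidence level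
`1 - δ` of its elements and on the width of the confidence bonus. -/
structure ConfParams (c p ε δ : ℝ) (N d H K : ℕ) : Prop where
  one_le_d : 1 ≤ d
  step_pos : 0 < ε
  /-- The net covers all weights that can occur. -/
  range_le : 2 * H * K ≤ N * ε
  /-- The net approximates the value estimates up to `1 / K`. -/
  error_le : d * ε + confWidth c p d H K * (d * √ε) ≤ 1 / K
  /-- The bonus covers the ridge penalty and the noise. -/
  radius_le : 4 * H * d + (√(confRadius d K (2 * H) δ) + 2) ≤ confWidth c p d H K

lemma ConfParams.width_nonneg {c p ε δ : ℝ} {N d H K : ℕ} (h : ConfParams c p ε δ N d H K) :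
    0 ≤ confWidth c p d H K := le_trans (by positivity) h.radius_le

variable {𝓜 : LinearMDP S A d H K} {c p ε δ : ℝ} {N : ℕ} {st : ℕ → ℕ → Ω → S}
  {ac : ℕ → ℕ → Ω → A} {ω : Ω}

lemma clipV_eq_runV {τ k n : ℕ} (hV : ∀ s, |runV 𝓜 c p st ac τ k n ω s| ≤ H) :
    clipV 𝓜 c p st ac τ k n ω = runV 𝓜 c p st ac τ k n ω :=
  funext fun s => max_eq_right (abs_le.1 (hV s)).1

/-- The accumulated bias at step `h` of an epoch that ranges over the episodes `τ ≤ j < τ'`, if the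
window has `W` episodes. -/
def epochBias (𝓜 : LinearMDP S A d H K) (W τ τ' h : ℕ) : ℝ :=
  √(W : ℝ) * ∑ j ∈ Finset.Ico τ τ', 𝓜.drift j h

lemma epochBias_nonneg (W τ τ' h : ℕ) : 0 ≤ epochBias 𝓜 W τ τ' h :=
  mul_nonneg (Real.sqrt_nonneg _) (Finset.sum_nonneg fun j _ => LinearMDP.drift_nonneg j h)

lemma bias_le_epochBias {W τ τ' k : ℕ} (hkτ' : k < τ') (hW : τ' - τ ≤ W)
    (h : ℕ) : √((k - τ : ℕ) : ℝ) * ∑ j ∈ Finset.Ico τ k, 𝓜.drift j h ≤ epochBias 𝓜 W τ τ' h := by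
  refine mul_le_mul (Real.sqrt_le_sqrt ?_) ?_
    (Finset.sum_nonneg fun j _ => LinearMDP.drift_nonneg j h) (Real.sqrt_nonneg _)
  · exact_mod_cast (by omega : k - τ ≤ W)
  · exact Finset.sum_le_sum_of_subset_of_nonneg (Finset.Ico_subset_Ico_right hkτ'.le)
      fun j _ _ => LinearMDP.drift_nonneg j h

lemma sum_epochBias_le {W τ τ' n : ℕ} :
    ∑ h ∈ Finset.Ico (H - n) H, epochBias 𝓜 W τ τ' h ≤
      ∑ h ∈ Finset.range H, epochBias 𝓜 W τ τ' h := by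
  rw [Finset.range_eq_Ico]
  exact Finset.sum_le_sum_of_subset_of_nonneg (Finset.Ico_subset_Ico_left (Nat.zero_le _))
    fun h _ _ => epochBias_nonneg W τ τ' h

lemma sumRadius_mono {n n' : ℕ} (hn : n ≤ n') {R δ : ℝ} (hδ : 0 < δ) (hδ1 : δ ≤ 1) :
    sumRadius n R δ ≤ sumRadius n' R δ := by
  have h1 : (n : ℝ) ≤ n' := by exact_mod_cast hn
  have h2 : 0 ≤ confRadius 1 n' R δ := by
    have : 0 ≤ Real.log (1 / δ) := Real.log_nonneg (by rw [le_div_iff₀ hδ]; linarith)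
    have : 0 ≤ Real.log ((1 : ℕ) + n' : ℝ) :=
      Real.log_nonneg (by push_cast; linarith [n'.cast_nonneg (α := ℝ)])
    unfold confRadius
    positivity
  unfold sumRadius
  refine Real.sqrt_le_sqrt ?_
  calc (1 + (n : ℝ)) * confRadius 1 n R δ ≤ (1 + (n : ℝ)) * confRadius 1 n' R δ :=
        mul_le_mul_of_nonneg_left (confRadius_mono le_rfl hn R δ) (by positivity)
    _ ≤ _ := mul_le_mul_of_nonneg_right (by linarith) h2

variable [MeasurableSingletonClass A] [Finite A]

lemma measurable_runV_of_bounded {τ k n : ℕ} (hV : ∀ s, |runV 𝓜 c p st ac τ k n ω s| ≤ H) :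
    Measurable (runV 𝓜 c p st ac τ k n ω) := by
  cases n with
  | zero => exact measurable_const
  | succ n =>
    rw [← clipV_eq_runV hV, clipV_eq_estClass]
    exact measurable_estClass 𝓜 _ _ _

variable [Nonempty A]

/-- The error of the least-squares estimate: it is at most the confidence bonus plus the drift
within the epoch, amplified by the square root of the length of the epoch. -/
lemma abs_weight_sub_le (hP : ConfParams c p ε δ N d H K)
    (hnet : NetConcentrated 𝓜 c p ε δ N st ac ω) {τ k n : ℕ} (hτk : τ ≤ k) (hk : k < K)
    (hn : n + 1 ≤ H) (hV : ∀ m ≤ n, ∀ s, |runV 𝓜 c p st ac τ k m ω s| ≤ H) (s : S) (a : A) :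
    |weight 𝓜.φ (fun l j => st l j ω) (fun l j => ac l j ω)
        (fun l j => 𝓜.reward l j (st l j ω) (ac l j ω)) τ k (H - (n + 1))
        (runV 𝓜 c p st ac τ k n ω) ⬝ᵥ (𝓜.φ s a).ofLp -
      (𝓜.reward k (H - (n + 1)) s a +
        𝓜.expect k (H - (n + 1)) (runV 𝓜 c p st ac τ k n ω) s a)| ≤
      confWidth c p d H K * √(invForm (runFeature 𝓜 st ac (H - (n + 1)) ω) τ k
        (𝓜.φ s a).ofLp (𝓜.φ s a).ofLp) +
      √((k - τ : ℕ) : ℝ) * ∑ j ∈ Finset.Ico τ k, 𝓜.drift j (H - (n + 1)) := by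
  set h := H - (n + 1) with hh
  have hhH : h < H := by omega
  have hH : (1 : ℝ) ≤ H := by exact_mod_cast (show 1 ≤ H by omega)
  set V := runV 𝓜 c p st ac τ k n ω with hVdef
  set x := runFeature 𝓜 st ac h ω with hx
  set y := (𝓜.φ s a).ofLp with hy
  have hVn := hV n le_rfl
  have hVm : Measurable V := measurable_runV_of_bounded hVn
  obtain ⟨ν, hν, hνe⟩ := LinearMDP.exists_expect_eq_inner (𝓜 := 𝓜) hk hhH hVm (by linarith) hVn
  -- the coefficients of the linear function that is to be estimated
  set v : EuclideanSpace ℝ (Fin d) := 𝓜.θ k h + ν with hv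
  have hlin : ∀ s a, 𝓜.reward k h s a + 𝓜.expect k h V s a = (𝓜.φ s a).ofLp ⬝ᵥ v.ofLp := by
    intro s a
    rw [hνe, LinearMDP.reward, ← inner_add_right, ← hv, inner_eq_dot]
  -- the noise of the regression
  set e : ℕ → ℝ := fun l => nextNoise 𝓜 st ac h (fun _ => runV 𝓜 c p st ac τ k n) l ω with he
  have hnoise : √(invForm x τ k (∑ l ∈ Finset.Ico τ k, e l • x l)
      (∑ l ∈ Finset.Ico τ k, e l • x l)) ≤ √(confRadius d K (2 * H) δ) + 2 := by
    -- in the last step of an episode there is no noise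
    rcases n with _ | n
    · have : ∀ l, e l = 0 := fun l => by
        simp [he, nextNoise, runV, lsviV, LinearMDP.expect]
      simp only [this, zero_smul, Finset.sum_const_zero, invForm_zero_right, Real.sqrt_zero]
      positivity
    · have h1 := sqrt_invForm_noise_le hP.one_le_d hP.width_nonneg hP.step_pos hP.range_le
        hP.error_le hnet hτk hk (show h + 1 < H by omega) (by omega) (hV n (by omega))
      have h2 : ∀ l, e l = nextNoise 𝓜 st ac h (fun _ => clipV 𝓜 c p st ac τ k (n + 1)) l ω :=
        fun l => by
          simp only [he, nextNoise]
          rw [clipV_eq_runV hVn]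
      simp only [noiseSum] at h1
      simpa only [h2] using h1
  -- the bias: the data of episode `l` were generated with the parameters of that episode
  set b : ℕ → ℝ := fun l => 𝓜.reward l h (st l h ω) (ac l h ω) +
    𝓜.expect l h V (st l h ω) (ac l h ω) - (𝓜.reward k h (st l h ω) (ac l h ω) +
    𝓜.expect k h V (st l h ω) (ac l h ω)) with hb
  have hbias : √(invForm x τ k (∑ l ∈ Finset.Ico τ k, b l • x l)
      (∑ l ∈ Finset.Ico τ k, b l • x l)) ≤
      (∑ j ∈ Finset.Ico τ k, 𝓜.drift j h) * √((k - τ : ℕ) : ℝ) := by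
    refine sqrt_invForm_sum_le x hτk b
      (Finset.sum_nonneg fun j _ => LinearMDP.drift_nonneg j h) fun l hl => ?_
    obtain ⟨hl1, hl2⟩ := Finset.mem_Ico.1 hl
    refine (LinearMDP.abs_reward_add_expect_sub_le hl2.le hk hhH hVm hVn _ _).trans ?_
    exact Finset.sum_le_sum_of_subset_of_nonneg (Finset.Ico_subset_Ico_left hl1)
      fun j _ _ => LinearMDP.drift_nonneg j h
  have hsum : ∑ l ∈ Finset.Ico τ k, (𝓜.reward l h (st l h ω) (ac l h ω) + V (st l (h + 1) ω)) •
      (𝓜.φ (st l h ω) (ac l h ω)).ofLp = ∑ l ∈ Finset.Ico τ k, (x l ⬝ᵥ v.ofLp) • x l +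
      ∑ l ∈ Finset.Ico τ k, b l • x l + ∑ l ∈ Finset.Ico τ k, e l • x l := by
    rw [← Finset.sum_add_distrib, ← Finset.sum_add_distrib]
    refine Finset.sum_congr rfl fun l _ => ?_
    rw [← add_smul, ← add_smul]
    change _ = (_ : ℝ) • (𝓜.φ (st l h ω) (ac l h ω)).ofLp
    congr 1
    have h1 := hlin (st l h ω) (ac l h ω)
    change _ = (𝓜.φ (st l h ω) (ac l h ω)).ofLp ⬝ᵥ v.ofLp + b l + e l
    rw [← h1]
    simp only [hb, he, nextNoise, ← hVdef]
    ring
  -- the ridge penalty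
  have hvnorm : √(invForm x τ k v.ofLp v.ofLp) ≤ 4 * H * d := by
    have h1 : √(invForm x τ k v.ofLp v.ofLp) ≤ ‖v‖ := by
      rw [norm_eq_sqrt_real_inner, inner_eq_dot]
      exact Real.sqrt_le_sqrt (invForm_self_le x hτk _)
    have h2 : ‖v‖ ≤ √(d : ℝ) + 3 * H * √(d : ℝ) :=
      (norm_add_le _ _).trans (add_le_add (𝓜.norm_θ_le k hk h hhH) hν)
    have hd1 : (1 : ℝ) ≤ d := by exact_mod_cast hP.one_le_d
    have h3 : √(d : ℝ) ≤ d := Real.sqrt_le_iff.2 ⟨by positivity, by nlinarith⟩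
    have h4 := Real.sqrt_nonneg (d : ℝ)
    nlinarith
  rw [weight_dot, hlin s a]
  change |invForm x τ k y _ - y ⬝ᵥ v.ofLp| ≤ _
  rw [hsum, invForm_add_right, invForm_add_right, invForm_sum_dot]
  have hy1 : √(invForm x τ k y y) ≤ 1 :=
    Real.sqrt_le_one.2 ((invForm_self_le x hτk y).trans (𝓜.φ_dot_self_le s a))
  have hy0 := Real.sqrt_nonneg (invForm x τ k y y)
  have t1 := (abs_invForm_le x τ k y v.ofLp).trans (mul_le_mul_of_nonneg_left hvnorm hy0)
  have t2 := (abs_invForm_le x τ k y (∑ l ∈ Finset.Ico τ k, b l • x l)).trans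
    (mul_le_mul hy1 hbias (Real.sqrt_nonneg _) zero_le_one)
  have t3 := (abs_invForm_le x τ k y (∑ l ∈ Finset.Ico τ k, e l • x l)).trans
    (mul_le_mul_of_nonneg_left hnoise hy0)
  have t4 := mul_le_mul_of_nonneg_left hP.radius_le hy0
  rw [abs_le] at t1 t2 t3 ⊢
  constructor <;> linarith [t1.1, t1.2, t2.1, t2.2, t3.1, t3.2]

/-- Optimism up to the accumulated bias. Together with the nonnegativity of the optimal values it
shows that the estimates of an epoch with little drift need no clipping from below. -/
lemma optimism (hP : ConfParams c p ε δ N d H K)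
    (hnet : NetConcentrated 𝓜 c p ε δ N st ac ω) {W τ τ' k : ℕ} (hτk : τ ≤ k) (hkτ' : k < τ')
    (hτ' : τ' ≤ K) (hW : τ' - τ ≤ W)
    (hbias : ∑ h ∈ Finset.range H, epochBias 𝓜 W τ τ' h ≤ H) {n : ℕ} (hn : n ≤ H) :
    ∀ m ≤ n, ∀ s, 𝓜.optToGo k m s - ∑ h ∈ Finset.Ico (H - m) H, epochBias 𝓜 W τ τ' h ≤
      runV 𝓜 c p st ac τ k m ω s ∧ |runV 𝓜 c p st ac τ k m ω s| ≤ H := by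
  have hk : k < K := hkτ'.trans_le hτ'
  have hH0 : (0 : ℝ) ≤ H := H.cast_nonneg
  have hbd : ∀ m ≤ H, ∀ s, 𝓜.optToGo k m s - ∑ h ∈ Finset.Ico (H - m) H, epochBias 𝓜 W τ τ' h ≤
      runV 𝓜 c p st ac τ k m ω s → |runV 𝓜 c p st ac τ k m ω s| ≤ H := fun m hm s h => by
    have h1 := (LinearMDP.optToGo_mem (𝓜 := 𝓜) hk hm s).1
    have h2 := sum_epochBias_le (𝓜 := 𝓜) (W := W) (τ := τ) (τ' := τ') (n := m)
    exact abs_le.2 ⟨by linarith, runV_le τ k m s⟩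
  induction n with
  | zero =>
    intro m hm s
    obtain rfl : m = 0 := by omega
    have h0 : 𝓜.optToGo k 0 s - ∑ h ∈ Finset.Ico (H - 0) H, epochBias 𝓜 W τ τ' h ≤
        runV 𝓜 c p st ac τ k 0 ω s := by
      simp [LinearMDP.optToGo, runV, lsviV]
    exact ⟨h0, hbd 0 hn s h0⟩
  | succ n ih =>
    have ih := ih (by omega)
    intro m hm s
    rcases Nat.lt_or_ge m (n + 1) with hlt | hge
    · exact ih m (by omega) s
    obtain rfl : m = n + 1 := by omega
    have hVb : ∀ m ≤ n, ∀ s, |runV 𝓜 c p st ac τ k m ω s| ≤ H := fun m hm s => (ih m hm s).2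
    have hhH : H - (n + 1) < H := by omega
    have hIco : ∑ h ∈ Finset.Ico (H - (n + 1)) H, epochBias 𝓜 W τ τ' h =
        epochBias 𝓜 W τ τ' (H - (n + 1)) + ∑ h ∈ Finset.Ico (H - n) H, epochBias 𝓜 W τ τ' h := by
      rw [Finset.sum_eq_sum_Ico_succ_bot hhH, show H - (n + 1) + 1 = H - n by omega]
    have hkey : 𝓜.optToGo k (n + 1) s - ∑ h ∈ Finset.Ico (H - (n + 1)) H, epochBias 𝓜 W τ τ' h ≤
        runV 𝓜 c p st ac τ k (n + 1) ω s := by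
      rw [sub_le_iff_le_add]
      refine ciSup_le fun a => ?_
      have hup := le_ciSup (f := fun a => ucbQ H (confWidth c p d H K) 𝓜.φ (fun l j => st l j ω)
        (fun l j => ac l j ω) (fun l j => 𝓜.reward l j (st l j ω) (ac l j ω)) τ k (H - (n + 1))
        (runV 𝓜 c p st ac τ k n ω) s a) (Set.finite_range _).bddAbove a
      refine le_trans ?_ (add_le_add_left hup _)
      have hle : 𝓜.reward k (H - (n + 1)) s a +
          𝓜.expect k (H - (n + 1)) (𝓜.optToGo k n) s a ≤ 𝓜.optToGo k (n + 1) s :=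
        le_ciSup (f := fun a => 𝓜.reward k (H - (n + 1)) s a +
          𝓜.expect k (H - (n + 1)) (𝓜.optToGo k n) s a) (Set.finite_range _).bddAbove a
      have hopt := (LinearMDP.optToGo_mem (𝓜 := 𝓜) hk hn s).2
      have hnH : ((n + 1 : ℕ) : ℝ) ≤ H := by exact_mod_cast hn
      have herr := (abs_le.1 (abs_weight_sub_le hP hnet hτk hk hn hVb s a)).1
      have hb := bias_le_epochBias (𝓜 := 𝓜) (τ := τ) hkτ' hW (H - (n + 1))
      have hmono := LinearMDP.expect_mono (𝓜 := 𝓜) hk hhH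
        (LinearMDP.measurable_optToGo hk (by omega : n ≤ H))
        (measurable_runV_of_bounded (hVb n le_rfl)) (B := H) (B' := H)
        (C := ∑ h ∈ Finset.Ico (H - n) H, epochBias 𝓜 W τ τ' h)
        (fun s => by
          have := LinearMDP.optToGo_mem (𝓜 := 𝓜) hk (by omega : n ≤ H) s
          have hn' : (n : ℝ) ≤ H := by exact_mod_cast (by omega : n ≤ H)
          exact abs_le.2 ⟨by linarith, by linarith⟩) (hVb n le_rfl)
        (fun s => by linarith [(ih n le_rfl s).1]) s a
      have hnonneg : 0 ≤ ∑ h ∈ Finset.Ico (H - (n + 1)) H, epochBias 𝓜 W τ τ' h :=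
        Finset.sum_nonneg fun h _ => epochBias_nonneg W τ τ' h
      rw [ucbQ, ← min_add_add_right]
      refine le_min ?_ (by linarith)
      rw [hIco]
      change _ ≤ weight _ _ _ _ _ _ _ _ ⬝ᵥ _ + confWidth c p d H K *
        √(invForm (runFeature 𝓜 st ac (H - (n + 1)) ω) τ k (𝓜.φ s a).ofLp (𝓜.φ s a).ofLp) + _
      linarith
    exact ⟨hkey, hbd (n + 1) hn s hkey⟩

/-- The noise of step `h` of episode `k` in the regret decomposition; the last step has none. -/
def stepNoise (𝓜 : LinearMDP S A d H K) (c p : ℝ) (st : ℕ → ℕ → Ω → S) (ac : ℕ → ℕ → Ω → A)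
    (τ k h : ℕ) (ω : Ω) : ℝ :=
  if h + 1 < H then
    nextNoise 𝓜 st ac h (fun l => clipV 𝓜 c p st ac τ l (H - (h + 1))) k ω
  else 0

/-- Regret decomposition of one episode: the estimated value exceeds the realized rewards by at most
the bonuses, the biases and the noise. -/
lemma runV_le_sum (hP : ConfParams c p ε δ N d H K)
    (hnet : NetConcentrated 𝓜 c p ε δ N st ac ω) {W τ τ' k : ℕ} (hτk : τ ≤ k) (hkτ' : k < τ')
    (hτ' : τ' ≤ K) (hW : τ' - τ ≤ W)
    (hVb : ∀ m ≤ H, ∀ s, |runV 𝓜 c p st ac τ k m ω s| ≤ H)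
    (hgreedy : ∀ h < H, ∀ a, lsviQ H (confWidth c p d H K) 𝓜.φ (fun l j => st l j ω)
      (fun l j => ac l j ω) (fun l j => 𝓜.reward l j (st l j ω) (ac l j ω)) τ k h (st k h ω) a ≤
      lsviQ H (confWidth c p d H K) 𝓜.φ (fun l j => st l j ω)
      (fun l j => ac l j ω) (fun l j => 𝓜.reward l j (st l j ω) (ac l j ω)) τ k h (st k h ω)
        (ac k h ω)) {n : ℕ} (hn : n < H) :
    runV 𝓜 c p st ac τ k (n + 1) ω (st k (H - (n + 1)) ω) ≤
      ∑ h ∈ Finset.Ico (H - (n + 1)) H, (𝓜.reward k h (st k h ω) (ac k h ω) +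
        2 * confWidth c p d H K * √(invForm (runFeature 𝓜 st ac h ω) τ k
          (runFeature 𝓜 st ac h ω k) (runFeature 𝓜 st ac h ω k)) +
        epochBias 𝓜 W τ τ' h - stepNoise 𝓜 c p st ac τ k h ω) := by
  have hk : k < K := hkτ'.trans_le hτ'
  -- in one step the greedy estimate is at most the reward and the expected next estimate, up to
  -- twice the bonus (once from the definition, once from the estimation error) and the bias
  have hstep : ∀ n < H, runV 𝓜 c p st ac τ k (n + 1) ω (st k (H - (n + 1)) ω) ≤
      𝓜.reward k (H - (n + 1)) (st k (H - (n + 1)) ω) (ac k (H - (n + 1)) ω) +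
      𝓜.expect k (H - (n + 1)) (runV 𝓜 c p st ac τ k n ω) (st k (H - (n + 1)) ω)
        (ac k (H - (n + 1)) ω) +
      2 * confWidth c p d H K * √(invForm (runFeature 𝓜 st ac (H - (n + 1)) ω) τ k
          (runFeature 𝓜 st ac (H - (n + 1)) ω k) (runFeature 𝓜 st ac (H - (n + 1)) ω k)) +
        epochBias 𝓜 W τ τ' (H - (n + 1)) := by
    intro n hn
    set h := H - (n + 1) with hh
    have hn' : H - (h + 1) = n := by omega
    have herr := (abs_le.1 (abs_weight_sub_le hP hnet hτk hk (Nat.succ_le_of_lt hn)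
      (fun m hm s => hVb m (by omega) s) (st k h ω) (ac k h ω))).2
    have hb := bias_le_epochBias (𝓜 := 𝓜) (τ := τ) hkτ' hW h
    refine (ciSup_le fun a => ?_ :
      runV 𝓜 c p st ac τ k (n + 1) ω (st k h ω) ≤ lsviQ H (confWidth c p d H K) 𝓜.φ
      (fun l j => st l j ω) (fun l j => ac l j ω) (fun l j => 𝓜.reward l j (st l j ω) (ac l j ω))
      τ k h (st k h ω) (ac k h ω)).trans ?_
    · have := hgreedy h (by omega) a
      rw [lsviQ, lsviQ, hn'] at this
      rw [lsviQ, hn']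
      exact this
    · rw [lsviQ, hn']
      refine (min_le_left _ _).trans ?_
      change weight 𝓜.φ (fun l j => st l j ω) (fun l j => ac l j ω)
        (fun l j => 𝓜.reward l j (st l j ω) (ac l j ω)) τ k h
        (runV 𝓜 c p st ac τ k n ω) ⬝ᵥ (𝓜.φ (st k h ω) (ac k h ω)).ofLp + confWidth c p d H K *
        √(invForm (runFeature 𝓜 st ac h ω) τ k (runFeature 𝓜 st ac h ω k)
          (runFeature 𝓜 st ac h ω k)) ≤ _
      change _ ≤ confWidth c p d H K * √(invForm (runFeature 𝓜 st ac h ω) τ k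
          (runFeature 𝓜 st ac h ω k) (runFeature 𝓜 st ac h ω k)) + _ at herr
      linarith
  induction n with
  | zero =>
    have h1 := hstep 0 hn
    have hIco : Finset.Ico (H - (0 + 1)) H = {H - (0 + 1)} := by
      ext j
      simp only [Finset.mem_Ico, Finset.mem_singleton]
      omega
    have h0 : 𝓜.expect k (H - (0 + 1)) (runV 𝓜 c p st ac τ k 0 ω) (st k (H - (0 + 1)) ω)
        (ac k (H - (0 + 1)) ω) = 0 := by
      simp [LinearMDP.expect, runV, lsviV]
    rw [hIco, Finset.sum_singleton, stepNoise, if_neg (by omega)]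
    rw [h0] at h1
    linarith
  | succ n ih =>
    have ih := ih (by omega)
    have h1 := hstep (n + 1) hn
    have hs : H - (n + 1 + 1) + 1 = H - (n + 1) := by omega
    rw [Finset.sum_eq_sum_Ico_succ_bot (by omega : H - (n + 1 + 1) < H), hs]
    have hnoise : stepNoise 𝓜 c p st ac τ k (H - (n + 1 + 1)) ω =
        runV 𝓜 c p st ac τ k (n + 1) ω (st k (H - (n + 1)) ω) -
        𝓜.expect k (H - (n + 1 + 1)) (runV 𝓜 c p st ac τ k (n + 1) ω)
          (st k (H - (n + 1 + 1)) ω) (ac k (H - (n + 1 + 1)) ω) := by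
      rw [stepNoise, if_pos (by omega), nextNoise, hs, show H - (H - (n + 1)) = n + 1 by omega,
        clipV_eq_runV (hVb (n + 1) (by omega))]
    rw [hnoise]
    linarith

/-- Statistical part of the regret of an epoch with a window of `W` episodes. -/
def epochStat (c p δ : ℝ) (W d H K : ℕ) : ℝ :=
  H * (2 * confWidth c p d H K * √(W * (2 * (d * Real.log (d + W)))) + sumRadius W (2 * H) δ)

/-- Concentration, at the sample point `ω`, of the noise in the regret decomposition, over all
ranges `τ ≤ l < n` of episodes, for an epoch that begins with episode `τ`. -/
def NoiseConcentrated (𝓜 : LinearMDP S A d H K) (c p δ : ℝ) (st : ℕ → ℕ → Ω → S)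
    (ac : ℕ → ℕ → Ω → A) (ω : Ω) : Prop :=
  ∀ h, h + 1 < H → ∀ τ n, τ ≤ n → n ≤ K →
    |∑ l ∈ Finset.Ico τ n, nextNoise 𝓜 st ac h
      (fun l => clipV 𝓜 c p st ac τ l (H - (h + 1))) l ω| ≤ sumRadius (n - τ) (2 * H) δ

/-- Regret of one epoch, against the realized rewards, if the actions are greedy throughout. -/
theorem epoch_regret_le (hP : ConfParams c p ε δ N d H K) (hδ : 0 < δ) (hδ1 : δ ≤ 1)
    (hnet : NetConcentrated 𝓜 c p ε δ N st ac ω) (hnoise : NoiseConcentrated 𝓜 c p δ st ac ω)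
    {W τ τ' : ℕ} (hττ' : τ ≤ τ') (hτ' : τ' ≤ K) (hW : τ' - τ ≤ W)
    (hgreedy : ∀ k ∈ Finset.Ico τ τ', ∀ h < H, ∀ a, lsviQ H (confWidth c p d H K) 𝓜.φ
      (fun l j => st l j ω) (fun l j => ac l j ω)
      (fun l j => 𝓜.reward l j (st l j ω) (ac l j ω)) τ k h (st k h ω) a ≤
      lsviQ H (confWidth c p d H K) 𝓜.φ (fun l j => st l j ω)
      (fun l j => ac l j ω) (fun l j => 𝓜.reward l j (st l j ω) (ac l j ω)) τ k h (st k h ω)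
        (ac k h ω)) :
    ∑ k ∈ Finset.Ico τ τ', (𝓜.optToGo k H (st k 0 ω) -
      ∑ h ∈ Finset.range H, 𝓜.reward k h (st k h ω) (ac k h ω)) ≤
      2 * W * ∑ h ∈ Finset.range H, epochBias 𝓜 W τ τ' h + epochStat c p δ W d H K := by
  have hβ := hP.width_nonneg
  have hD0 : 0 ≤ ∑ h ∈ Finset.range H, epochBias 𝓜 W τ τ' h :=
    Finset.sum_nonneg fun h _ => epochBias_nonneg W τ τ' h
  set D := ∑ h ∈ Finset.range H, epochBias 𝓜 W τ τ' h with hD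
  have hWn : ((τ' - τ : ℕ) : ℝ) ≤ W := by exact_mod_cast hW
  have hstat : 0 ≤ epochStat c p δ W d H K := by
    have : 0 ≤ sumRadius W (2 * H) δ := Real.sqrt_nonneg _
    unfold epochStat
    positivity
  rcases le_or_gt D H with hDH | hDH
  · -- little drift: the estimates are optimistic
    rcases Nat.eq_zero_or_pos H with hH0 | hHpos
    · have h1 : ∑ k ∈ Finset.Ico τ τ', (𝓜.optToGo k H (st k 0 ω) -
          ∑ h ∈ Finset.range H, 𝓜.reward k h (st k h ω) (ac k h ω)) = 0 := by
        subst hH0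
        simp [LinearMDP.optToGo]
      rw [h1]
      positivity
    have hopt : ∀ k ∈ Finset.Ico τ τ', 𝓜.optToGo k H (st k 0 ω) -
        ∑ h ∈ Finset.range H, 𝓜.reward k h (st k h ω) (ac k h ω) ≤ 2 * D +
        ∑ h ∈ Finset.range H, (2 * confWidth c p d H K * √(invForm (runFeature 𝓜 st ac h ω) τ k
          (runFeature 𝓜 st ac h ω k) (runFeature 𝓜 st ac h ω k)) -
          stepNoise 𝓜 c p st ac τ k h ω) := by
      intro k hk
      obtain ⟨hk1, hk2⟩ := Finset.mem_Ico.1 hk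
      have ho := optimism hP hnet hk1 hk2 hτ' hW hDH le_rfl
      have h1 := (ho H le_rfl (st k 0 ω)).1
      have h2 := runV_le_sum hP hnet hk1 hk2 hτ' hW (fun m hm s => (ho m hm s).2) (hgreedy k hk)
        (n := H - 1) (by omega)
      rw [show H - 1 + 1 = H by omega, Nat.sub_self, ← Finset.range_eq_Ico] at h2
      rw [Nat.sub_self, ← Finset.range_eq_Ico] at h1
      have h3 : ∑ h ∈ Finset.range H, (𝓜.reward k h (st k h ω) (ac k h ω) +
        2 * confWidth c p d H K * √(invForm (runFeature 𝓜 st ac h ω) τ k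
          (runFeature 𝓜 st ac h ω k) (runFeature 𝓜 st ac h ω k)) +
        epochBias 𝓜 W τ τ' h - stepNoise 𝓜 c p st ac τ k h ω) =
          ∑ h ∈ Finset.range H, 𝓜.reward k h (st k h ω) (ac k h ω) + D +
          ∑ h ∈ Finset.range H, (2 * confWidth c p d H K * √(invForm (runFeature 𝓜 st ac h ω) τ k
          (runFeature 𝓜 st ac h ω k) (runFeature 𝓜 st ac h ω k)) -
          stepNoise 𝓜 c p st ac τ k h ω) := by
        rw [hD, ← Finset.sum_add_distrib, ← Finset.sum_add_distrib]
        exact Finset.sum_congr rfl fun h _ => by ring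
      rw [h3] at h2
      linarith
    refine (Finset.sum_le_sum hopt).trans ?_
    rw [Finset.sum_add_distrib, Finset.sum_comm]
    refine add_le_add ?_ ?_
    · rw [Finset.sum_const, Nat.card_Ico, nsmul_eq_mul]
      nlinarith
    · have hterm : ∀ h ∈ Finset.range H, ∑ k ∈ Finset.Ico τ τ',
          (2 * confWidth c p d H K * √(invForm (runFeature 𝓜 st ac h ω) τ k
          (runFeature 𝓜 st ac h ω k) (runFeature 𝓜 st ac h ω k)) -
          stepNoise 𝓜 c p st ac τ k h ω) ≤
          2 * confWidth c p d H K * √(W * (2 * (d * Real.log (d + W)))) +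
            sumRadius W (2 * H) δ := by
        intro h hh
        rw [Finset.sum_sub_distrib, ← Finset.mul_sum, sub_eq_add_neg]
        refine add_le_add (mul_le_mul_of_nonneg_left ?_ (by positivity)) ?_
        · refine (sum_sqrt_invForm_le (runFeature 𝓜 st ac h ω) hττ'
            fun l _ => runFeature_dot_le h l).trans (Real.sqrt_le_sqrt ?_)
          have hd : (1 : ℝ) ≤ d := by exact_mod_cast hP.one_le_d
          have h0 : (0 : ℝ) ≤ ((τ' - τ : ℕ) : ℝ) := Nat.cast_nonneg _
          have hl0 : 0 ≤ Real.log (d + (τ' - τ : ℕ)) := Real.log_nonneg (by linarith)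
          have hl : Real.log (d + (τ' - τ : ℕ)) ≤ Real.log (d + W) :=
            Real.log_le_log (by linarith) (by linarith)
          gcongr
        · refine (neg_le_abs _).trans ?_
          by_cases hh1 : h + 1 < H
          · simp only [stepNoise, if_pos hh1]
            exact (hnoise h hh1 τ τ' hττ' hτ').trans (sumRadius_mono hW hδ hδ1)
          · simp only [stepNoise, if_neg hh1, Finset.sum_const_zero, abs_zero]
            exact Real.sqrt_nonneg _
      refine (Finset.sum_le_sum hterm).trans (le_of_eq ?_)
      rw [Finset.sum_const, Finset.card_range, nsmul_eq_mul, epochStat]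
  · -- much drift: the regret of an episode is at most `H < D`
    have hterm : ∀ k ∈ Finset.Ico τ τ', 𝓜.optToGo k H (st k 0 ω) -
        ∑ h ∈ Finset.range H, 𝓜.reward k h (st k h ω) (ac k h ω) ≤ D := by
      intro k hk
      have hkK : k < K := (Finset.mem_Ico.1 hk).2.trans_le hτ'
      have h1 := (LinearMDP.optToGo_mem (𝓜 := 𝓜) hkK le_rfl (st k 0 ω)).2
      have h2 : 0 ≤ ∑ h ∈ Finset.range H, 𝓜.reward k h (st k h ω) (ac k h ω) :=
        Finset.sum_nonneg fun h hh => 𝓜.reward_nonneg k hkK h (Finset.mem_range.1 hh) _ _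
      linarith
    refine (Finset.sum_le_sum hterm).trans ?_
    rw [Finset.sum_const, Nat.card_Ico, nsmul_eq_mul]
    nlinarith

end Epoch

/-! ### Regret of a block -/

section Blocks

lemma sum_sum_Ico_partition {M : Type*} [AddCommMonoid M] (f : ℕ → M) {e : ℕ → ℕ}
    (he : Monotone e) (J : ℕ) :
    ∑ j ∈ Finset.range J, ∑ k ∈ Finset.Ico (e j) (e (j + 1)), f k =
      ∑ k ∈ Finset.Ico (e 0) (e J), f k := by
  induction J with
  | zero => simp
  | succ J ih =>
    rw [Finset.sum_range_succ, ih, Finset.sum_Ico_consecutive f (he (Nat.zero_le J))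
      (he (Nat.le_succ J))]

/-- The `j`-th epoch of block `i` begins with episode `i * M + j * W`. -/
lemma epochStart_eq {M W i j k : ℕ} (hM : 0 < M) (h1 : i * M + j * W ≤ k)
    (h2 : k < i * M + (j + 1) * W) (h3 : k < (i + 1) * M) :
    k / M = i ∧ epochStart M W k = i * M + j * W := by
  have hW : 0 < W := by
    rcases Nat.eq_zero_or_pos W with rfl | h
    · simp at h1 h2; omega
    · exact h
  have h4 : k = (k - i * M) + i * M := by omega
  have h5 : k - i * M < M := by
    have : (i + 1) * M = i * M + M := by ring
    omega
  have hdiv : k / M = i := by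
    rw [h4, Nat.add_mul_div_right _ _ hM, Nat.div_eq_of_lt h5, zero_add]
  have hmod : k % M = k - i * M := by
    rw [h4, Nat.add_mul_mod_self_right, Nat.mod_eq_of_lt h5, ← h4]
  refine ⟨hdiv, ?_⟩
  have h6 : k - i * M = (k - i * M - j * W) + j * W := by omega
  have h7 : k - i * M - j * W < W := by
    have : (j + 1) * W = j * W + W := by ring
    omega
  rw [epochStart, hmod, h6, Nat.add_mul_mod_self_right, Nat.mod_eq_of_lt h7]
  omega

variable {S : Type u} {A : Type v} [MeasurableSpace S] [MeasurableSpace A] {d H K : ℕ} {Ω : Type w}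
  {𝓜 : LinearMDP S A d H K}

/-- End of block `i`, which begins with episode `i * blockLen b d H K`. -/
def blockEnd (b : ℝ) (d H K i : ℕ) : ℕ := min ((i + 1) * blockLen b d H K) K

/-- Deterministic bound on the regret of block `i` if the window of `W` episodes is used: the cost
of the drift and the statistical error of at most `M / W + 1` epochs. -/
def blockBound (𝓜 : LinearMDP S A d H K) (b c p δ : ℝ) (W i : ℕ) : ℝ :=
  2 * W * √(W : ℝ) * ∑ j ∈ Finset.Ico (i * blockLen b d H K) (blockEnd b d H K i),
    ∑ h ∈ Finset.range H, 𝓜.drift j h +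
  ((blockLen b d H K / W + 1 : ℕ) : ℝ) * epochStat c p δ W d H K

variable {sel : ArgmaxRule A} {c b p ε δ : ℝ} {N : ℕ} {st : ℕ → ℕ → Ω → S}
  {ac : ℕ → ℕ → Ω → A} {arm : ℕ → Ω → Fin (numArms b d H K)} {ω : Ω}
  [MeasurableSingletonClass A] [Finite A] [Nonempty A]

/-- Regret of a block, against the realized rewards, if the window `2 ^ l` is used. -/
theorem block_regret_le (hP : ConfParams c p ε δ N d H K) (hδ : 0 < δ) (hδ1 : δ ≤ 1)
    (hnet : NetConcentrated 𝓜 c p ε δ N st ac ω) (hnoise : NoiseConcentrated 𝓜 c p δ st ac ω)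
    (hM : 0 < blockLen b d H K)
    (hact : ∀ k < K, ∀ h < H, ac k h ω = adaPolicy 𝓜 sel c b p st ac arm k ω h (st k h ω))
    {i : ℕ} (hi : i * blockLen b d H K < K) :
    ∑ k ∈ Finset.Ico (i * blockLen b d H K) (blockEnd b d H K i), (𝓜.optToGo k H (st k 0 ω) -
      ∑ h ∈ Finset.range H, 𝓜.reward k h (st k h ω) (ac k h ω)) ≤
      blockBound 𝓜 b c p δ (2 ^ (arm i ω : ℕ)) i := by
  set M := blockLen b d H K with hMdef
  set W := 2 ^ (arm i ω : ℕ) with hW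
  have hW0 : 0 < W := by positivity
  set e' := blockEnd b d H K i with he'
  have haM : (i + 1) * M = i * M + M := by ring
  have hae : i * M ≤ e' := le_min ((Nat.le_add_right _ _).trans haM.ge) hi.le
  have heM : e' ≤ i * M + M := (min_le_left _ _).trans haM.le
  have heK : e' ≤ K := min_le_right _ _
  -- boundaries of the epochs, cut off at the end of the block
  set e : ℕ → ℕ := fun j => min (i * M + j * W) e' with he
  have hmono : Monotone e := fun j j' hj => min_le_min_right _
    (Nat.add_le_add_left (Nat.mul_le_mul_right _ hj) _)
  have he0 : e 0 = i * M := by simp [he, hae]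
  have heJ : e (M / W + 1) = e' := by
    refine min_eq_right (heM.trans ?_)
    have := Nat.lt_div_mul_add (a := M) hW0
    have : (M / W + 1) * W = M / W * W + W := by ring
    omega
  have hepoch : ∀ j ∈ Finset.range (M / W + 1), ∑ k ∈ Finset.Ico (e j) (e (j + 1)),
      (𝓜.optToGo k H (st k 0 ω) - ∑ h ∈ Finset.range H, 𝓜.reward k h (st k h ω) (ac k h ω)) ≤
      2 * W * √(W : ℝ) * ∑ k ∈ Finset.Ico (e j) (e (j + 1)), ∑ h ∈ Finset.range H, 𝓜.drift k h +
        epochStat c p δ W d H K := by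
    intro j _
    have hlen : e (j + 1) - e j ≤ W := by
      have : (j + 1) * W = j * W + W := by ring
      simp only [he]
      omega
    have h := epoch_regret_le (W := W) hP hδ hδ1 hnet hnoise (hmono (Nat.le_succ j))
      ((min_le_right _ _).trans heK) hlen ?_
    · refine h.trans (le_of_eq ?_)
      rw [Finset.sum_comm (s := Finset.Ico (e j) (e (j + 1)))]
      simp only [epochBias]
      rw [← Finset.mul_sum]
      ring
    · intro k hk h hh a
      obtain ⟨hk1, hk2⟩ := Finset.mem_Ico.1 hk
      have hke : k < e' := hk2.trans_le (min_le_right _ _)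
      have hkj : k < i * M + (j + 1) * W := hk2.trans_le (min_le_left _ _)
      have hej : e j = i * M + j * W := by
        simp only [he] at hk1 ⊢
        omega
      obtain ⟨hdiv, hstart⟩ := epochStart_eq (k := k) (i := i) (j := j) (W := W) hM
        (hej ▸ hk1) hkj (by omega)
      rw [hact k (by omega) h hh, adaPolicy, ← hMdef, hdiv, hstart, ← hej]
      exact sel.le_pick (fun a => lsviQ H (confWidth c p d H K) 𝓜.φ (fun l j => st l j ω)
        (fun l j => ac l j ω) (fun l j => 𝓜.reward l j (st l j ω) (ac l j ω)) (e j) k h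
        (st k h ω) a) a
  rw [← heJ, ← he0, ← sum_sum_Ico_partition _ hmono]
  refine (Finset.sum_le_sum hepoch).trans (le_of_eq ?_)
  rw [Finset.sum_add_distrib, ← Finset.mul_sum, sum_sum_Ico_partition _ hmono, heJ, he0]
  simp [blockBound, ← hMdef, ← he']

end Blocks

/-! ### The good event -/

section GoodEvent

variable {S : Type u} {A : Type v} [MeasurableSpace S] [MeasurableSpace A] {d H K : ℕ} {Ω : Type w}

lemma exp3pScore_eq_sum {n : ℕ} (α β γ : ℝ) (arm : ℕ → Fin n) (gain : ℕ → ℝ) (N : ℕ) (l : Fin n) :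
    exp3pScore α β γ arm gain N l = ∑ i ∈ Finset.range N, ((if arm i = l then gain i else 0) + β) /
      exp3pProb α γ (exp3pScore α β γ arm gain i) l := by
  induction N with
  | zero => simp [exp3pScore]
  | succ N ih => rw [Finset.sum_range_succ, ← ih]; rfl

lemma measurable_exp3pProb {m : MeasurableSpace Ω} {n : ℕ} (α γ : ℝ) {q : Ω → Fin n → ℝ}
    (hq : ∀ l, Measurable fun ω => q ω l) (l : Fin n) :
    Measurable fun ω => exp3pProb α γ (q ω) l := by
  have he : ∀ l, Measurable fun ω => Real.exp (α * q ω l) := fun l =>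
    Real.measurable_exp.comp ((hq l).const_mul α)
  exact (((he l).div (Finset.measurable_sum _ fun j _ => he j)).const_mul _).add_const _

lemma measurable_exp3pScore {m : MeasurableSpace Ω} {n : ℕ} (α β γ : ℝ) {arm : ℕ → Ω → Fin n}
    {gain : ℕ → Ω → ℝ} {N : ℕ} (harm : ∀ i < N, Measurable (arm i))
    (hgain : ∀ i < N, Measurable (gain i)) (l : Fin n) :
    Measurable fun ω => exp3pScore α β γ (fun i => arm i ω) (fun i => gain i ω) N l := by
  induction N generalizing l with
  | zero => exact measurable_const
  | succ N ih =>
    have ih := ih (fun i hi => harm i (by omega)) (fun i hi => hgain i (by omega))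
    refine (ih l).add (((Measurable.ite ?_ (hgain N (by omega)) measurable_const).add_const β).div
      (measurable_exp3pProb α γ ih l))
    exact harm N (by omega) (measurableSet_singleton l)

lemma measure_biUnion_le_card_mul [MeasurableSpace Ω] {P : Measure Ω} {ι : Type*} (s : Finset ι)
    {B : ι → Set Ω} {δ : ℝ} (h : ∀ i ∈ s, P (B i) ≤ ENNReal.ofReal δ) :
    P (⋃ i ∈ s, B i) ≤ ENNReal.ofReal (s.card * δ) := by
  refine (measure_biUnion_finset_le s B).trans ((Finset.sum_le_sum h).trans (le_of_eq ?_))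
  rw [Finset.sum_const, nsmul_eq_mul, ENNReal.ofReal_mul (by positivity), ENNReal.ofReal_natCast]

/-- Concentration, at the sample point `ω`, of the realized rewards around the values of the
executed policies. -/
def ValueConcentrated (𝓜 : LinearMDP S A d H K) (sel : ArgmaxRule A) (c b p δ : ℝ)
    (st : ℕ → ℕ → Ω → S) (ac : ℕ → ℕ → Ω → A) (arm : ℕ → Ω → Fin (numArms b d H K)) (ω : Ω) :
    Prop :=
  ∀ h, h + 1 < H → |∑ l ∈ Finset.Ico 0 K, nextNoise 𝓜 st ac h (fun l ω =>
    𝓜.valueToGo l (adaPolicy 𝓜 sel c b p st ac arm l ω) (H - (h + 1))) l ω| ≤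
      sumRadius K (2 * H) δ

variable {𝓜 : LinearMDP S A d H K} {sel : ArgmaxRule A} {c b p ε δ : ℝ} {N : ℕ}
  {st : ℕ → ℕ → Ω → S} {ac : ℕ → ℕ → Ω → A} {arm : ℕ → Ω → Fin (numArms b d H K)}

/-- The value of the executed policy differs from the realized rewards by a sum of noise terms, one
for every step that is not the last of its episode. -/
lemma sum_reward_sub_value_le {ω : Ω} (hval : ValueConcentrated 𝓜 sel c b p δ st ac arm ω)
    (hact : ∀ k < K, ∀ h < H, ac k h ω = adaPolicy 𝓜 sel c b p st ac arm k ω h (st k h ω)) :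
    ∑ k ∈ Finset.range K, (∑ h ∈ Finset.range H, 𝓜.reward k h (st k h ω) (ac k h ω) -
      𝓜.value k (adaPolicy 𝓜 sel c b p st ac arm k ω) (st k 0 ω)) ≤
      H * sumRadius K (2 * H) δ := by
  set π : ℕ → ℕ → S → A := fun k => adaPolicy 𝓜 sel c b p st ac arm k ω with hπ
  set e : ℕ → ℕ → ℝ := fun k h => if h + 1 < H then nextNoise 𝓜 st ac h (fun l ω =>
    𝓜.valueToGo l (adaPolicy 𝓜 sel c b p st ac arm l ω) (H - (h + 1))) k ω else 0 with he
  have hdec : ∀ k < K, ∀ n < H, 𝓜.valueToGo k (π k) (n + 1) (st k (H - (n + 1)) ω) =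
      ∑ h ∈ Finset.Ico (H - (n + 1)) H, (𝓜.reward k h (st k h ω) (ac k h ω) - e k h) := by
    intro k hk n hn
    induction n with
    | zero =>
      have hIco : Finset.Ico (H - (0 + 1)) H = {H - (0 + 1)} := by
        ext j
        simp only [Finset.mem_Ico, Finset.mem_singleton]
        omega
      rw [hIco, Finset.sum_singleton, he]
      simp only
      rw [if_neg (by omega), hact k hk _ (by omega)]
      simp [LinearMDP.valueToGo, hπ]
    | succ n ih =>
      have ih := ih (by omega)
      have hs : H - (n + 1 + 1) + 1 = H - (n + 1) := by omega
      rw [Finset.sum_eq_sum_Ico_succ_bot (by omega : H - (n + 1 + 1) < H), hs, ← ih]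
      simp only [he]
      rw [if_pos (by omega), nextNoise, hs, show H - (H - (n + 1)) = n + 1 by omega,
        hact k hk _ (by omega)]
      simp only [LinearMDP.expect, hπ]
      rw [LinearMDP.valueToGo]
      ring
  rcases Nat.eq_zero_or_pos H with hH0 | hHpos
  · subst hH0
    simp [LinearMDP.value, LinearMDP.valueToGo]
  have hk : ∀ k ∈ Finset.range K, ∑ h ∈ Finset.range H, 𝓜.reward k h (st k h ω) (ac k h ω) -
      𝓜.value k (π k) (st k 0 ω) = ∑ h ∈ Finset.range H, e k h := by
    intro k hk
    have := hdec k (Finset.mem_range.1 hk) (H - 1) (by omega)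
    rw [show H - 1 + 1 = H by omega, Nat.sub_self, ← Finset.range_eq_Ico] at this
    rw [LinearMDP.value, this, Finset.sum_sub_distrib]
    ring
  rw [Finset.sum_congr rfl hk, Finset.sum_comm]
  calc ∑ h ∈ Finset.range H, ∑ k ∈ Finset.range K, e k h
      ≤ ∑ h ∈ Finset.range H, sumRadius K (2 * H) δ := by
        refine Finset.sum_le_sum fun h _ => ?_
        by_cases hh : h + 1 < H
        · have := (le_abs_self _).trans (hval h hh)
          rw [← Finset.range_eq_Ico] at this
          simpa only [he, if_pos hh] using this
        · simp only [he, if_neg hh, Finset.sum_const_zero]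
          exact Real.sqrt_nonneg _
    _ = _ := by simp

variable [mΩ : MeasurableSpace Ω] {P : Measure Ω} [IsProbabilityMeasure P]
  {ℱ : Filtration ℕ (inferInstance : MeasurableSpace Ω)}
  [MeasurableSingletonClass A] [Finite A]

namespace IsAdaRun

/-- Union bound over steps, ranges of episodes and the net. -/
lemma measure_not_netConcentrated [Nonempty A]
    (hrun : IsAdaRun 𝓜 sel c b p P ℱ st ac arm) (hH : 1 ≤ H)
    (hδ : 0 < δ) : P {ω | ¬ NetConcentrated 𝓜 c p ε δ N st ac ω} ≤ ENNReal.ofReal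
      ((H * (K + 1) ^ 2 * (2 * N + 1) ^ (d + d * d) : ℕ) * δ) := by
  classical
  set s : Finset (ℕ × ℕ × ℕ × NetIndex d N) := Finset.range H ×ˢ Finset.range (K + 1) ×ˢ
    Finset.range (K + 1) ×ˢ Finset.univ with hs
  set B : ℕ × ℕ × ℕ × NetIndex d N → Set Ω := fun q => {ω | (q.1 + 1 < H ∧ q.2.1 ≤ q.2.2.1) ∧
    confRadius d (q.2.2.1 - q.2.1) (2 * H) δ < invForm (runFeature 𝓜 st ac q.1 ω) q.2.1 q.2.2.1
      (noiseSum (runFeature 𝓜 st ac q.1 ω) (fun l => nextNoise 𝓜 st ac q.1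
        (fun _ _ => netFun H (confWidth c p d H K) 𝓜.φ ε N q.2.2.2) l ω) q.2.1 q.2.2.1)
      (noiseSum (runFeature 𝓜 st ac q.1 ω) (fun l => nextNoise 𝓜 st ac q.1
        (fun _ _ => netFun H (confWidth c p d H K) 𝓜.φ ε N q.2.2.2) l ω) q.2.1 q.2.2.1)} with hB
  have hsub : {ω | ¬ NetConcentrated 𝓜 c p ε δ N st ac ω} ⊆ ⋃ q ∈ s, B q := by
    intro ω hω
    simp only [NetConcentrated, Set.mem_ofPred_eq, not_forall, not_le] at hω
    obtain ⟨h, hh, τ, n, hτn, hn, z, hz⟩ := hω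
    refine Set.mem_biUnion (x := (h, τ, n, z)) ?_ ⟨⟨hh, hτn⟩, hz⟩
    simp only [hs, Finset.coe_product, Set.mem_prod, Finset.mem_coe, Finset.mem_range,
      Finset.mem_univ, and_true]
    omega
  refine (measure_mono hsub).trans ((measure_biUnion_le_card_mul (δ := δ) s fun q hq => ?_).trans
    (le_of_eq ?_))
  · simp only [hs, Finset.mem_product, Finset.mem_range] at hq
    by_cases hc : q.1 + 1 < H ∧ q.2.1 ≤ q.2.2.1
    · refine (measure_mono fun ω hω => ?_).trans (hrun.concentration hc.1 hc.2 (by omega)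
        (x := fun l ω => runFeature 𝓜 st ac q.1 ω l)
        (V := fun _ _ => netFun H (confWidth c p d H K) 𝓜.φ ε N q.2.2.2) (R := H)
        (fun l hl => hrun.measurable_feature hl (by omega) le_rfl)
        (fun l _ ω => runFeature_dot_le q.1 l) (fun l _ => ?_) (by exact_mod_cast hH)
        (fun _ _ _ s => abs_estClass_le _ _ s) hδ)
      · exact hω.2
      · exact (measurable_estClass 𝓜 _ _ _).comp measurable_snd
    · have : B q = ∅ := by
        ext ω
        simp only [hB, Set.mem_ofPred_eq, Set.mem_empty_iff_false, iff_false]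
        exact fun h => hc h.1
      rw [this, measure_empty]
      exact zero_le
  · congr 3
    rw [hs, Finset.card_product, Finset.card_product, Finset.card_product, Finset.card_range,
      Finset.card_range, Finset.card_univ, card_netIndex]
    ring

/-- Union bound over steps and ranges of episodes. -/
lemma measure_not_noiseConcentrated [Nonempty A]
    (hrun : IsAdaRun 𝓜 sel c b p P ℱ st ac arm) (hH : 1 ≤ H)
    (hδ : 0 < δ) : P {ω | ¬ NoiseConcentrated 𝓜 c p δ st ac ω} ≤ ENNReal.ofReal
      ((H * (K + 1) ^ 2 : ℕ) * δ) := by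
  classical
  set s : Finset (ℕ × ℕ × ℕ) := Finset.range H ×ˢ Finset.range (K + 1) ×ˢ
    Finset.range (K + 1) with hs
  set B : ℕ × ℕ × ℕ → Set Ω := fun q => {ω | (q.1 + 1 < H ∧ q.2.1 ≤ q.2.2) ∧
    sumRadius (q.2.2 - q.2.1) (2 * H) δ < |∑ l ∈ Finset.Ico q.2.1 q.2.2, nextNoise 𝓜 st ac q.1
      (fun l => clipV 𝓜 c p st ac q.2.1 l (H - (q.1 + 1))) l ω|} with hB
  have hsub : {ω | ¬ NoiseConcentrated 𝓜 c p δ st ac ω} ⊆ ⋃ q ∈ s, B q := by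
    intro ω hω
    simp only [NoiseConcentrated, Set.mem_ofPred_eq, not_forall, not_le] at hω
    obtain ⟨h, hh, τ, n, hτn, hn, hz⟩ := hω
    refine Set.mem_biUnion (x := (h, τ, n)) ?_ ⟨⟨hh, hτn⟩, hz⟩
    simp only [hs, Finset.coe_product, Set.mem_prod, Finset.mem_coe, Finset.mem_range]
    omega
  refine (measure_mono hsub).trans ((measure_biUnion_le_card_mul (δ := δ) s fun q hq => ?_).trans
    (le_of_eq ?_))
  · simp only [hs, Finset.mem_product, Finset.mem_range] at hq
    by_cases hc : q.1 + 1 < H ∧ q.2.1 ≤ q.2.2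
    · refine (measure_mono fun ω hω => ?_).trans (hrun.concentration_sum hc.1 hc.2 (by omega)
        (V := fun l => clipV 𝓜 c p st ac q.2.1 l (H - (q.1 + 1))) (R := H)
        (fun l hl => ?_) (by exact_mod_cast hH) (fun l _ ω s => ?_) hδ)
      · exact hω.2
      · exact measurable_const.max (hrun.measurable_runV hl (by omega)
          (tick_mono le_rfl (Nat.zero_le _)) q.2.1)
      · have hH0 : (0 : ℝ) ≤ H := H.cast_nonneg
        exact abs_le.2 ⟨le_max_left _ _, max_le (by linarith) (runV_le _ _ _ s)⟩
    · have : B q = ∅ := by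
        ext ω
        simp only [hB, Set.mem_ofPred_eq, Set.mem_empty_iff_false, iff_false]
        exact fun h => hc h.1
      rw [this, measure_empty]
      exact zero_le
  · congr 3
    rw [hs, Finset.card_product, Finset.card_product, Finset.card_range, Finset.card_range]
    ring

/-- Union bound over steps. -/
lemma measure_not_valueConcentrated (hrun : IsAdaRun 𝓜 sel c b p P ℱ st ac arm) (hH : 1 ≤ H)
    (hδ : 0 < δ) : P {ω | ¬ ValueConcentrated 𝓜 sel c b p δ st ac arm ω} ≤
      ENNReal.ofReal (H * δ) := by
  set B : ℕ → Set Ω := fun h => {ω | h + 1 < H ∧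
    sumRadius (K - 0) (2 * H) δ < |∑ l ∈ Finset.Ico 0 K, nextNoise 𝓜 st ac h (fun l ω =>
      𝓜.valueToGo l (adaPolicy 𝓜 sel c b p st ac arm l ω) (H - (h + 1))) l ω|} with hB
  have hsub : {ω | ¬ ValueConcentrated 𝓜 sel c b p δ st ac arm ω} ⊆
      ⋃ h ∈ Finset.range H, B h := by
    intro ω hω
    simp only [ValueConcentrated, Set.mem_ofPred_eq, not_forall, not_le] at hω
    obtain ⟨h, hh, hz⟩ := hω
    refine Set.mem_biUnion (x := h) ?_ ⟨hh, hz⟩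
    simp only [Finset.coe_range, Set.mem_Iio]
    omega
  refine (measure_mono hsub).trans ((measure_biUnion_le_card_mul (δ := δ) _ fun h hh => ?_).trans
    (le_of_eq ?_))
  · by_cases hc : h + 1 < H
    · refine (measure_mono fun ω hω => ?_).trans (hrun.concentration_sum hc (Nat.zero_le K) le_rfl
        (V := fun l ω => 𝓜.valueToGo l (adaPolicy 𝓜 sel c b p st ac arm l ω) (H - (h + 1)))
        (R := H) (fun l hl => ?_) (by exact_mod_cast hH) (fun l hl ω s => ?_) hδ)
      · exact hω.2
      · exact LinearMDP.measurable_valueToGo (mΓ := ℱ (tick H l (h + 1))) hl (by omega)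
          (π := fun ω => adaPolicy 𝓜 sel c b p st ac arm l ω)
          fun j hj => hrun.measurable_policy hl hj (tick_mono le_rfl (by omega))
      · have h1 := LinearMDP.valueToGo_mem (𝓜 := 𝓜) hl (by omega : H - (h + 1) ≤ H)
          (adaPolicy 𝓜 sel c b p st ac arm l ω) s
        have h2 : ((H - (h + 1) : ℕ) : ℝ) ≤ H := by exact_mod_cast Nat.sub_le _ _
        have hH0 : (0 : ℝ) ≤ H := H.cast_nonneg
        exact abs_le.2 ⟨by linarith, by linarith⟩
    · have : B h = ∅ := by
        ext ω
        simp only [hB, Set.mem_ofPred_eq, Set.mem_empty_iff_false, iff_false]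
        exact fun h => hc h.1
      rw [this, measure_empty]
      exact zero_le
  · rw [Finset.card_range]

end IsAdaRun

end GoodEvent

/-! ### High-probability regret bound against a fixed window -/

section Regret

variable {S : Type u} {A : Type v} [MeasurableSpace S] [MeasurableSpace A] {d H K : ℕ} {Ω : Type w}
  {b : ℝ}

lemma lt_of_lt_numBlocks (hM : 0 < blockLen b d H K) {i : ℕ} (hi : i < numBlocks b d H K) :
    i * blockLen b d H K < K := by
  have h := Nat.lt_ceil.1 hi
  rw [lt_div_iff₀ (by exact_mod_cast hM)] at h
  exact_mod_cast h

lemma le_numBlocks_mul (hM : 0 < blockLen b d H K) :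
    K ≤ numBlocks b d H K * blockLen b d H K := by
  have h := Nat.le_ceil ((K : ℝ) / blockLen b d H K)
  rw [div_le_iff₀ (by exact_mod_cast hM)] at h
  exact_mod_cast h

lemma sum_blocks {M : Type*} [AddCommMonoid M] (hM : 0 < blockLen b d H K) (f : ℕ → M) :
    ∑ i ∈ Finset.range (numBlocks b d H K),
      ∑ k ∈ Finset.Ico (i * blockLen b d H K) (blockEnd b d H K i), f k =
      ∑ k ∈ Finset.range K, f k := by
  have hmono : Monotone fun i => min (i * blockLen b d H K) K := fun i j hij =>
    min_le_min_right _ (Nat.mul_le_mul_right _ hij)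
  have h := sum_sum_Ico_partition f hmono (numBlocks b d H K)
  simp only [zero_mul, Nat.zero_min, min_eq_right (le_numBlocks_mul hM)] at h
  rw [Finset.range_eq_Ico, Finset.range_eq_Ico, ← h, Finset.range_eq_Ico]
  refine Finset.sum_congr rfl fun i hi => ?_
  rw [min_eq_left (lt_of_lt_numBlocks hM (Finset.mem_Ico.1 hi).2).le, blockEnd]

lemma card_block_le (i : ℕ) :
    (Finset.Ico (i * blockLen b d H K) (blockEnd b d H K i)).card ≤ blockLen b d H K := by
  have h1 : blockEnd b d H K i ≤ (i + 1) * blockLen b d H K := min_le_left _ _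
  have h2 : (i + 1) * blockLen b d H K = i * blockLen b d H K + blockLen b d H K := by ring
  rw [Nat.card_Ico]
  omega

lemma lt_of_mem_block {i k : ℕ} (hk : k ∈ Finset.Ico (i * blockLen b d H K) (blockEnd b d H K i)) :
    k < (i + 1) * blockLen b d H K ∧ k < K :=
  lt_min_iff.1 (Finset.mem_Ico.1 hk).2

lemma sum_block_le {f : ℕ → ℝ} {i : ℕ} (hf : ∀ k < K, f k ≤ H) :
    ∑ k ∈ Finset.Ico (i * blockLen b d H K) (blockEnd b d H K i), f k ≤ blockLen b d H K * H := by
  calc _ ≤ ∑ k ∈ Finset.Ico (i * blockLen b d H K) (blockEnd b d H K i), (H : ℝ) :=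
        Finset.sum_le_sum fun k hk => hf k (lt_of_mem_block hk).2
    _ ≤ _ := by
        rw [Finset.sum_const, nsmul_eq_mul]
        have : ((Finset.Ico (i * blockLen b d H K) (blockEnd b d H K i)).card : ℝ) ≤
          blockLen b d H K := by exact_mod_cast card_block_le i
        gcongr

variable {𝓜 : LinearMDP S A d H K} {c p δ η : ℝ}

lemma epochStat_nonneg {W : ℕ} (hw : 0 ≤ confWidth c p d H K) : 0 ≤ epochStat c p δ W d H K := by
  unfold epochStat sumRadius
  positivity

lemma blockBound_nonneg {W i : ℕ} (hw : 0 ≤ confWidth c p d H K) :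
    0 ≤ blockBound 𝓜 b c p δ W i := by
  have h1 := epochStat_nonneg (δ := δ) (W := W) hw
  have h2 : 0 ≤ ∑ j ∈ Finset.Ico (i * blockLen b d H K) (blockEnd b d H K i),
      ∑ h ∈ Finset.range H, 𝓜.drift j h :=
    Finset.sum_nonneg fun j _ => Finset.sum_nonneg fun h _ => 𝓜.drift_nonneg j h
  unfold blockBound
  positivity

/-- The total drift in terms of the variation budgets, with a factor `2 H` for the transitions. -/
lemma sum_drift : ∑ j ∈ Finset.range K, ∑ h ∈ Finset.range H, 𝓜.drift j h =
    𝓜.varθ + 2 * H * 𝓜.varμ := by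
  rcases Nat.eq_zero_or_pos K with h0 | hK
  · subst h0
    simp [LinearMDP.varθ, LinearMDP.varμ]
  obtain ⟨n, hn⟩ : ∃ n, K = n + 1 := ⟨K - 1, by omega⟩
  have hlast : ∑ h ∈ Finset.range H, 𝓜.drift n h = 0 :=
    Finset.sum_eq_zero fun h _ => if_neg (by omega)
  have hrange : Finset.range K = Finset.range (n + 1) := by rw [hn]
  rw [hrange, Finset.sum_range_succ, hlast, add_zero, LinearMDP.varθ, LinearMDP.varμ,
    show K - 1 = n by omega, Finset.mul_sum, ← Finset.sum_add_distrib]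
  refine Finset.sum_congr rfl fun j hj => ?_
  rw [Finset.mul_sum, ← Finset.sum_add_distrib]
  refine Finset.sum_congr rfl fun h _ => ?_
  have := Finset.mem_range.1 hj
  rw [LinearMDP.drift, if_pos (by omega)]

lemma sum_blockBound (hM : 0 < blockLen b d H K) (W : ℕ) :
    ∑ i ∈ Finset.range (numBlocks b d H K), blockBound 𝓜 b c p δ W i =
      2 * W * √(W : ℝ) * (𝓜.varθ + 2 * H * 𝓜.varμ) +
        numBlocks b d H K * (((blockLen b d H K / W + 1 : ℕ) : ℝ) * epochStat c p δ W d H K) := by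
  simp only [blockBound, Finset.sum_add_distrib]
  rw [← Finset.mul_sum, sum_blocks hM, sum_drift, Finset.sum_const, Finset.card_range, nsmul_eq_mul]

/-- Gain guaranteed in block `i` by the window of `W` episodes, on the scale of EXP3-P. It depends
only on what happens before the block, since the initial states of the block do. -/
def guaranteedGain (𝓜 : LinearMDP S A d H K) (b c p δ : ℝ) (st : ℕ → ℕ → Ω → S) (W i : ℕ) (ω : Ω) :
    ℝ :=
  max 0 ((∑ k ∈ Finset.Ico (i * blockLen b d H K) (blockEnd b d H K i), 𝓜.optToGo k H (st k 0 ω) -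
    blockBound 𝓜 b c p δ W i) / (blockLen b d H K * H))

/-- Bound on the dynamic regret: the regret of EXP3-P against the fixed window of `W` episodes, the
regret with that window, and the deviation of the rewards from the values. The confidence level of
the score of EXP3-P is `1 - η`. -/
def regretBound (𝓜 : LinearMDP S A d H K) (b c p δ η : ℝ) (W : ℕ) : ℝ :=
  blockLen b d H K * H * (2 * metaγ b d H K * numBlocks b d H K + Real.log (1 / η) / metaβ b d H K +
    Real.log (numArms b d H K) / metaα b d H K +
      numBlocks b d H K * (numArms b d H K * metaβ b d H K)) +
  ∑ i ∈ Finset.range (numBlocks b d H K), blockBound 𝓜 b c p δ W i +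
  H * sumRadius K (2 * H) δ

/-- The parameters of EXP3-P are in the range of its analysis. -/
structure Exp3Params (b : ℝ) (d H K : ℕ) : Prop where
  blockLen_pos : 0 < blockLen b d H K
  α_pos : 0 < metaα b d H K
  β_pos : 0 < metaβ b d H K
  β_le_one : metaβ b d H K ≤ 1
  γ_pos : 0 < metaγ b d H K
  γ_le : metaγ b d H K ≤ 1 / 2
  mul_le : metaα b d H K * (1 + metaβ b d H K) * numArms b d H K ≤ metaγ b d H K

variable {sel : ArgmaxRule A} {ε : ℝ} {N : ℕ} {st : ℕ → ℕ → Ω → S}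
  {ac : ℕ → ℕ → Ω → A} {arm : ℕ → Ω → Fin (numArms b d H K)} {ω : Ω}

lemma reward_mem {k h : ℕ} (hk : k < K) (hh : h < H) (s : S) (a : A) :
    0 ≤ 𝓜.reward k h s a ∧ 𝓜.reward k h s a ≤ 1 :=
  ⟨𝓜.reward_nonneg k hk h hh s a, 𝓜.reward_le_one k hk h hh s a⟩

lemma blockGain_mem (i : ℕ) : 0 ≤ blockGain 𝓜 b st ac i ω ∧ blockGain 𝓜 b st ac i ω ≤ 1 := by
  constructor
  · refine div_nonneg (Finset.sum_nonneg fun k hk => Finset.sum_nonneg fun h hh => ?_)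
      (by positivity)
    exact (reward_mem (lt_of_mem_block hk).2 (Finset.mem_range.1 hh) _ _).1
  · refine div_le_one_of_le₀ (sum_block_le fun k hk => ?_) (by positivity)
    calc _ ≤ ∑ h ∈ Finset.range H, (1 : ℝ) := Finset.sum_le_sum fun h hh =>
          (reward_mem hk (Finset.mem_range.1 hh) _ _).2
      _ = H := by simp

variable [Nonempty A]

lemma guaranteedGain_mem (hw : 0 ≤ confWidth c p d H K) (W i : ℕ) :
    0 ≤ guaranteedGain 𝓜 b c p δ st W i ω ∧ guaranteedGain 𝓜 b c p δ st W i ω ≤ 1 := by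
  refine ⟨le_max_left _ _, max_le zero_le_one (div_le_one_of_le₀ ?_ (by positivity))⟩
  have := blockBound_nonneg (𝓜 := 𝓜) (b := b) (δ := δ) (W := W) (i := i) hw
  have := sum_block_le (d := d) (b := b) (i := i) (f := fun k => 𝓜.optToGo k H (st k 0 ω))
    fun k hk => (𝓜.optToGo_mem hk le_rfl _).2
  linarith

/-- The trivial bound on the dynamic regret. -/
lemma dynRegret_le_mul [Finite A] [MeasurableSingletonClass A] :
    dynRegret 𝓜 sel c b p st ac arm ω ≤ K * H := by
  calc dynRegret 𝓜 sel c b p st ac arm ω ≤ ∑ k ∈ Finset.range K, (H : ℝ) :=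
        Finset.sum_le_sum fun k hk => by
          have hk := Finset.mem_range.1 hk
          have h1 := 𝓜.optValue_le hk (st k 0 ω)
          have h2 := (𝓜.optToGo_mem hk le_rfl (st k 0 ω)).2
          have h3 := (𝓜.valueToGo_mem hk le_rfl (adaPolicy 𝓜 sel c b p st ac arm k ω)
            (st k 0 ω)).1
          unfold LinearMDP.value
          linarith
    _ = K * H := by simp

/-- Regret bound at a sample point of the good event. -/
theorem dynRegret_le [Finite A] [MeasurableSingletonClass A]
    (hP : ConfParams c p ε δ N d H K) (hE : Exp3Params b d H K) (hH : 1 ≤ H)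
    (hδ : 0 < δ) (hδ1 : δ ≤ 1) (hη : 0 < η) (hη1 : η ≤ 1) (l : Fin (numArms b d H K))
    (hnet : NetConcentrated 𝓜 c p ε δ N st ac ω) (hnoise : NoiseConcentrated 𝓜 c p δ st ac ω)
    (hval : ValueConcentrated 𝓜 sel c b p δ st ac arm ω)
    (hact : ∀ k < K, ∀ h < H, ac k h ω = adaPolicy 𝓜 sel c b p st ac arm k ω h (st k h ω))
    (hbias : ∑ i ∈ Finset.range (numBlocks b d H K), (guaranteedGain 𝓜 b c p δ st (2 ^ (l : ℕ)) i ω -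
      ((if arm i ω = l then 1 else 0) * guaranteedGain 𝓜 b c p δ st (2 ^ (l : ℕ)) i ω +
        metaβ b d H K) / armProb 𝓜 b st ac arm i l ω) ≤ Real.log (1 / η) / metaβ b d H K) :
    dynRegret 𝓜 sel c b p st ac arm ω ≤ regretBound 𝓜 b c p δ η (2 ^ (l : ℕ)) := by
  have hM := hE.blockLen_pos
  have hw := hP.width_nonneg
  set M := blockLen b d H K with hMdef
  set J := numBlocks b d H K with hJ
  set x := Real.log (1 / η) / metaβ b d H K with hx
  set G := fun i => guaranteedGain 𝓜 b c p δ st (2 ^ (l : ℕ)) i ω with hG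
  set B := fun i => blockBound 𝓜 b c p δ (2 ^ (l : ℕ)) i with hB
  set gain := fun i => blockGain 𝓜 b st ac i ω with hgain
  set u := fun i => armProb 𝓜 b st ac arm i l ω with hu
  have hMH : (0 : ℝ) < M * H := by
    have : 0 < M * H := Nat.mul_pos hM hH
    exact_mod_cast this
  have hΔ : 0 < numArms b d H K := Nat.succ_pos _
  have hx0 : 0 ≤ x := div_nonneg (Real.log_nonneg (by rw [one_div]; exact (one_le_inv₀ hη).2 hη1))
    hE.β_pos.le
  have hG0 : ∀ i, 0 ≤ G i ∧ G i ≤ 1 := fun i => guaranteedGain_mem hw _ i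
  have hopt : ∀ i, ∑ k ∈ Finset.Ico (i * M) (blockEnd b d H K i), 𝓜.optToGo k H (st k 0 ω) ≤
      M * H * G i + B i := fun i => by
    have : (∑ k ∈ Finset.Ico (i * M) (blockEnd b d H K i), 𝓜.optToGo k H (st k 0 ω) - B i) /
      (M * H) ≤ G i := le_max_right _ _
    rw [div_le_iff₀ hMH] at this
    linarith
  have hrew : ∀ i, ∑ k ∈ Finset.Ico (i * M) (blockEnd b d H K i), ∑ h ∈ Finset.range H,
      𝓜.reward k h (st k h ω) (ac k h ω) = M * H * gain i := fun i => by
    simp only [hgain, blockGain]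
    rw [mul_div_cancel₀ _ hMH.ne']
    rfl
  -- whenever the window `2 ^ l` is used, it earns at least its guaranteed gain
  have hGgain : ∀ i < J, arm i ω = l → G i ≤ gain i := fun i hi hl => by
    refine max_le (blockGain_mem i).1 ?_
    rw [div_le_iff₀ hMH]
    have h := block_regret_le hP hδ hδ1 hnet hnoise hM hact (lt_of_lt_numBlocks hM hi)
    rw [Finset.sum_sub_distrib, hrew i, hl] at h
    linarith
  -- hence the score of the arm `l` is at least the sum of its guaranteed gains, up to a deviation
  have hscore : ∑ i ∈ Finset.range J, G i - x ≤ exp3pScore (metaα b d H K) (metaβ b d H K)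
      (metaγ b d H K) (fun i => arm i ω) gain J l := by
    rw [exp3pScore_eq_sum]
    rw [Finset.sum_sub_distrib] at hbias
    have : ∑ i ∈ Finset.range J, ((if arm i ω = l then 1 else 0) * G i + metaβ b d H K) / u i ≤
        ∑ i ∈ Finset.range J, ((if arm i ω = l then gain i else 0) + metaβ b d H K) / u i := by
      refine Finset.sum_le_sum fun i hi => ?_
      have hui : 0 < u i := (exp3pProb_pos hΔ hE.γ_pos (hE.γ_le.trans (by norm_num)) _ l).2
      gcongr
      split_ifs with h
      · rw [one_mul]
        exact hGgain i (Finset.mem_range.1 hi) h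
      · rw [zero_mul]
    simp only [hu, armProb] at this hbias
    linarith
  have hexp := exp3p_gain_ge hΔ hE.α_pos hE.β_pos.le hE.γ_pos hE.γ_le hE.mul_le
    (fun i => arm i ω) gain J (fun i _ => (blockGain_mem i).1) (fun i _ => (blockGain_mem i).2) l
  have hGJ : ∑ i ∈ Finset.range J, G i ≤ J := by
    calc _ ≤ ∑ i ∈ Finset.range J, (1 : ℝ) := Finset.sum_le_sum fun i _ => (hG0 i).2
      _ = J := by simp
  -- and EXP3-P competes with the score
  have hmain : ∑ i ∈ Finset.range J, G i - ∑ i ∈ Finset.range J, gain i ≤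
      2 * metaγ b d H K * J + x + Real.log (numArms b d H K) / metaα b d H K +
        J * (numArms b d H K * metaβ b d H K) := by
    have h1 := mul_le_mul_of_nonneg_left hscore (by linarith [hE.γ_le] :
      0 ≤ 1 - 2 * metaγ b d H K)
    have h2 := mul_le_mul_of_nonneg_left hGJ hE.γ_pos.le
    have h3 := mul_nonneg hE.γ_pos.le hx0
    linarith
  have hreg : dynRegret 𝓜 sel c b p st ac arm ω ≤ ∑ k ∈ Finset.range K,
      (𝓜.optToGo k H (st k 0 ω) - 𝓜.value k (adaPolicy 𝓜 sel c b p st ac arm k ω) (st k 0 ω)) :=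
    Finset.sum_le_sum fun k hk =>
      sub_le_sub_right (𝓜.optValue_le (Finset.mem_range.1 hk) _) _
  have hv := sum_reward_sub_value_le hval hact
  have hopt' : ∑ k ∈ Finset.range K, 𝓜.optToGo k H (st k 0 ω) ≤
      M * H * ∑ i ∈ Finset.range J, G i + ∑ i ∈ Finset.range J, B i := by
    rw [← sum_blocks hM, Finset.mul_sum, ← Finset.sum_add_distrib]
    exact Finset.sum_le_sum fun i _ => hopt i
  have hrew' : ∑ k ∈ Finset.range K, ∑ h ∈ Finset.range H, 𝓜.reward k h (st k h ω) (ac k h ω) =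
      M * H * ∑ i ∈ Finset.range J, gain i := by
    rw [← sum_blocks hM, Finset.mul_sum]
    exact Finset.sum_congr rfl fun i _ => hrew i
  rw [Finset.sum_sub_distrib] at hreg hv
  have h4 := mul_le_mul_of_nonneg_left hmain hMH.le
  unfold regretBound
  simp only [← hMdef, ← hJ, ← hx]
  have h5 : ∑ i ∈ Finset.range J, blockBound 𝓜 b c p δ (2 ^ (l : ℕ)) i =
    ∑ i ∈ Finset.range J, B i := rfl
  rw [h5]
  linarith

end Regret

section RegretProbability

variable {S : Type u} {A : Type v} [MeasurableSpace S] [MeasurableSpace A] {d H K : ℕ} {Ω : Type w}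
  {b c p δ η ε : ℝ} {𝓜 : LinearMDP S A d H K} {sel : ArgmaxRule A} {N : ℕ} {st : ℕ → ℕ → Ω → S}
  {ac : ℕ → ℕ → Ω → A} {arm : ℕ → Ω → Fin (numArms b d H K)} [Finite A] [MeasurableSingletonClass A]

variable [mΩ : MeasurableSpace Ω] {P : Measure Ω}
  {ℱ : Filtration ℕ (inferInstance : MeasurableSpace Ω)}

namespace IsAdaRun

lemma measurable_blockGain (hrun : IsAdaRun 𝓜 sel c b p P ℱ st ac arm) {i t : ℕ}
    (ht : tick H ((i + 1) * blockLen b d H K) 0 ≤ t) : Measurable[ℱ t] (blockGain 𝓜 b st ac i) := by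
  refine Measurable.div_const (m := ℱ t) (Finset.measurable_sum _ fun k hk =>
    Finset.measurable_sum _ fun h hh => ?_) _
  have hh' := Finset.mem_range.1 hh
  exact hrun.measurable_rw (lt_of_mem_block hk).2 hh'
    ((tick_le_tick (by omega) (lt_of_mem_block hk).1).trans ht)

lemma measurable_armProb (hrun : IsAdaRun 𝓜 sel c b p P ℱ st ac arm)
    (hM : 0 < blockLen b d H K) {i : ℕ} (hi : i < numBlocks b d H K) (l : Fin (numArms b d H K)) :
    Measurable[ℱ (tick H (i * blockLen b d H K) 0)] (armProb 𝓜 b st ac arm i l) := by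
  refine measurable_exp3pProb (m := ℱ _) _ _ (fun l => measurable_exp3pScore (m := ℱ _) _ _ _
    (fun j hj => ?_) (fun j hj => hrun.measurable_blockGain (tick_mono ?_ le_rfl)) l) l
  · refine (hrun.arm_measurable j (lt_of_lt_numBlocks hM (hj.trans hi))).mono (ℱ.mono ?_) le_rfl
    exact tick_le_tick (by omega) (Nat.mul_lt_mul_of_pos_right hj hM)
  · exact Nat.mul_le_mul_right _ hj

lemma measurable_guaranteedGain [Nonempty A]
    (hrun : IsAdaRun 𝓜 sel c b p P ℱ st ac arm) (W i : ℕ) :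
    Measurable[ℱ (tick H (i * blockLen b d H K) 0)] (guaranteedGain 𝓜 b c p δ st W i) := by
  refine Measurable.max (mδ := ℱ _) measurable_const (Measurable.div_const (m := ℱ _)
    (Measurable.sub_const (m := ℱ _) (Finset.measurable_sum _ fun k hk => ?_) _) _)
  obtain ⟨hk1, hk2⟩ := lt_of_mem_block hk
  have hdiv : k / blockLen b d H K = i := by
    refine Nat.div_eq_of_lt_le (Finset.mem_Ico.1 hk).1 hk1
  have := hrun.init_measurable k hk2
  rw [hdiv] at this
  exact (𝓜.measurable_optToGo hk2 le_rfl).comp this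

/-- The bias of EXP3-P makes up, with high probability, for the variance of the estimates of the
guaranteed gains of a fixed arm. -/
lemma measure_bias [Nonempty A] [IsProbabilityMeasure P]
    (hrun : IsAdaRun 𝓜 sel c b p P ℱ st ac arm)
    (hE : Exp3Params b d H K) (hw : 0 ≤ confWidth c p d H K) (hη : 0 < η)
    (l : Fin (numArms b d H K)) (W : ℕ) :
    P {ω | ¬ ∑ i ∈ Finset.range (numBlocks b d H K), (guaranteedGain 𝓜 b c p δ st W i ω -
      ((if arm i ω = l then 1 else 0) * guaranteedGain 𝓜 b c p δ st W i ω +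
        metaβ b d H K) / armProb 𝓜 b st ac arm i l ω) ≤ Real.log (1 / η) / metaβ b d H K} ≤
      ENNReal.ofReal η := by
  classical
  have hM := hE.blockLen_pos
  have hΔ : 0 < numArms b d H K := Nat.succ_pos _
  have hγ1 : metaγ b d H K ≤ 1 := hE.γ_le.trans (by norm_num)
  have hmono : Monotone fun i => ℱ (tick H (i * blockLen b d H K) 0) := fun i j hij =>
    ℱ.mono (tick_mono (Nat.mul_le_mul_right _ hij) le_rfl)
  have hI : ∀ i < numBlocks b d H K, Measurable[ℱ (tick H (i * blockLen b d H K) 1)]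
      fun ω => if arm i ω = l then (1 : ℝ) else 0 := fun i hi =>
    Measurable.ite (m := ℱ _) ((hrun.arm_measurable i (lt_of_lt_numBlocks hM hi))
      (measurableSet_singleton l)) measurable_const measurable_const
  refine (measure_mono fun ω hω => ?_).trans (measure_bias_lt_le (P := P)
    (m := fun i => ℱ (tick H (i * blockLen b d H K) 0)) (fun i => ℱ.le _) hmono hE.β_pos
    hE.β_le_one hη (div_pos hE.γ_pos (by exact_mod_cast hΔ : (0 : ℝ) < numArms b d H K))
    (G := guaranteedGain 𝓜 b c p δ st W) (u := fun i => armProb 𝓜 b st ac arm i l)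
    (I := fun i ω => if arm i ω = l then 1 else 0) (N := numBlocks b d H K)
    (fun i _ => hrun.measurable_guaranteedGain W i) (fun i _ ω => (guaranteedGain_mem hw W i).1)
    (fun i _ ω => (guaranteedGain_mem hw W i).2) (fun i hi => hrun.measurable_armProb hM hi l)
    (fun i _ ω => (exp3pProb_pos hΔ hE.γ_pos hγ1 _ l).1)
    (fun i _ ω => exp3pProb_le_one hΔ hE.γ_pos hγ1 _ l) (fun i hi => ?_) (fun i _ ω => ?_)
    (fun i hi => ?_))
  · exact not_le.1 hω
  · exact (hI i hi).mono (ℱ.mono (tick_le_tick (by omega)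
      (Nat.mul_lt_mul_of_pos_right (Nat.lt_succ_self i) hM))) le_rfl
  · split_ifs <;> simp
  · have hlaw := hrun.arm_law i (lt_of_lt_numBlocks hM hi) l
    have hind : (arm i ⁻¹' {l}).indicator (fun _ => (1 : ℝ)) =
        fun ω => if arm i ω = l then (1 : ℝ) else 0 := by
      ext ω
      simp [Set.indicator_apply]
    rw [hind] at hlaw
    refine condMeanZero_of_condExp (ℱ.le _) ?_ ?_ hlaw
    · refine Integrable.of_bound ((hI i hi).mono (ℱ.le _) le_rfl).aestronglyMeasurable 1
        (Filter.Eventually.of_forall fun ω => ?_)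
      split_ifs <;> simp
    · refine Integrable.of_bound ((hrun.measurable_armProb hM hi l).mono
        (ℱ.le _) le_rfl).aestronglyMeasurable 1 (Filter.Eventually.of_forall fun ω => ?_)
      rw [Real.norm_eq_abs, abs_le]
      have h1 := (exp3pProb_pos (α := metaα b d H K) hΔ hE.γ_pos hγ1
        (exp3pScore (metaα b d H K) (metaβ b d H K) (metaγ b d H K) (fun j => arm j ω)
          (fun j => blockGain 𝓜 b st ac j ω) i) l).2
      exact ⟨by unfold armProb; linarith, exp3pProb_le_one hΔ hE.γ_pos hγ1 _ l⟩

/-- High-probability bound on the dynamic regret against any fixed window. -/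
theorem measure_dynRegret_le [Nonempty A] [IsProbabilityMeasure P]
    (hrun : IsAdaRun 𝓜 sel c b p P ℱ st ac arm)
    (hP : ConfParams c p ε δ N d H K) (hE : Exp3Params b d H K) (hH : 1 ≤ H)
    (hδ : 0 < δ) (hδ1 : δ ≤ 1) (hη : 0 < η) (hη1 : η ≤ 1) (l : Fin (numArms b d H K))
    (hp : ((H * (K + 1) ^ 2 * (2 * N + 1) ^ (d + d * d) : ℕ) + (H * (K + 1) ^ 2 : ℕ) + H) * δ +
      η ≤ p) :
    ENNReal.ofReal (1 - p) ≤ P {ω | dynRegret 𝓜 sel c b p st ac arm ω ≤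
      regretBound 𝓜 b c p δ η (2 ^ (l : ℕ))} := by
  set E := {ω | dynRegret 𝓜 sel c b p st ac arm ω ≤ regretBound 𝓜 b c p δ η (2 ^ (l : ℕ))}
    with hEdef
  set B₁ := {ω | ¬ NetConcentrated 𝓜 c p ε δ N st ac ω}
  set B₂ := {ω | ¬ NoiseConcentrated 𝓜 c p δ st ac ω}
  set B₃ := {ω | ¬ ValueConcentrated 𝓜 sel c b p δ st ac arm ω}
  set B₄ := {ω | ¬ ∑ i ∈ Finset.range (numBlocks b d H K),
    (guaranteedGain 𝓜 b c p δ st (2 ^ (l : ℕ)) i ω -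
      ((if arm i ω = l then 1 else 0) * guaranteedGain 𝓜 b c p δ st (2 ^ (l : ℕ)) i ω +
        metaβ b d H K) / armProb 𝓜 b st ac arm i l ω) ≤ Real.log (1 / η) / metaβ b d H K}
  have hcover : (Set.univ : Set Ω) ⊆ E ∪ (B₁ ∪ B₂ ∪ B₃ ∪ B₄) := by
    intro ω _
    by_contra hcon
    simp only [Set.mem_union, not_or] at hcon
    obtain ⟨h0, ⟨⟨h1, h2⟩, h3⟩, h4⟩ := hcon
    exact h0 (dynRegret_le hP hE hH hδ hδ1 hη hη1 l (not_not.1 h1) (not_not.1 h2) (not_not.1 h3)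
      (fun k hk h hh => hrun.action_eq k hk h hh ω) (not_not.1 h4))
  have hbad : P (B₁ ∪ B₂ ∪ B₃ ∪ B₄) ≤ ENNReal.ofReal p := by
    have h1 := hrun.measure_not_netConcentrated (ε := ε) (N := N) hH hδ
    have h2 := hrun.measure_not_noiseConcentrated hH hδ
    have h3 := hrun.measure_not_valueConcentrated hH hδ
    have h4 := hrun.measure_bias hE hP.width_nonneg (δ := δ) hη l (2 ^ (l : ℕ))
    calc P (B₁ ∪ B₂ ∪ B₃ ∪ B₄) ≤ P B₁ + P B₂ + P B₃ + P B₄ :=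
          (measure_union_le _ _).trans (add_le_add ((measure_union_le _ _).trans
            (add_le_add (measure_union_le _ _) le_rfl)) le_rfl)
      _ ≤ _ := add_le_add (add_le_add (add_le_add h1 h2) h3) h4
      _ = ENNReal.ofReal (((H * (K + 1) ^ 2 * (2 * N + 1) ^ (d + d * d) : ℕ) +
          (H * (K + 1) ^ 2 : ℕ) + H) * δ + η) := by
          rw [← ENNReal.ofReal_add (by positivity) (by positivity),
            ← ENNReal.ofReal_add (by positivity) (by positivity),
            ← ENNReal.ofReal_add (by positivity) (by positivity)]
          congr 1
          ring
      _ ≤ _ := ENNReal.ofReal_le_ofReal hp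
  have hp0 : 0 ≤ p := le_trans (by positivity) hp
  rw [ENNReal.ofReal_sub _ hp0, ENNReal.ofReal_one, tsub_le_iff_right]
  calc (1 : ENNReal) = P Set.univ := measure_univ.symm
    _ ≤ P E + P (B₁ ∪ B₂ ∪ B₃ ∪ B₄) := (measure_mono hcover).trans (measure_union_le _ _)
    _ ≤ _ := add_le_add le_rfl hbad

end IsAdaRun

end RegretProbability

/-! ### Choice of the confidence parameters -/

section Parameters

variable {d H K : ℕ} {p c : ℝ}

lemma two_mul_le_div (hp : 0 < p) (hp1 : p < 1) :
    2 * (d * H * K : ℝ) ≤ 2 * d * totalSteps H K / p := by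
  rw [le_div_iff₀ hp, totalSteps]
  have : (0 : ℝ) ≤ d * H * K := by positivity
  nlinarith

lemma one_le_mul_mul (hd : 1 ≤ d) (hH : 1 ≤ H) (hK : 1 ≤ K) : (1 : ℝ) ≤ d * H * K := by
  have : 1 ≤ d * H * K := Nat.mul_pos (Nat.mul_pos hd hH) hK
  exact_mod_cast this

lemma half_le_log (hd : 1 ≤ d) (hH : 1 ≤ H) (hK : 1 ≤ K) (hp : 0 < p) (hp1 : p < 1) :
    1 / 2 ≤ Real.log (2 * d * totalSteps H K / p) := by
  have h1 := two_mul_le_div (d := d) (H := H) (K := K) hp hp1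
  have h2 := one_le_mul_mul hd hH hK
  have h3 := Real.log_le_log (by norm_num : (0 : ℝ) < 2)
    (by linarith : (2 : ℝ) ≤ 2 * d * totalSteps H K / p)
  linarith [Real.log_two_gt_d9]

lemma log_add_le (hd : 1 ≤ d) (hH : 1 ≤ H) (hK : 1 ≤ K) (hp : 0 < p) (hp1 : p < 1) {d' n : ℕ}
    (hd'0 : 1 ≤ d') (hd' : d' ≤ d) (hn : n ≤ K) :
    Real.log (d' + n) ≤ Real.log (2 * d * totalSteps H K / p) := by
  have h1 := two_mul_le_div (d := d) (H := H) (K := K) hp hp1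
  have h2 : d' + n ≤ 2 * (d * H * K) := by
    calc d' + n ≤ d + K := add_le_add hd' hn
      _ ≤ d * K + d * K :=
        add_le_add (Nat.le_mul_of_pos_right _ hK) (Nat.le_mul_of_pos_left _ hd)
      _ = 2 * (d * 1 * K) := by ring
      _ ≤ 2 * (d * H * K) := by gcongr
  have h3 : ((d' + n : ℕ) : ℝ) ≤ ((2 * (d * H * K) : ℕ) : ℝ) := by exact_mod_cast h2
  push_cast at h3
  refine Real.log_le_log ?_ (h3.trans h1)
  have : (1 : ℝ) ≤ d' := by exact_mod_cast hd'0
  positivity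

lemma log_mul_div_le (hd : 1 ≤ d) (hH : 1 ≤ H) (hK : 1 ≤ K) (hp : 0 < p) (hp1 : p < 1) :
    Real.log (4 * (H * (K + 1) ^ 2) / p) ≤ 8 * Real.log (2 * d * totalSteps H K / p) := by
  set X := 2 * d * totalSteps H K / p with hX
  have hL := half_le_log hd hH hK hp hp1
  have h2 := one_le_mul_mul hd hH hK
  have hd' : (1 : ℝ) ≤ d := by exact_mod_cast hd
  have hH' : (1 : ℝ) ≤ H := by exact_mod_cast hH
  have hK' : (1 : ℝ) ≤ K := by exact_mod_cast hK
  have hX2 : 2 * (d * H * K : ℝ) ≤ X := two_mul_le_div hp hp1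
  have hXpos : 0 < X := by linarith
  have hKX : (K : ℝ) ≤ X := by
    have h3 : (K : ℝ) ≤ d * H * K := le_mul_of_one_le_left (by positivity) (by nlinarith)
    linarith
  have hHK : H * K / p ≤ X := by
    rw [hX, totalSteps]
    refine div_le_div_of_nonneg_right ?_ hp.le
    have : (0 : ℝ) ≤ H * K := by positivity
    nlinarith
  have h1 : 4 * (H * ((K : ℝ) + 1) ^ 2) / p ≤ 16 * X ^ 2 := by
    calc 4 * (H * ((K : ℝ) + 1) ^ 2) / p ≤ 4 * (H * (2 * K : ℝ) ^ 2) / p := by gcongr; linarith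
      _ = 16 * ((H * K / p) * K) := by ring
      _ ≤ 16 * (X * X) := by gcongr
      _ = _ := by ring
  have h16 : Real.log 16 ≤ 3 := by
    rw [show (16 : ℝ) = 2 ^ 4 by norm_num, Real.log_pow]
    push_cast
    linarith [Real.log_two_lt_d9]
  calc _ ≤ Real.log (16 * X ^ 2) := Real.log_le_log (by positivity) h1
    _ = Real.log 16 + 2 * Real.log X := by
        rw [Real.log_mul (by norm_num) (by positivity), Real.log_pow]
        push_cast
        ring
    _ ≤ _ := by linarith

/-- The size of the net depends on the width `c` of the bonus, and the bonus has to cover the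
confidence radius of the net. This works for large `c`, since the radius grows only like
`√(log c)`. -/
lemma one_add_log_le {c : ℝ} (hc : 10000 ≤ c) : 9 + 20 * √(1 + Real.log c) ≤ c := by
  set s := √c with hs
  have hs100 : 100 ≤ s := Real.le_sqrt_of_sq_le (by linarith)
  have hsq : s ^ 2 = c := Real.sq_sqrt (by linarith)
  have hlog : Real.log c ≤ 2 * s - 2 := by
    rw [← hsq, Real.log_pow]
    have := Real.log_le_sub_one_of_pos (by linarith : 0 < s)
    push_cast
    linarith
  have : √(1 + Real.log c) ≤ s := Real.sqrt_le_sqrt (by nlinarith)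
  nlinarith

/-- Constant in the bound for the logarithm of the inverse confidence level: `log (1 / δ)` is at
most `confConst c * d ^ 2 * log (2 d T / p)`. -/
def confConst (c : ℝ) : ℝ := 48 * (1 + Real.log c)

/-- For `c ≥ 10000` the confidence bonus is wide enough. The concentration events fail with
probability at most `3 p / 4`, which leaves `p / 4` for the score of EXP3-P. -/
lemma exists_confParams (hd : 1 ≤ d) (hH : 1 ≤ H) (hK : 1 ≤ K) (hp : 0 < p) (hp1 : p < 1)
    (hc : 10000 ≤ c) : ∃ (ε δ : ℝ) (N : ℕ), ConfParams c p ε δ N d H K ∧ 0 < δ ∧ δ ≤ 1 ∧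
      ((H * (K + 1) ^ 2 * (2 * N + 1) ^ (d + d * d) : ℕ) + (H * (K + 1) ^ 2 : ℕ) + H) * δ +
        p / 4 ≤ p ∧
      Real.log (1 / δ) ≤ confConst c * d ^ 2 * Real.log (2 * d * totalSteps H K / p) := by
  set X := 2 * d * totalSteps H K / p with hX
  set L := Real.log X with hLdef
  have hL : 1 / 2 ≤ L := half_le_log hd hH hK hp hp1
  have hdHK := one_le_mul_mul hd hH hK
  have hd' : (1 : ℝ) ≤ d := by exact_mod_cast hd
  have hH' : (1 : ℝ) ≤ H := by exact_mod_cast hH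
  have hK' : (1 : ℝ) ≤ K := by exact_mod_cast hK
  have hX2 : 2 * (d * H * K : ℝ) ≤ X := two_mul_le_div hp hp1
  have hX1 : 1 ≤ X := by linarith
  have hlogc : 0 ≤ Real.log c := Real.log_nonneg (by linarith)
  set β := confWidth c p d H K with hβ
  have hβ0 : 0 ≤ β := by unfold β confWidth; positivity
  -- the step `ε` of the net is determined by `√ε = 1 / e`, which makes the error of the net at most
  -- `1 / K`
  set e : ℝ := 2 * d * K * (1 + β) with he
  have he1 : 1 ≤ e := one_le_mul_of_one_le_of_one_le
    (one_le_mul_of_one_le_of_one_le (by linarith) hK') (by linarith)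
  have he0 : 0 < e := by linarith
  set ε : ℝ := (1 / e) ^ 2 with hε
  have hε0 : 0 < ε := by positivity
  have hsqrt : √ε = 1 / e := Real.sqrt_sq (by positivity)
  set N : ℕ := ⌈2 * H * K / ε⌉₊ with hN
  -- the numbers of events in the union bounds
  set Z : ℕ := H * (K + 1) ^ 2 * (2 * N + 1) ^ (d + d * d) with hZ
  set Z' : ℕ := H * (K + 1) ^ 2 with hZ'
  have hZ'1 : 1 ≤ Z' := Nat.mul_pos hH (by positivity)
  have hHZ' : H ≤ Z' := Nat.le_mul_of_pos_right _ (by positivity)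
  have hZ'Z : Z' ≤ Z := Nat.le_mul_of_pos_right _ (by positivity)
  have hZ1 : (1 : ℝ) ≤ Z := by exact_mod_cast hZ'1.trans hZ'Z
  have hZZ' : (Z' : ℝ) ≤ Z := by exact_mod_cast hZ'Z
  have hHZ : (H : ℝ) ≤ Z := by exact_mod_cast hHZ'.trans hZ'Z
  set δ : ℝ := p / (4 * Z) with hδ
  have hδ0 : 0 < δ := by positivity
  have hZδ : Z * δ = p / 4 := by
    rw [hδ]
    field_simp
  have hβX : 1 + β ≤ 2 * (c * (d * H * K) * X) := by
    have hsL : √L ≤ X := by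
      rw [Real.sqrt_le_left (by linarith)]
      have : L ≤ X := (Real.log_le_sub_one_of_pos (by linarith)).trans (by linarith)
      exact this.trans (le_self_pow₀ hX1 two_ne_zero)
    have h1 : β ≤ c * (d * H * K) * X := by
      calc β = c * (d * H * 1) * √L := by simp only [hβ, confWidth, ← hX, ← hLdef]; ring
        _ ≤ c * (d * H * K) * X := by gcongr
    have h2 : 1 ≤ c * (d * H * K) * X := one_le_mul_of_one_le_of_one_le
      (one_le_mul_of_one_le_of_one_le (by linarith) hdHK) hX1
    linarith
  -- the size of the net is polynomial in `c` and `X` in every coordinate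
  have hNX : (2 * N + 1 : ℝ) ≤ 112 * c ^ 2 * X ^ 8 := by
    have hHKe : 1 ≤ H * K / ε := by
      rw [hε, one_div, inv_pow, div_inv_eq_mul]
      exact one_le_mul_of_one_le_of_one_le (one_le_mul_of_one_le_of_one_le hH' hK')
        (one_le_pow₀ he1)
    have h1 : (N : ℝ) < 2 * H * K / ε + 1 := Nat.ceil_lt_add_one (by positivity)
    have h2 : 2 * (H : ℝ) * K / ε = 2 * (H * K / ε) := by ring
    calc (2 * N + 1 : ℝ) ≤ 7 * (H * K / ε) := by linarith
      _ = 28 * (d * H * K) * (d * K) * K * (1 + β) ^ 2 := by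
          rw [hε, one_div, inv_pow, div_inv_eq_mul, he]
          ring
      _ ≤ 28 * (d * H * K) * (d * H * K) * (d * H * K) * (2 * (c * (d * H * K) * X)) ^ 2 := by
          have h3 : (d * K : ℝ) ≤ d * H * K := by
            gcongr
            exact le_mul_of_one_le_right (by linarith) hH'
          have h4 : (K : ℝ) ≤ d * H * K := le_mul_of_one_le_left (by linarith)
            (one_le_mul_of_one_le_of_one_le hd' hH')
          gcongr
      _ = 112 * c ^ 2 * ((d * H * K) ^ 5 * X ^ 2) := by ring
      _ ≤ 112 * c ^ 2 * (X ^ 5 * X ^ 3) := by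
          have h5 : (d * H * K : ℝ) ≤ X := by linarith
          gcongr
          norm_num
      _ = _ := by ring
  have hlogN : Real.log (2 * N + 1) ≤ (18 + 4 * Real.log c) * L := by
    have h112 : Real.log 112 ≤ 5 := by
      have : Real.log 112 ≤ Real.log (2 ^ 7) := Real.log_le_log (by norm_num) (by norm_num)
      rw [Real.log_pow] at this
      push_cast at this
      linarith [Real.log_two_lt_d9]
    have h1 := Real.log_le_log (by positivity) hNX
    rw [Real.log_mul (by positivity) (by positivity), Real.log_mul (by norm_num) (by positivity),
      Real.log_pow, Real.log_pow] at h1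
    push_cast at h1
    have := mul_le_mul_of_nonneg_left hL hlogc
    linarith
  have hι : Real.log (1 / δ) ≤ confConst c * d ^ 2 * L := by
    have h1 : 1 / δ = 4 * (H * ((K : ℝ) + 1) ^ 2) / p * (2 * N + 1 : ℝ) ^ (d + d * d) := by
      rw [hδ, hZ, hZ']
      push_cast
      field_simp
    have h2 := log_mul_div_le hd hH hK hp hp1
    rw [← hX, ← hLdef] at h2
    rw [h1, Real.log_mul (by positivity) (by positivity), Real.log_pow]
    have hdd : ((d + d * d : ℕ) : ℝ) ≤ 2 * d ^ 2 := by
      have : (d : ℝ) ≤ d * d := le_mul_of_one_le_left (by linarith) hd'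
      push_cast
      linarith
    calc Real.log (4 * (H * ((K : ℝ) + 1) ^ 2) / p) + (d + d * d : ℕ) * Real.log (2 * N + 1)
        ≤ 8 * L + 2 * d ^ 2 * ((18 + 4 * Real.log c) * L) := by
          have : 0 ≤ Real.log (2 * N + 1 : ℝ) := Real.log_nonneg (by
            have : (0 : ℝ) ≤ N := N.cast_nonneg
            linarith)
          gcongr
      _ ≤ d ^ 2 * (8 * L) + 2 * d ^ 2 * ((18 + 4 * Real.log c) * L) := by
          have : 8 * L ≤ d ^ 2 * (8 * L) :=
            le_mul_of_one_le_left (by linarith) (one_le_pow₀ hd')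
          linarith
      _ = (44 + 8 * Real.log c) * (d ^ 2 * L) := by ring
      _ ≤ (48 * (1 + Real.log c)) * (d ^ 2 * L) := by
          gcongr
          linarith
      _ = _ := by rw [confConst]; ring
  refine ⟨ε, δ, N, ⟨hd, hε0, ?_, ?_, ?_⟩, hδ0, ?_, ?_, hι⟩
  · have := Nat.le_ceil (2 * H * K / ε)
    rwa [div_le_iff₀ hε0] at this
  · have hβ1 : 1 + β ≠ 0 := by positivity
    have hd0 : (d : ℝ) ≠ 0 := by positivity
    have hK0 : (K : ℝ) ≠ 0 := by positivity
    rw [hsqrt, ← hβ]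
    have h1 : d * ε ≤ 1 / K * (1 / 2 * (1 / (1 + β))) := by
      calc d * ε = 1 / K * (1 / 2 * (1 / (1 + β))) * (1 / e) := by
            rw [hε, he]
            field_simp
        _ ≤ 1 / K * (1 / 2 * (1 / (1 + β))) * 1 := by
            gcongr
            exact div_le_one_of_le₀ he1 he0.le
        _ = _ := mul_one _
    have h2 : β * (d * (1 / e)) = 1 / K * (1 / 2 * (β / (1 + β))) := by
      rw [he]
      field_simp
    rw [h2]
    calc _ ≤ 1 / K * (1 / 2 * (1 / (1 + β))) + 1 / K * (1 / 2 * (β / (1 + β))) := by gcongr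
      _ = 1 / K * (1 / 2 * ((1 + β) / (1 + β))) := by ring
      _ ≤ 1 / K * 1 := by
          rw [div_self (by positivity)]
          gcongr
          norm_num
      _ = _ := mul_one _
  · have hrad : confRadius d K (2 * H) δ ≤ (20 * H * d * √L * √(1 + Real.log c)) ^ 2 := by
      have h1 := log_add_le hd hH hK hp hp1 hd le_rfl (le_refl K)
      rw [← hX, ← hLdef] at h1
      have hsq : (20 * H * d * √L * √(1 + Real.log c)) ^ 2 =
          400 * (H ^ 2 * d ^ 2 * L) * (1 + Real.log c) := by
        simp only [mul_pow]
        rw [Real.sq_sqrt (by linarith), Real.sq_sqrt (by linarith)]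
        ring
      rw [confRadius, hsq]
      calc (2 * H : ℝ) ^ 2 * (d * Real.log (d + K) + 2 * Real.log (1 / δ))
          ≤ (2 * H : ℝ) ^ 2 * (d * L + 2 * (confConst c * d ^ 2 * L)) := by gcongr
        _ ≤ (2 * H : ℝ) ^ 2 * (d ^ 2 * L + 2 * (confConst c * d ^ 2 * L)) := by
            gcongr
            exact le_self_pow₀ hd' two_ne_zero
        _ = 4 * (H ^ 2 * d ^ 2 * L) * (1 + 96 * (1 + Real.log c)) := by rw [confConst]; ring
        _ ≤ 4 * (H ^ 2 * d ^ 2 * L) * (100 * (1 + Real.log c)) := by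
            gcongr
            linarith
        _ = _ := by ring
    have hsL : 2 / 3 ≤ √L := Real.le_sqrt_of_sq_le (by linarith)
    have h1 := Real.sqrt_le_sqrt hrad
    rw [Real.sqrt_sq (by positivity)] at h1
    have hHd : 1 ≤ (H * d : ℝ) := one_le_mul_of_one_le_of_one_le hH' hd'
    calc 4 * H * d + (√(confRadius d K (2 * H) δ) + 2)
        ≤ 6 * (H * d) * 1 + 20 * H * d * √L * √(1 + Real.log c) := by linarith
      _ ≤ 6 * (H * d) * (3 / 2 * √L) + 20 * H * d * √L * √(1 + Real.log c) := by
          gcongr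
          linarith
      _ = (9 + 20 * √(1 + Real.log c)) * (d * H * √L) := by ring
      _ ≤ c * (d * H * √L) := by
          gcongr
          exact one_add_log_le hc
      _ = _ := by rw [confWidth]; ring
  · rw [hδ]
    exact div_le_one_of_le₀ (by linarith) (by positivity)
  · have h1 : (Z' : ℝ) * δ ≤ Z * δ := by gcongr
    have h2 : (H : ℝ) * δ ≤ Z * δ := by gcongr
    have : ((Z : ℝ) + Z' + H) * δ = Z * δ + Z' * δ + H * δ := by ring
    linarith

end Parameters

/-! ### Parameters of EXP3-P -/

section MetaParameters

variable {d H K : ℕ} {b p c δ : ℝ}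

/-- With sufficiently many blocks the parameters of EXP3-P are admissible, and its regret is of
order `√(number of blocks)`. -/
lemma exp3_params (hM : 0 < blockLen b d H K) (hΔ : 2 ≤ numArms b d H K)
    (hJ : 25 * (numArms b d H K : ℝ) ^ 2 < numBlocks b d H K) :
    Exp3Params b d H K ∧ ∀ x : ℝ, 0 ≤ x →
      2 * metaγ b d H K * numBlocks b d H K + x / metaβ b d H K +
        Real.log (numArms b d H K) / metaα b d H K +
          numBlocks b d H K * (numArms b d H K * metaβ b d H K) ≤
      √(numBlocks b d H K : ℝ) * (5 * numArms b d H K + 2 * x * √(numArms b d H K : ℝ)) := by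
  have hα : metaα b d H K = 0.95 * metaβ b d H K := rfl
  have hβ : metaβ b d H K =
    √(Real.log (numArms b d H K) / (numBlocks b d H K * numArms b d H K)) := rfl
  have hγ : metaγ b d H K = min 1 (1.05 *
    √(numArms b d H K * Real.log (numArms b d H K) / numBlocks b d H K)) := rfl
  set α := metaα b d H K
  set β := metaβ b d H K
  set γ := metaγ b d H K
  have hΔ' : (2 : ℝ) ≤ numArms b d H K := by exact_mod_cast hΔ
  set Δ : ℝ := (numArms b d H K : ℝ)
  set J : ℝ := (numBlocks b d H K : ℝ)
  have hΔ0 : 0 < Δ := by linarith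
  have hJ0 : 0 < J := lt_trans (by positivity) hJ
  set y := Real.log Δ with hy
  have hy1 : 1 / 2 ≤ y := by
    have := Real.log_le_log (by norm_num) hΔ'
    linarith [Real.log_two_gt_d9]
  have hyΔ : y ≤ Δ := (Real.log_le_sub_one_of_pos hΔ0).trans (by linarith)
  -- `r` is the common scale: `β = r / Δ`, `α = 0.95 r / Δ` and `γ = 1.05 r`; the cap on `γ` is
  -- inactive
  set r := √(Δ * y / J) with hr
  have hr0 : 0 < r := Real.sqrt_pos.2 (by positivity)
  have hr2 : r ^ 2 = Δ * y / J := Real.sq_sqrt (by positivity)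
  have hr5 : r ≤ 1 / 5 := by
    refine Real.sqrt_le_iff.2 ⟨by norm_num, ?_⟩
    rw [div_le_iff₀ hJ0]
    nlinarith
  have hβr : β = r / Δ := by
    rw [hβ, hr, eq_div_iff hΔ0.ne']
    nth_rewrite 2 [← Real.sqrt_sq hΔ0.le]
    rw [← Real.sqrt_mul (by positivity)]
    congr 1
    field_simp
  have hγr : γ = 1.05 * r := by
    rw [hγ, min_eq_right]
    linarith
  have hβ0 : 0 < β := by rw [hβr]; positivity
  have hβ10 : β ≤ 1 / 10 := by
    rw [hβr, div_le_iff₀ hΔ0]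
    linarith
  have hβΔ : β * Δ = r := by rw [hβr, div_mul_cancel₀ _ hΔ0.ne']
  have hrJ : r * √J ≤ Δ := by
    rw [hr, ← Real.sqrt_mul (by positivity), div_mul_cancel₀ _ hJ0.ne']
    refine Real.sqrt_le_iff.2 ⟨hΔ0.le, ?_⟩
    nlinarith
  have hsJ : √J * √J = J := Real.mul_self_sqrt hJ0.le
  have hα0 : 0 < α := by rw [hα]; positivity
  have hγ0 : 0 < γ := by rw [hγr]; positivity
  have hαγ : α * (1 + β) * Δ ≤ γ := by
    rw [hα, hγr]
    calc 0.95 * β * (1 + β) * Δ = 0.95 * (1 + β) * r := by rw [← hβΔ]; ring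
      _ ≤ 0.95 * (1 + 1 / 10) * r := by gcongr
      _ ≤ _ := by linarith
  refine ⟨⟨hM, hα0, hβ0, by linarith, hγ0, by linarith, hαγ⟩, fun x hx => ?_⟩
  have h1 : y / α ≤ 1.1 * (r * J) := by
    have : y = β * (r * J) := by
      have h2 : r ^ 2 * J = Δ * y := by rw [hr2, div_mul_cancel₀ _ hJ0.ne']
      have h3 : Δ * y = Δ * (β * (r * J)) := by
        rw [← h2, ← hβΔ]
        ring
      exact mul_left_cancel₀ hΔ0.ne' h3
    rw [hα, div_le_iff₀ (by positivity)]
    calc y = 1 * (β * (r * J)) := by rw [one_mul]; exact this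
      _ ≤ (1.1 * 0.95) * (β * (r * J)) := by
          gcongr
          norm_num
      _ = _ := by ring
  have h2 : r * J ≤ √J * Δ := by
    calc r * J = √J * (r * √J) := by rw [mul_left_comm, hsJ]
      _ ≤ _ := by gcongr
  have h3 : x / β ≤ √J * (2 * x * √Δ) := by
    rw [div_le_iff₀ hβ0]
    have h4 : 1 ≤ √J * √Δ * 2 * β := by
      have h5 : 1 / 4 ≤ (√J * √Δ * β) ^ 2 := by
        rw [mul_pow, mul_pow, Real.sq_sqrt hJ0.le, Real.sq_sqrt hΔ0.le, hβ,
          Real.sq_sqrt (by positivity), mul_div_cancel₀ _ (by positivity)]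
        linarith
      have h6 : 1 / 2 ≤ √J * √Δ * β := by
        refine (pow_le_pow_iff_left₀ (by norm_num) (by positivity) two_ne_zero).1 ?_
        linarith
      linarith
    calc x = x * 1 := (mul_one x).symm
      _ ≤ x * (√J * √Δ * 2 * β) := by gcongr
      _ = _ := by ring
  have h4 : J * (Δ * β) = r * J := by rw [mul_comm Δ, hβΔ, mul_comm]
  have h5 : 0 ≤ √J * Δ := by positivity
  rw [h4, hγr]
  linarith

/-- The number of window sizes is logarithmic. -/
lemma numArms_le (hb : 1 ≤ b) (hd : 1 ≤ d) (hH : 1 ≤ H) (hK : 1 ≤ K) (hp : 0 < p) (hp1 : p < 1)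
    (hM0 : 0 < blockLen b d H K) (hM : (blockLen b d H K : ℝ) ≤ 2 * b * (d * H * K)) :
    (numArms b d H K : ℝ) ≤ 6 * b * Real.log (2 * d * totalSteps H K / p) := by
  set X := 2 * d * totalSteps H K / p with hX
  set L := Real.log X with hLdef
  have hL : 1 / 2 ≤ L := half_le_log hd hH hK hp hp1
  have hdHK := one_le_mul_mul hd hH hK
  have hX2 : 2 * (d * H * K : ℝ) ≤ X := two_mul_le_div hp hp1
  have hMX : (blockLen b d H K : ℝ) ≤ b * X := by
    refine hM.trans ?_
    rw [mul_comm 2 b, mul_assoc]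
    gcongr
  have h1 : ((2 ^ Nat.log 2 (blockLen b d H K) : ℕ) : ℝ) ≤ b * X :=
    le_trans (by exact_mod_cast Nat.pow_log_le_self 2 hM0.ne') hMX
  have h2 := Real.log_le_log (by positivity) h1
  push_cast at h2
  rw [Real.log_pow, Real.log_mul (by linarith) (by linarith)] at h2
  have h3 := Real.log_le_sub_one_of_pos (by linarith : 0 < b)
  have h4 : (Nat.log 2 (blockLen b d H K) : ℝ) * (1 / 2) ≤
      Nat.log 2 (blockLen b d H K) * Real.log 2 := by
    gcongr
    linarith [Real.log_two_gt_d9]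
  have h5 : b * (1 / 2) ≤ b * L := by gcongr
  have h6 : 1 * L ≤ b * L := by gcongr
  rw [numArms]
  push_cast
  linarith

end MetaParameters

/-! ### Size of the regret bound -/

section Size

variable {S : Type u} {A : Type v} [MeasurableSpace S] [MeasurableSpace A] {d H K : ℕ}
  {b p c δ : ℝ}

/-- The size of the regret is estimated in terms of the fourth roots `a, h, k, q` of `d, H, K, B_θ +
B_μ + 1`, so that only natural powers occur; the target is `q * a ^ 5 * h ^ 8 * k ^ 3`. -/
lemma exists_pow_four_eq {x : ℝ} (hx : 1 ≤ x) : ∃ y : ℝ, 1 ≤ y ∧ y ^ 4 = x :=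
  ⟨√(√x), Real.one_le_sqrt.2 (Real.one_le_sqrt.2 hx), by
    rw [show (√(√x)) ^ 4 = ((√(√x)) ^ 2) ^ 2 by ring, Real.sq_sqrt (Real.sqrt_nonneg _),
      Real.sq_sqrt (by linarith)]⟩

/-- The deviation of a sum of `n` noise terms is of order `H d √n`; the factor `d` comes from the
size of the net in the union bound. -/
lemma sumRadius_le (hd : 1 ≤ d) (hH : 1 ≤ H) (hK : 1 ≤ K) (hp : 0 < p) (hp1 : p < 1)
    {D : ℝ} (hD : 1 ≤ D)
    (hι : Real.log (1 / δ) ≤ D * d ^ 2 * Real.log (2 * d * totalSteps H K / p)) {n : ℕ}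
    (hn0 : 1 ≤ n) (hn : n ≤ K) :
    sumRadius n (2 * H) δ ≤
      24 * D * Real.log (2 * d * totalSteps H K / p) * (H * d) * √(n : ℝ) := by
  have hlog := log_add_le hd hH hK hp hp1 le_rfl hd hn
  have hL := half_le_log hd hH hK hp hp1
  set L := Real.log (2 * d * totalSteps H K / p) with hLdef
  have hd' : (1 : ℝ) ≤ d := by exact_mod_cast hd
  have hn' : (1 : ℝ) ≤ n := by exact_mod_cast hn0
  have hDL : 1 / 2 ≤ D * L := by nlinarith
  refine Real.sqrt_le_iff.2 ⟨by positivity, ?_⟩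
  rw [mul_pow, Real.sq_sqrt (by positivity), confRadius]
  calc (1 + n : ℝ) * ((2 * H) ^ 2 * ((1 : ℕ) * Real.log ((1 : ℕ) + n) + 2 * Real.log (1 / δ)))
      ≤ (1 + n) * ((2 * H) ^ 2 * (D * d ^ 2 * L + 2 * (D * d ^ 2 * L))) := by
        have h1 : L ≤ D * d ^ 2 * L := le_mul_of_one_le_left (by linarith)
          (one_le_mul_of_one_le_of_one_le hD (one_le_pow₀ hd'))
        refine mul_le_mul_of_nonneg_left (mul_le_mul_of_nonneg_left ?_ (by positivity))
          (by positivity)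
        rw [Nat.cast_one, one_mul]
        rw [Nat.cast_one] at hlog
        linarith
    _ ≤ (n + n) * ((2 * H) ^ 2 * (D * d ^ 2 * L + 2 * (D * d ^ 2 * L))) := by gcongr
    _ = 1 / 2 * (48 * (D * L) * (H * d) ^ 2 * n) := by ring
    _ ≤ (D * L) * (48 * (D * L) * (H * d) ^ 2 * n) := by gcongr
    _ ≤ (D * L) * (576 * (D * L) * (H * d) ^ 2 * n) := by
        gcongr
        norm_num
    _ = _ := by ring

/-- The statistical error of an epoch of `n` episodes is of order `H² d^(3/2) √n`. -/
lemma epochStat_le (hd : 1 ≤ d) (hH : 1 ≤ H) (hK : 1 ≤ K) (hp : 0 < p) (hp1 : p < 1)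
    (hc : 0 ≤ c) {D : ℝ} (hD : 1 ≤ D)
    (hι : Real.log (1 / δ) ≤ D * d ^ 2 * Real.log (2 * d * totalSteps H K / p)) {n : ℕ}
    (hn0 : 1 ≤ n) (hn : n ≤ K) {a : ℝ} (ha : 1 ≤ a) (had : a ^ 4 = d) :
    epochStat c p δ n d H K ≤ (3 * c + 24 * D) * Real.log (2 * d * totalSteps H K / p) *
      (H ^ 2 * a ^ 6) * √(n : ℝ) := by
  have hlog := log_add_le hd hH hK hp hp1 hd le_rfl hn
  have hrad := sumRadius_le hd hH hK hp hp1 hD hι hn0 hn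
  have hL := half_le_log hd hH hK hp hp1
  rw [epochStat, confWidth]
  set L := Real.log (2 * d * totalSteps H K / p) with hLdef
  have h1 : √(n * (2 * (d * Real.log (d + n)))) ≤ √(n : ℝ) * (3 / 2 * (a ^ 2 * √L)) := by
    refine Real.sqrt_le_iff.2 ⟨by positivity, ?_⟩
    rw [mul_pow, mul_pow, mul_pow, Real.sq_sqrt (by positivity), Real.sq_sqrt (by linarith),
      ← pow_mul, had]
    calc (n : ℝ) * (2 * (d * Real.log (d + n))) ≤ n * (2 * (d * L)) := by gcongr
      _ ≤ n * ((3 / 2) ^ 2 * (d * L)) := by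
          gcongr
          norm_num
  have hLL : √L * √L = L := Real.mul_self_sqrt (by linarith)
  calc _ ≤ H * (2 * (c * d * H * √L) * (√(n : ℝ) * (3 / 2 * (a ^ 2 * √L))) +
        24 * D * L * (H * d) * √(n : ℝ)) := by gcongr
    _ = 3 * c * (√L * √L) * H ^ 2 * (a ^ 2 * d) * √(n : ℝ) +
        24 * D * L * H ^ 2 * d * √(n : ℝ) := by ring
    _ = 3 * c * L * H ^ 2 * a ^ 6 * √(n : ℝ) + 24 * D * L * H ^ 2 * a ^ 4 * √(n : ℝ) := by
        rw [hLL, ← had]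
        ring
    _ ≤ 3 * c * L * H ^ 2 * a ^ 6 * √(n : ℝ) + 24 * D * L * H ^ 2 * a ^ 6 * √(n : ℝ) := by
        have : a ^ 4 ≤ a ^ 6 := pow_le_pow_right₀ ha (by norm_num)
        gcongr
    _ = _ := by ring

/-- A block has about `b H √(d K)` episodes. -/
lemma blockLen_bounds (hb : 1 ≤ b) {a h k : ℝ} (ha : 1 ≤ a) (hh : 1 ≤ h) (hk : 1 ≤ k)
    (had : a ^ 4 = d) (hhH : h ^ 4 = H) (hkK : k ^ 4 = K) :
    b * (h ^ 4 * a ^ 2 * k ^ 2) ≤ blockLen b d H K ∧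
      (blockLen b d H K : ℝ) ≤ 2 * b * (h ^ 4 * a ^ 2 * k ^ 2) := by
  have hsqrt : √((d : ℝ) * H * totalSteps H K) = h ^ 4 * a ^ 2 * k ^ 2 := by
    rw [totalSteps, ← had, ← hhH, ← hkK, show a ^ 4 * h ^ 4 * (k ^ 4 * h ^ 4) =
      (h ^ 4 * a ^ 2 * k ^ 2) ^ 2 by ring, Real.sqrt_sq (by positivity)]
  have h1 : 1 ≤ b * (h ^ 4 * a ^ 2 * k ^ 2) :=
    one_le_mul_of_one_le_of_one_le hb (one_le_mul_of_one_le_of_one_le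
      (one_le_mul_of_one_le_of_one_le (one_le_pow₀ hh) (one_le_pow₀ ha)) (one_le_pow₀ hk))
  rw [blockLen, hsqrt]
  refine ⟨Nat.le_ceil _, ?_⟩
  have := Nat.ceil_lt_add_one (a := b * (h ^ 4 * a ^ 2 * k ^ 2)) (by linarith)
  linarith

end Size

/-! ### Tuning the window -/

section Tuning

variable {S : Type u} {A : Type v} [MeasurableSpace S] [MeasurableSpace A] {d H K : ℕ}
  {b p c δ : ℝ}

lemma varμ_nonneg (𝓜 : LinearMDP S A d H K) : 0 ≤ 𝓜.varμ :=
  Finset.sum_nonneg fun _ _ => Finset.sum_nonneg fun _ _ => LinearMDP.variationNorm_nonneg _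

lemma varθ_nonneg (𝓜 : LinearMDP S A d H K) : 0 ≤ 𝓜.varθ :=
  Finset.sum_nonneg fun _ _ => Finset.sum_nonneg fun _ _ => norm_nonneg _

lemma log_four_div_le (hd : 1 ≤ d) (hH : 1 ≤ H) (hK : 1 ≤ K) (hp : 0 < p) (hp1 : p < 1) :
    0 ≤ Real.log (1 / (p / 4)) ∧
      Real.log (1 / (p / 4)) ≤ 3 * Real.log (2 * d * totalSteps H K / p) := by
  have hdHK := one_le_mul_mul hd hH hK
  have hL := half_le_log hd hH hK hp hp1
  have h1 : 1 / (p / 4) ≤ 2 * (2 * d * totalSteps H K / p) := by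
    rw [one_div_div, totalSteps, ← mul_div_assoc]
    refine div_le_div_of_nonneg_right ?_ hp.le
    linarith
  have hX : 2 * d * totalSteps H K / p ≠ 0 := by
    have := two_mul_le_div (d := d) (H := H) (K := K) hp hp1
    linarith
  refine ⟨Real.log_nonneg ?_, ?_⟩
  · rw [one_div_div, le_div_iff₀ hp]
    linarith
  · have h2 := Real.log_le_log (by positivity) h1
    rw [Real.log_mul two_ne_zero hX] at h2
    linarith [Real.log_two_lt_d9]

/-- Powers of the fourth roots occurring in the bounds are compared with
`d^{5/4} H^{5/4} T^{3/4} (B + 1)^{1/4}`. -/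
lemma mul_pow_le {a h k q : ℝ} (ha : 1 ≤ a) (hh : 1 ≤ h) (hk : 1 ≤ k) (hq : 1 ≤ q)
    {i j l n : ℕ} (hi : i ≤ 1) (hj : j ≤ 5) (hl : l ≤ 8) (hn : n ≤ 3) :
    q ^ i * a ^ j * h ^ l * k ^ n ≤ q * a ^ 5 * h ^ 8 * k ^ 3 := by
  have h1 := pow_le_pow_right₀ hq hi
  have h2 := pow_le_pow_right₀ ha hj
  have h3 := pow_le_pow_right₀ hh hl
  have h4 := pow_le_pow_right₀ hk hn
  rw [pow_one] at h1
  gcongr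

/-- The grid contains a window of about `x` episodes. -/
lemma exists_window_length {x : ℝ} (hx : 1 ≤ x) {M : ℕ} (hxM : x ≤ M) :
    ∃ l, l ≤ Nat.log 2 M ∧ 2 ^ l ≤ M ∧ ((2 ^ l : ℕ) : ℝ) ≤ x ∧ x ≤ 2 * ((2 ^ l : ℕ) : ℝ) := by
  have hfl : 1 ≤ ⌊x⌋₊ := Nat.le_floor (by simpa using hx)
  have hflM : ⌊x⌋₊ ≤ M := Nat.floor_le_of_le hxM
  have h1 : 2 ^ Nat.log 2 ⌊x⌋₊ ≤ ⌊x⌋₊ := Nat.pow_log_le_self 2 (by omega)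
  refine ⟨Nat.log 2 ⌊x⌋₊, Nat.log_mono_right hflM, h1.trans hflM,
    le_trans (by exact_mod_cast h1) (Nat.floor_le (by linarith)), ?_⟩
  have h2 := Nat.lt_pow_succ_log_self (b := 2) (by norm_num) ⌊x⌋₊
  have h3 : ((⌊x⌋₊ + 1 : ℕ) : ℝ) ≤ ((2 ^ (Nat.log 2 ⌊x⌋₊ + 1) : ℕ) : ℝ) := by exact_mod_cast h2
  have h4 := Nat.lt_floor_add_one x
  push_cast [pow_succ] at h3 ⊢
  linarith

/-- If there are at least two blocks, rounding up their number costs at most a factor `2`. -/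
lemma numBlocks_mul_le (hM : 0 < blockLen b d H K) (hJ : 2 ≤ numBlocks b d H K) :
    (numBlocks b d H K : ℝ) * blockLen b d H K ≤ 2 * K ∧ blockLen b d H K ≤ K := by
  have hM' : (0 : ℝ) < blockLen b d H K := by exact_mod_cast hM
  have hJ' : (2 : ℝ) ≤ numBlocks b d H K := by exact_mod_cast hJ
  have h1 : (numBlocks b d H K : ℝ) < K / blockLen b d H K + 1 :=
    Nat.ceil_lt_add_one (by positivity)
  have h2 : (numBlocks b d H K : ℝ) * blockLen b d H K ≤ 2 * K := by
    calc (numBlocks b d H K : ℝ) * blockLen b d H K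
        ≤ 2 * (K / blockLen b d H K) * blockLen b d H K := by
          gcongr
          linarith
      _ = 2 * K := by field_simp
  refine ⟨h2, ?_⟩
  have h3 : (2 : ℝ) * blockLen b d H K ≤ 2 * K := le_trans (by gcongr) h2
  exact_mod_cast (by linarith : (blockLen b d H K : ℝ) ≤ K)

lemma blockLen_pos (hb : 1 ≤ b) {a h k : ℝ} (ha : 1 ≤ a) (hh : 1 ≤ h) (hk : 1 ≤ k)
    (had : a ^ 4 = d) (hhH : h ^ 4 = H) (hkK : k ^ 4 = K) : 0 < blockLen b d H K := by
  have h1 : (1 : ℝ) ≤ blockLen b d H K := le_trans (one_le_mul_of_one_le_of_one_le hb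
    (one_le_mul_of_one_le_of_one_le (one_le_mul_of_one_le_of_one_le (one_le_pow₀ hh)
      (one_le_pow₀ ha)) (one_le_pow₀ hk))) (blockLen_bounds hb ha hh hk had hhH hkK).1
  exact_mod_cast (by linarith : (0 : ℝ) < blockLen b d H K)

lemma numArms_le_log (hd : 1 ≤ d) (hH : 1 ≤ H) (hK : 1 ≤ K) (hp : 0 < p) (hp1 : p < 1)
    (hb : 1 ≤ b) {a h k : ℝ} (ha : 1 ≤ a) (hh : 1 ≤ h) (hk : 1 ≤ k)
    (had : a ^ 4 = d) (hhH : h ^ 4 = H) (hkK : k ^ 4 = K) :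
    (numArms b d H K : ℝ) ≤ 6 * b * Real.log (2 * d * totalSteps H K / p) := by
  refine numArms_le hb hd hH hK hp hp1 (blockLen_pos hb ha hh hk had hhH hkK)
    ((blockLen_bounds hb ha hh hk had hhH hkK).2.trans ?_)
  have h1 := pow_le_pow_right₀ ha (by norm_num : 2 ≤ 4)
  have h2 := pow_le_pow_right₀ hk (by norm_num : 2 ≤ 4)
  rw [← had, ← hhH, ← hkK, mul_comm (h ^ 4)]
  gcongr

/-- Arithmetic behind `exp3_regret_le`. -/
lemma exp3_arith {M J Δ L x E b a h k q : ℝ} (hM : 0 ≤ M) (hJ : 0 ≤ J) (hΔ : 2 ≤ Δ) (hL : 1 / 2 ≤ L)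
    (hx : x ≤ 3 * L) (hb : 1 ≤ b) (ha : 1 ≤ a) (hh : 1 ≤ h) (hk : 1 ≤ k) (hq : 1 ≤ q)
    (hΔL : Δ ≤ 6 * b * L) (hMhi : M ≤ 2 * b * (h ^ 4 * a ^ 2 * k ^ 2)) (hJM : J * M ≤ 2 * k ^ 4)
    (hE : E ≤ √J * (5 * Δ + 2 * x * √Δ)) :
    M * h ^ 4 * E ≤ 192 * b ^ 2 * L ^ 2 * (q * a ^ 5 * h ^ 8 * k ^ 3) := by
  have h2 : M * √J ≤ 2 * b * (k ^ 3 * h ^ 2 * a) := by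
    refine (pow_le_pow_iff_left₀ (by positivity) (by positivity) two_ne_zero).1 ?_
    rw [mul_pow, Real.sq_sqrt (by positivity)]
    calc M ^ 2 * J = M * (J * M) := by ring
      _ ≤ (2 * b * (h ^ 4 * a ^ 2 * k ^ 2)) * (2 * k ^ 4) := by gcongr
      _ = 4 * (b * 1) * (k ^ 3 * h ^ 2 * a) ^ 2 := by ring
      _ ≤ 4 * (b * b) * (k ^ 3 * h ^ 2 * a) ^ 2 := by gcongr
      _ = _ := by ring
  have h3 : √Δ ≤ Δ := Real.sqrt_le_iff.2 ⟨by linarith, by nlinarith⟩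
  have h4 := mul_pow_le ha hh hk hq (i := 0) (j := 1) (l := 6) (n := 3) (by norm_num)
    (by norm_num) (by norm_num) (by norm_num)
  have h5 : 5 * Δ + 2 * x * √Δ ≤ 16 * L * Δ := by
    calc 5 * Δ + 2 * x * √Δ ≤ 5 * Δ + 2 * (3 * L) * Δ := by gcongr
      _ ≤ 10 * L * Δ + 2 * (3 * L) * Δ := by
          gcongr
          linarith
      _ = _ := by ring
  calc M * h ^ 4 * E ≤ M * h ^ 4 * (√J * (16 * L * Δ)) := by
        gcongr
        exact hE.trans (by gcongr)
    _ = (M * √J) * h ^ 4 * (16 * L * Δ) := by ring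
    _ ≤ (2 * b * (k ^ 3 * h ^ 2 * a)) * h ^ 4 * (16 * L * (6 * b * L)) := by gcongr
    _ = 192 * b ^ 2 * L ^ 2 * (q ^ 0 * a ^ 1 * h ^ 6 * k ^ 3) := by ring
    _ ≤ _ := by gcongr

/-- The regret of EXP3-P is of the target order. -/
lemma exp3_regret_le (hd : 1 ≤ d) (hH : 1 ≤ H) (hK : 1 ≤ K) (hp : 0 < p) (hp1 : p < 1)
    (hb : 1 ≤ b) {a h k q : ℝ} (ha : 1 ≤ a) (hh : 1 ≤ h) (hk : 1 ≤ k) (hq : 1 ≤ q)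
    (had : a ^ 4 = d) (hhH : h ^ 4 = H) (hkK : k ^ 4 = K)
    (hΔ : 2 ≤ numArms b d H K) (hJ : 25 * (numArms b d H K : ℝ) ^ 2 < numBlocks b d H K)
    (hJM : (numBlocks b d H K : ℝ) * blockLen b d H K ≤ 2 * K) :
    blockLen b d H K * H * (2 * metaγ b d H K * numBlocks b d H K +
      Real.log (1 / (p / 4)) / metaβ b d H K + Real.log (numArms b d H K) / metaα b d H K +
        numBlocks b d H K * (numArms b d H K * metaβ b d H K)) ≤
      192 * b ^ 2 * Real.log (2 * d * totalSteps H K / p) ^ 2 * (q * a ^ 5 * h ^ 8 * k ^ 3) := by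
  have hL := half_le_log hd hH hK hp hp1
  obtain ⟨hx0, hx⟩ := log_four_div_le hd hH hK hp hp1
  have hΔ' : (2 : ℝ) ≤ numArms b d H K := by exact_mod_cast hΔ
  rw [← hhH]
  exact exp3_arith (Nat.cast_nonneg _) (Nat.cast_nonneg _) hΔ' hL hx hb ha hh hk hq
    (numArms_le_log hd hH hK hp hp1 hb ha hh hk had hhH hkK)
    (blockLen_bounds hb ha hh hk had hhH hkK).2 (hJM.trans_eq (by rw [hkK]))
    ((exp3_params (blockLen_pos hb ha hh hk had hhH hkK) hΔ hJ).2 _ hx0)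

/-- The regret caused by the drift is of the target order. -/
lemma drift_regret_le (𝓜 : LinearMDP S A d H K) (hH : 1 ≤ H)
    {a h k q z y : ℝ} (ha : 1 ≤ a) (hh : 1 ≤ h) (hk : 1 ≤ k) (hq : 1 ≤ q)
    (hhH : h ^ 4 = H) (hqB : q ^ 4 = 𝓜.varθ + 𝓜.varμ + 1) (hzq : z * q = k * a * h)
    (hy : 0 ≤ y) (hyz : y ≤ z) {n : ℝ} (hnz : n ≤ z ^ 2) :
    2 * n * y * (𝓜.varθ + 2 * H * 𝓜.varμ) ≤ 4 * (q * a ^ 5 * h ^ 8 * k ^ 3) := by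
  have h1 : 𝓜.varθ + 2 * H * 𝓜.varμ ≤ 2 * (h ^ 4 * q ^ 4) := by
    rw [hhH, hqB]
    have hH' : (1 : ℝ) ≤ H := by exact_mod_cast hH
    have := mul_le_mul_of_nonneg_right hH' (varθ_nonneg 𝓜)
    have := varθ_nonneg 𝓜
    linarith
  have h2 := mul_pow_le ha hh hk hq (i := 1) (j := 3) (l := 7) (n := 3) (by norm_num)
    (by norm_num) (by norm_num) (by norm_num)
  have h3 : 0 ≤ 𝓜.varθ + 2 * H * 𝓜.varμ := by
    have := varθ_nonneg 𝓜
    have := varμ_nonneg 𝓜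
    positivity
  have hz : 0 ≤ z := hy.trans hyz
  calc _ ≤ 2 * z ^ 2 * z * (2 * (h ^ 4 * q ^ 4)) := by gcongr
    _ = 4 * ((z * q) ^ 3 * h ^ 4 * q) := by ring
    _ = 4 * (q ^ 1 * a ^ 3 * h ^ 7 * k ^ 3) := by rw [hzq]; ring
    _ ≤ _ := by gcongr

/-- The statistical error of all epochs is of the target order. -/
lemma stat_regret_le {J M n L E F h a k q y z : ℝ} (hJ : 0 ≤ J) (hn : 0 < n)
    (hJM : J * M ≤ 2 * k ^ 4) (hnM : n ≤ M) {r : ℕ} (hr : (r : ℝ) ≤ M / n) (hE : 0 ≤ E) (hL : 0 ≤ L)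
    (ha : 1 ≤ a) (hh : 1 ≤ h) (hk : 1 ≤ k) (hq : 1 ≤ q)
    (hF : F ≤ E * L * ((h ^ 4) ^ 2 * a ^ 6) * y) (hy : 0 < y) (hy2 : y ^ 2 = n)
    (hzq : z * q = k * a * h) (hzy : z ≤ 2 * y) :
    J * (((r + 1 : ℕ) : ℝ) * F) ≤ 8 * E * L * (q * a ^ 5 * h ^ 8 * k ^ 3) := by
  have h1 : ((r + 1 : ℕ) : ℝ) ≤ 2 * (M / n) := by
    have h3 : (1 : ℝ) ≤ M / n := by rwa [le_div_iff₀ hn, one_mul]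
    push_cast
    linarith
  have h3 : k * a ≤ 2 * q * y := by
    calc k * a ≤ k * a * h := le_mul_of_one_le_right (by positivity) hh
      _ = z * q := hzq.symm
      _ ≤ 2 * y * q := by gcongr
      _ = _ := by ring
  calc _ ≤ J * (((r + 1 : ℕ) : ℝ) * (E * L * ((h ^ 4) ^ 2 * a ^ 6) * y)) := by gcongr
    _ ≤ J * ((2 * (M / n)) * (E * L * ((h ^ 4) ^ 2 * a ^ 6) * y)) := by gcongr
    _ = (J * M) * (2 * E * L * (h ^ 8 * a ^ 6) * (y / n)) := by ring
    _ ≤ (2 * k ^ 4) * (2 * E * L * (h ^ 8 * a ^ 6) * (y / n)) := by gcongr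
    _ = 4 * E * L * (h ^ 8 * a ^ 5 * k ^ 3) * ((k * a) / y) := by
        rw [← hy2]
        field_simp
        ring
    _ ≤ 4 * E * L * (h ^ 8 * a ^ 5 * k ^ 3) * (2 * q) := by
        gcongr
        rwa [div_le_iff₀ hy]
    _ = _ := by ring

lemma sum_terms_le {b c D L Y : ℝ} (hL : 1 / 2 ≤ L) (hc : 0 ≤ c) (hD : 0 ≤ D) (hY : 0 ≤ Y) :
    192 * b ^ 2 * L ^ 2 * Y + (4 * Y + 8 * (3 * c + 24 * D) * L * Y) + 24 * D * L * Y ≤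
      (192 * b ^ 2 + 48 * c + 432 * D + 16) * L ^ 2 * Y := by
  have hLL : L ≤ 2 * L ^ 2 := by nlinarith
  have hL1 : 1 ≤ 4 * L ^ 2 := by nlinarith
  calc _ = (192 * b ^ 2 * L ^ 2 + 4 * 1 + (24 * c + 216 * D) * L) * Y := by ring
    _ ≤ (192 * b ^ 2 * L ^ 2 + 4 * (4 * L ^ 2) + (24 * c + 216 * D) * (2 * L ^ 2)) * Y := by
        gcongr
    _ = _ := by ring

/-- With enough blocks, the best window of the grid has regret of the optimal order: the window of
about `√(d H K / (B + 1))` episodes balances the drift and the cost of the restarts. -/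
theorem exists_window (𝓜 : LinearMDP S A d H K) (hd : 1 ≤ d) (hH : 1 ≤ H) (hK : 1 ≤ K) (hp : 0 < p)
    (hp1 : p < 1) (hb : 1 ≤ b) (hc : 0 ≤ c) {D : ℝ} (hD : 1 ≤ D)
    (hι : Real.log (1 / δ) ≤ D * d ^ 2 * Real.log (2 * d * totalSteps H K / p))
    {a h k q : ℝ} (ha : 1 ≤ a) (hh : 1 ≤ h) (hk : 1 ≤ k) (hq : 1 ≤ q)
    (had : a ^ 4 = d) (hhH : h ^ 4 = H) (hkK : k ^ 4 = K) (hqB : q ^ 4 = 𝓜.varθ + 𝓜.varμ + 1)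
    (hΔ : 2 ≤ numArms b d H K) (hJ : 25 * (numArms b d H K : ℝ) ^ 2 < numBlocks b d H K)
    (hkq : q ≤ k * a * h) :
    ∃ l : Fin (numArms b d H K), regretBound 𝓜 b c p δ (p / 4) (2 ^ (l : ℕ)) ≤
      (192 * b ^ 2 + 48 * c + 432 * D + 16) * Real.log (2 * d * totalSteps H K / p) ^ 2 *
        (q * a ^ 5 * h ^ 8 * k ^ 3) := by
  have hM0 := blockLen_pos hb ha hh hk had hhH hkK
  have hJ2 : 2 ≤ numBlocks b d H K := by
    have hΔ' : (2 : ℝ) ≤ numArms b d H K := by exact_mod_cast hΔ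
    exact_mod_cast (by nlinarith : (2 : ℝ) ≤ numBlocks b d H K)
  obtain ⟨hJM, hMK⟩ := numBlocks_mul_le hM0 hJ2
  -- `z ^ 2 = √(d H K / (B + 1))` is the ideal number of episodes of an epoch
  set z := k * a * h / q with hz
  have hz1 : 1 ≤ z := by rwa [hz, le_div_iff₀ (by linarith), one_mul]
  have hzq : z * q = k * a * h := div_mul_cancel₀ _ (by positivity)
  have hzM : z ^ 2 ≤ blockLen b d H K := by
    refine le_trans ?_ (blockLen_bounds hb ha hh hk had hhH hkK).1
    calc z ^ 2 ≤ (k * a * h) ^ 2 := by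
          have : z ≤ k * a * h := div_le_self (by positivity) hq
          gcongr
      _ = 1 * (h ^ 2 * a ^ 2 * k ^ 2) := by ring
      _ ≤ b * (h ^ 4 * a ^ 2 * k ^ 2) := by
          have : h ^ 2 ≤ h ^ 4 := pow_le_pow_right₀ hh (by norm_num)
          gcongr
  obtain ⟨l, hl, hnM, hnz, hzn⟩ := exists_window_length (one_le_pow₀ hz1) hzM
  refine ⟨⟨l, Nat.lt_succ_of_le hl⟩, ?_⟩
  have hn1 : 1 ≤ 2 ^ l := Nat.one_le_two_pow
  simp only
  generalize 2 ^ l = n at *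
  have hn0 : (0 : ℝ) < n := by exact_mod_cast hn1
  have hy0 : 0 < √(n : ℝ) := Real.sqrt_pos.2 hn0
  have hy2 : √(n : ℝ) ^ 2 = n := Real.sq_sqrt hn0.le
  have hyz : √(n : ℝ) ≤ z := Real.sqrt_le_iff.2 ⟨by linarith, hnz⟩
  have hzy : z ≤ 2 * √(n : ℝ) := by
    refine (pow_le_pow_iff_left₀ (by linarith) (by positivity) two_ne_zero).1 ?_
    rw [mul_pow, hy2]
    linarith
  have hL := half_le_log hd hH hK hp hp1
  have hT1 := exp3_regret_le hd hH hK hp hp1 hb ha hh hk hq had hhH hkK hΔ hJ hJM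
  have hT2 := drift_regret_le 𝓜 hH ha hh hk hq hhH hqB hzq hy0.le hyz hnz
  have hstat := epochStat_le hd hH hK hp hp1 hc hD hι hn1 (hnM.trans hMK) ha had
  rw [← hhH] at hstat
  have hT3 := stat_regret_le (numBlocks b d H K).cast_nonneg hn0
    (hJM.trans_eq (by rw [hkK])) (by exact_mod_cast hnM) (r := blockLen b d H K / n)
    Nat.cast_div_le (by linarith) (by linarith) ha hh hk hq hstat hy0 hy2 hzq hzy
  have hT4 : H * sumRadius K (2 * H) δ ≤ 24 * D * Real.log (2 * d * totalSteps H K / p) *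
      (q * a ^ 5 * h ^ 8 * k ^ 3) := by
    have hrad := sumRadius_le hd hH hK hp hp1 hD hι hK le_rfl
    have h1 := mul_pow_le ha hh hk hq (i := 0) (j := 4) (l := 8) (n := 2) (by norm_num)
      (by norm_num) (by norm_num) (by norm_num)
    have h2 : √(K : ℝ) = k ^ 2 := by
      rw [← hkK, show k ^ 4 = (k ^ 2) ^ 2 by ring, Real.sqrt_sq (by positivity)]
    rw [h2] at hrad
    calc _ ≤ H * (24 * D * Real.log (2 * d * totalSteps H K / p) * (H * d) * k ^ 2) := by gcongr
      _ = 24 * D * Real.log (2 * d * totalSteps H K / p) * (q ^ 0 * a ^ 4 * h ^ 8 * k ^ 2) := by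
          rw [← hhH, ← had]
          ring
      _ ≤ _ := by gcongr
  rw [regretBound, sum_blockBound hM0]
  exact (add_le_add (add_le_add hT1 (add_le_add hT2 hT3)) hT4).trans
    (sum_terms_le hL hc (by linarith) (by positivity))

/-- If there is a single window size, there are few blocks, or the total variation is large, the
trivial bound is good enough. -/
theorem mul_le_of_few_blocks (hd : 1 ≤ d) (hH : 1 ≤ H) (hK : 1 ≤ K) (hp : 0 < p)
    (hp1 : p < 1) (hb : 1 ≤ b) {a h k q : ℝ} (ha : 1 ≤ a) (hh : 1 ≤ h) (hk : 1 ≤ k) (hq : 1 ≤ q)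
    (had : a ^ 4 = d) (hhH : h ^ 4 = H) (hkK : k ^ 4 = K)
    (hcase : ¬ (2 ≤ numArms b d H K ∧ 25 * (numArms b d H K : ℝ) ^ 2 < numBlocks b d H K ∧
      q ≤ k * a * h)) :
    (K : ℝ) * H ≤ 192 * b ^ 2 * Real.log (2 * d * totalSteps H K / p) ^ 2 *
      (q * a ^ 5 * h ^ 8 * k ^ 3) := by
  have hL := half_le_log hd hH hK hp hp1
  obtain ⟨hMlo, hMhi⟩ := blockLen_bounds hb ha hh hk had hhH hkK
  have hM0 := blockLen_pos hb ha hh hk had hhH hkK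
  have hΔ6 := numArms_le_log hd hH hK hp hp1 hb ha hh hk had hhH hkK
  set L := Real.log (2 * d * totalSteps H K / p) with hLdef
  have hbL : 1 ≤ 4 * (b ^ 2 * L ^ 2) := by
    have h1 : (1 : ℝ) ≤ b ^ 2 := one_le_pow₀ hb
    have h2 : 1 ≤ 4 * L ^ 2 := by nlinarith
    nlinarith
  -- it suffices to bound `k = K ^ (1 / 4)`
  have key : k ≤ 192 * b ^ 2 * L ^ 2 * (q * a ^ 5 * h ^ 4) → (K : ℝ) * H ≤ 192 * b ^ 2 * L ^ 2 *
      (q * a ^ 5 * h ^ 8 * k ^ 3) := fun hle => by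
    rw [← hkK, ← hhH]
    calc k ^ 4 * h ^ 4 = k * (h ^ 4 * k ^ 3) := by ring
      _ ≤ 192 * b ^ 2 * L ^ 2 * (q * a ^ 5 * h ^ 4) * (h ^ 4 * k ^ 3) := by gcongr
      _ = _ := by ring
  have h1Y : 1 ≤ q * a ^ 5 * h ^ 4 := one_le_mul_of_one_le_of_one_le
    (one_le_mul_of_one_le_of_one_le hq (one_le_pow₀ ha)) (one_le_pow₀ hh)
  refine key ?_
  -- the cases: large total variation, few blocks, a single window size
  by_cases hΔ : 2 ≤ numArms b d H K
  · by_cases hJ : 25 * (numArms b d H K : ℝ) ^ 2 < numBlocks b d H K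
    · have hkq : k * a * h < q := not_le.1 fun h' => hcase ⟨hΔ, hJ, h'⟩
      calc k ≤ k * a * h := by
            rw [mul_assoc]
            exact le_mul_of_one_le_right (by linarith)
              (one_le_mul_of_one_le_of_one_le ha hh)
        _ ≤ 1 * q := by linarith
        _ ≤ (192 * b ^ 2 * L ^ 2) * (q * a ^ 5 * h ^ 4) := by
            have : q ≤ q * a ^ 5 * h ^ 4 := by
              rw [mul_assoc]
              exact le_mul_of_one_le_right (by linarith)
                (one_le_mul_of_one_le_of_one_le (one_le_pow₀ ha) (one_le_pow₀ hh))
            gcongr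
            linarith
    · have h1 : (K : ℝ) ≤ numBlocks b d H K * blockLen b d H K := by
        exact_mod_cast le_numBlocks_mul hM0
      have h2 : k ^ 2 ≤ (8 * b * (6 * b * L) * (h ^ 2 * a)) ^ 2 := by
        have h3 : k ^ 2 * k ^ 2 ≤ (50 * (6 * b * L) ^ 2 * (b * (h ^ 4 * a ^ 2))) * k ^ 2 := by
          calc k ^ 2 * k ^ 2 = K := by rw [← hkK]; ring
            _ ≤ (25 * (numArms b d H K : ℝ) ^ 2) * (2 * b * (h ^ 4 * a ^ 2 * k ^ 2)) :=
              h1.trans (mul_le_mul (not_lt.1 hJ) hMhi (by positivity) (by positivity))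
            _ ≤ (25 * (6 * b * L) ^ 2) * (2 * b * (h ^ 4 * a ^ 2 * k ^ 2)) := by gcongr
            _ = _ := by ring
        calc k ^ 2 ≤ 50 * (6 * b * L) ^ 2 * (b * (h ^ 4 * a ^ 2)) :=
              le_of_mul_le_mul_right h3 (by positivity)
          _ ≤ 64 * (6 * b * L) ^ 2 * (b ^ 2 * (h ^ 4 * a ^ 2)) := by
              have : b ≤ b ^ 2 := le_self_pow₀ hb two_ne_zero
              gcongr
              norm_num
          _ = _ := by ring
      have h3 := (pow_le_pow_iff_left₀ (by positivity) (by positivity) two_ne_zero).1 h2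
      calc k ≤ 48 * b ^ 2 * L * (h ^ 2 * a) := by linarith
        _ ≤ 48 * b ^ 2 * (2 * L ^ 2) * (q * a ^ 5 * h ^ 4) := by
            have h4 : L ≤ 2 * L ^ 2 := by nlinarith
            have h5 : h ^ 2 * a ≤ q * a ^ 5 * h ^ 4 := by
              calc h ^ 2 * a = 1 * a ^ 1 * h ^ 2 := by ring
                _ ≤ q * a ^ 5 * h ^ 4 := by
                  gcongr <;> first | assumption | norm_num
            gcongr
        _ ≤ _ := by
            have : 0 ≤ b ^ 2 * L ^ 2 * (q * a ^ 5 * h ^ 4) := by positivity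
            linarith
  · have hM2 : blockLen b d H K < 2 := by
      by_contra hcon
      have := Nat.log_pos (b := 2) (by norm_num) (not_lt.1 hcon)
      rw [numArms] at hΔ
      omega
    have hM1' : (blockLen b d H K : ℝ) ≤ 1 := by exact_mod_cast Nat.le_of_lt_succ hM2
    have hk1 : k ≤ 1 := by
      calc k ≤ k ^ 2 := le_self_pow₀ hk two_ne_zero
        _ ≤ b * (h ^ 4 * a ^ 2) * k ^ 2 := le_mul_of_one_le_left (by positivity)
            (one_le_mul_of_one_le_of_one_le hb
              (one_le_mul_of_one_le_of_one_le (one_le_pow₀ hh) (one_le_pow₀ ha)))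
        _ = b * (h ^ 4 * a ^ 2 * k ^ 2) := by ring
        _ ≤ 1 := hMlo.trans hM1'
    exact hk1.trans (one_le_mul_of_one_le_of_one_le (by linarith) h1Y)

/-- The target in terms of the fourth roots, as `T = K H`. -/
lemma rpow_target {a h k q : ℝ} (ha : 0 ≤ a) (hh : 0 ≤ h) (hk : 0 ≤ k) (hq : 0 ≤ q) :
    (q ^ 4) ^ (1 / 4 : ℝ) * (a ^ 4) ^ (5 / 4 : ℝ) * (h ^ 4) ^ (5 / 4 : ℝ) *
      (k ^ 4 * h ^ 4) ^ (3 / 4 : ℝ) = q * a ^ 5 * h ^ 8 * k ^ 3 := by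
  have key : ∀ (x : ℝ) (n : ℕ), 0 ≤ x → (x ^ 4) ^ ((n : ℝ) / 4) = x ^ n := fun x n hx => by
    rw [← Real.rpow_natCast x 4, ← Real.rpow_mul hx, ← Real.rpow_natCast x n]
    congr 1
    push_cast
    ring
  have h1 := key q 1 hq
  have h2 := key a 5 ha
  have h3 := key h 5 hh
  have h4 := key (k * h) 3 (by positivity)
  norm_num at h1 h2 h3 h4 ⊢
  rw [h1, h2, h3, ← mul_pow, h4]
  ring

end Tuning

end NonstatRL

theorem mainTheorem2 :
    ∃ (m : ℕ) (c₀ : ℝ), 0 < c₀ ∧ ∀ c : ℝ, c₀ ≤ c → ∀ b : ℝ, 1 ≤ b → ∃ C : ℝ, 0 < C ∧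
      ∀ (d H K : ℕ), 1 ≤ d → 1 ≤ H → 1 ≤ K → ∀ p : ℝ, 0 < p → p < 1 →
      ∀ (S : Type u) (A : Type v) [MeasurableSpace S] [MeasurableSpace A]
        [MeasurableSingletonClass A] [Finite A] [Nonempty A]
        (𝓜 : NonstatRL.LinearMDP S A d H K) (sel : NonstatRL.ArgmaxRule A)
        (Ω : Type w) [MeasurableSpace Ω] (P : Measure Ω) [IsProbabilityMeasure P]
        (ℱ : Filtration ℕ (inferInstance : MeasurableSpace Ω))
        (st : ℕ → ℕ → Ω → S) (ac : ℕ → ℕ → Ω → A)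
        (arm : ℕ → Ω → Fin (NonstatRL.numArms b d H K)),
        NonstatRL.IsAdaRun 𝓜 sel c b p P ℱ st ac arm →
        ENNReal.ofReal (1 - p) ≤
          P {ω | NonstatRL.dynRegret 𝓜 sel c b p st ac arm ω ≤
            C * Real.log (2 * d * NonstatRL.totalSteps H K / p) ^ m *
              ((𝓜.varθ + 𝓜.varμ + 1) ^ (1 / 4 : ℝ) * (d : ℝ) ^ (5 / 4 : ℝ) *
                (H : ℝ) ^ (5 / 4 : ℝ) * (NonstatRL.totalSteps H K) ^ (3 / 4 : ℝ))} := by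
  refine ⟨2, 10000, by norm_num, fun c hc b hb => ?_⟩
  have hD : 1 ≤ NonstatRL.confConst c := by
    have := Real.log_nonneg (by linarith : (1 : ℝ) ≤ c)
    rw [NonstatRL.confConst]
    linarith
  refine ⟨192 * b ^ 2 + 48 * c + 432 * NonstatRL.confConst c + 16, by positivity, ?_⟩
  intro d H K hd hH hK p hp hp1 S A _ _ _ _ _ 𝓜 sel Ω _ P _ ℱ st ac arm hrun
  obtain ⟨a, ha, had⟩ := NonstatRL.exists_pow_four_eq (by exact_mod_cast hd : (1 : ℝ) ≤ d)
  obtain ⟨h, hh, hhH⟩ := NonstatRL.exists_pow_four_eq (by exact_mod_cast hH : (1 : ℝ) ≤ H)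
  obtain ⟨k, hk, hkK⟩ := NonstatRL.exists_pow_four_eq (by exact_mod_cast hK : (1 : ℝ) ≤ K)
  obtain ⟨q, hq, hqB⟩ := NonstatRL.exists_pow_four_eq
    (by linarith [NonstatRL.varθ_nonneg 𝓜, NonstatRL.varμ_nonneg 𝓜] :
      (1 : ℝ) ≤ 𝓜.varθ + 𝓜.varμ + 1)
  have htarget := NonstatRL.rpow_target (by linarith : 0 ≤ a) (by linarith : 0 ≤ h)
    (by linarith : 0 ≤ k) (by linarith : 0 ≤ q)
  rw [had, hhH, hkK, hqB] at htarget
  simp only [NonstatRL.totalSteps] at htarget ⊢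
  rw [htarget]
  -- either there are enough blocks and the ideal window is not too short, or the trivial bound
  -- works
  by_cases hcase : 2 ≤ NonstatRL.numArms b d H K ∧
      25 * (NonstatRL.numArms b d H K : ℝ) ^ 2 < NonstatRL.numBlocks b d H K ∧ q ≤ k * a * h
  · obtain ⟨hΔ, hJ, hkq⟩ := hcase
    obtain ⟨ε, δ, N, hP, hδ, hδ1, hZ, hι⟩ := NonstatRL.exists_confParams hd hH hK hp hp1 hc
    have hM : 0 < NonstatRL.blockLen b d H K := by
      by_contra hcon
      have : NonstatRL.blockLen b d H K = 0 := by omega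
      simp [NonstatRL.numArms, this] at hΔ
    obtain ⟨l, hl⟩ := NonstatRL.exists_window (c := c) 𝓜 hd hH hK hp hp1 hb (by linarith) hD hι
      ha hh hk hq had hhH hkK hqB hΔ hJ hkq
    refine (hrun.measure_dynRegret_le hP (NonstatRL.exp3_params hM hΔ hJ).1 hH hδ hδ1
      (by linarith) (by linarith) l hZ).trans (measure_mono fun ω hω => ?_)
    exact le_trans hω hl
  · have hall : ∀ ω, NonstatRL.dynRegret 𝓜 sel c b p st ac arm ω ≤
        (192 * b ^ 2 + 48 * c + 432 * NonstatRL.confConst c + 16) *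
          Real.log (2 * d * (K * H) / p) ^ 2 * (q * a ^ 5 * h ^ 8 * k ^ 3) := fun ω => by
      refine NonstatRL.dynRegret_le_mul.trans ((NonstatRL.mul_le_of_few_blocks hd hH hK hp hp1 hb
        ha hh hk hq had hhH hkK hcase).trans ?_)
      rw [NonstatRL.totalSteps]
      gcongr
      linarith
    calc ENNReal.ofReal (1 - p) ≤ 1 := ENNReal.ofReal_le_one.2 (by linarith)
      _ = P Set.univ := measure_univ.symm
      _ ≤ _ := measure_mono fun ω _ => hall ω

end
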